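/- **Setting.** Let $K$ be a field and $A=K[a_1,\dots,a_n]$ a $K$-algebra for which the monomials $a^\alpha=a_1^{\alpha_1}\cdots a_n^{\alpha_n}$, $\alpha\in\mathbb N^n$, form a $K$-basis $\mathscr B$. Let $\prec$ be a monomial ordering on $\mathscr B$, i.e. a well-ordering such that (a) $a^\alpha\prec a^\beta$ implies $\mathbf{LM}(a^\gamma a^\alpha a^\eta)\prec\mathbf{LM}(a^\gamma a^\beta a^\eta)$ whenever these leading monomials are not in $K$, and (b) $a^\gamma=\mathbf{LM}(a^\alpha a^\beta a^\eta)\neq a^\beta$ implies $a^\beta\prec a^\gamma$. Assume that $A$ is a solvable polynomial algebra: for all $\alpha,\beta$ one has $a^\alpha a^\beta=\lambda a^{\alpha+\beta}+f$ with $\lambda\in K^*$ and either $f=0$ or $\mathbf{LM}(f)\prec a^{\alpha+\beta}$. Let $d(a^\alpha)=\sum_i d_i\alpha_i$ with integers $d_i>0$, and assume that $\prec$ is graded: $a^\alpha\prec a^\beta$ implies $d(a^\alpha)\le d(a^\beta)$. Put $F_pA=K\text{-span}\{a^\alpha: d(a^\alpha)\le p\}$. Let $L=\bigoplus_{i=1}^s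 Ae_i$ be a free left $A$-module, let $b_1,\dots,b_s\in\mathbb N$, and put $F_qL=K\text{-span}\{a^\alpha e_i: d(a^\alpha)+b_i\le q\}$. Let $\prec_e$ be a graded left monomial ordering on the monomials $a^\alpha e_i$ of $L$, i.e. a total ordering such that $a^\alpha e_i\prec_e a^\beta e_j$ implies $\mathbf{LM}(a^\gamma a^\alpha e_i)\prec_e\mathbf{LM}(a^\gamma a^\beta e_j)$ and $d(a^\alpha)+b_i\le d(a^\beta)+b_j$, and $a^\alpha\prec a^\beta$ implies $a^\alpha e_i\prec_e a^\beta e_i$. A *left Gröbner basis* of a submodule $N\subseteq L$ is a finite set of nonzero elements of $N$ such that the leading monomial of every nonzero element of $N$ is divisible by the leading monomial of one of them. Let $G(A)=\bigoplus_p F_pA/F_{p-1}A$ and $G(L)=\bigoplus_q F_qL/F_{q-1}L$ be the associated graded ring and module (with $F_{-1}=0$), and let $\sigma(x)$ denote the principal symbol of $x$. The elements $\sigma(a)^\alpha\sigma(e_i)$, where $\sigma(a)^\alpha=\sigma(a_1)^{\alpha_1}\cdots\sigma(a_n)^{\alpha_n}$, are the monomials of $G(L)$; order them by $\sigma(a)^\alpha\sigma(e_i)\prec_{\sigma(e)}\sigma(a)^\beta\sigma(e_j)\Leftrightarrow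 a^\alpha e_i\prec_e a^\beta e_j$. For a submodule $N$ of $L$ with the induced filtration $F_qN=F_qL\cap N$, view $G(N)=\bigoplus_q F_qN/F_{q-1}N$ as a graded $G(A)$-submodule of $G(L)$. A finite set $W\subseteq N\setminus\{0\}$ is a *standard basis* of $N$ if there are numbers $n_w\in\mathbb N$ $(w\in W)$ with $F_qN=\sum_{w\in W}\bigl(\sum_{p+n_w\le q}F_pA\bigr)w$ for all $q$; it is *minimal* if no proper subset of $W$ is a standard basis of $N$. **Algorithms.** Division of an element $v$ by a finite list $\mathcal G$ of nonzero elements: as long as the current $v$ is nonzero, if $\mathbf{LM}(v)=\mathbf{LM}(a^\gamma g)$ for some $g\in\mathcal G$ and some $a^\gamma$, replace $v$ by $v-\frac{\mathbf{LC}(v)}{\mathbf{LC}(a^\gamma g)}a^\gamma g$ (for any such choice); otherwise move the leading term of $v$ to the remainder. The left S-polynomial of $f,g$ with $\mathbf{LM}(f)=a^\alpha e_p$, $\mathbf{LM}(g)=a^\beta e_p$ is $\mathbf{LC}(a^{\gamma-\alpha}f)^{-1}a^{\gamma-\alpha}f-\mathbf{LC}(a^{\gamma-\beta}g)^{-1}a^{\gamma-\beta}g$,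 where $\gamma=\max(\alpha,\beta)$ componentwise. The same operations are used in $G(L)$, with the $\sigma(a)^\alpha\sigma(e_i)$ as monomials. *Buchberger's algorithm*, for a list $\Theta$: start with $\mathcal G=\Theta$ and the set $\mathcal S$ of the S-polynomials of the pairs of elements of $\mathcal G$; while $\mathcal S\neq\emptyset$, remove any element from $\mathcal S$ and divide it by $\mathcal G$; if the remainder $\eta$ is nonzero, add to $\mathcal S$ the S-polynomials of the elements of $\mathcal G$ with $\eta$ and append $\eta$ to $\mathcal G$. *Selection algorithm*, for nonzero homogeneous elements $u_1,\dots,u_m$ of $G(L)$: start with $\mathcal G=\emptyset$, $\mathcal S=\emptyset$, $J=\emptyset$; while some $u_j$ has not been treated, take an element of least degree among the elements of $\mathcal S$ and the untreated $u_j$ (elements of $\mathcal S$ first if there is a tie), remove it and divide it by $\mathcal G$; if the remainder $\eta$ is nonzero, add to $\mathcal S$ the nonzero S-polynomials of the elements of $\mathcal G$ with $\eta$, append $\eta$ to $\mathcal G$, and, if the divided element was $u_j$, add $j$ to $J$. The output is $J$. **Theorem 5.4.** Let $N=\sum_{i=1}^cA\theta_i$ be a submodule of $L$ generated by nonzero elements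 $\theta_1,\dots,\theta_c$. Then a minimal standard basis of $N$ is obtained by the following procedures. 1. Every run of Buchberger's algorithm on $\theta_1,\dots,\theta_c$ with respect to $\prec_e$ terminates, and its output is a left Gröbner basis of $N$. 2. Let $U=\{\xi_1,\dots,\xi_m\}$ be any left Gröbner basis of $N$ with respect to $\prec_e$, for example the output of step 1. Then $\sigma(U)=\{\sigma(\xi_1),\dots,\sigma(\xi_m)\}$ is a homogeneous left Gröbner basis of $G(N)$ with respect to $\prec_{\sigma(e)}$, and every run of the selection algorithm on $\sigma(\xi_1),\dots,\sigma(\xi_m)$ terminates with a set $J=\{j_1,\dots,j_t\}$ of indices such that $\sigma(\xi_{j_1}),\dots,\sigma(\xi_{j_t})$ are pairwise distinct and form a minimal homogeneous generating set of $G(N)$. 3. $W=\{\xi_{j_1},\dots,\xi_{j_t}\}$ is then a minimal standard basis of $N$. More generally, this holds for every set $J=\{j_1,\dots,j_t\}\subseteq\{1,\dots,m\}$ of indices for which $\sigma(\xi_{j_1}),\dots,\sigma(\xi_{j_t})$ are pairwise distinct and form a minimal homogeneous generating set of $G(N)$. -/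

import Mathlib

open scoped DirectSum

noncomputable section

namespace SolvPoly

/-! ### Monomials, leading terms, solvable polynomial algebras -/

/-- The standard monomial `a^α = a₁^{α₁} ⋯ aₙ^{αₙ}` (in this order of the factors). -/
def mon {R : Type*} [Ring R] {n : ℕ} (a : Fin n → R) (α : Fin n →₀ ℕ) : R :=
  (List.ofFn fun i => a i ^ α i).prod

/-- `v` is nonzero, `μ` is its leading monomial and `c` its leading coefficient: `v` is a linear
combination of the monomials `m i` in which `m μ` has the coefficient `c ≠ 0` and all other
monomials that occur are smaller. It is used for families `m` that are `K`-bases. -/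
def IsLeading (K : Type*) {V ι : Type*} [Field K] [AddCommGroup V] [Module K V]
    (m : ι → V) (lt : ι → ι → Prop) (v : V) (μ : ι) (c : K) : Prop :=
  ∃ f : ι →₀ K, Finsupp.linearCombination K m f = v ∧ f μ = c ∧ c ≠ 0 ∧
    ∀ ν, f ν ≠ 0 → ν = μ ∨ lt ν μ

/-- `LM(v) = m μ`. -/
def IsLM (K : Type*) {V ι : Type*} [Field K] [AddCommGroup V] [Module K V]
    (m : ι → V) (lt : ι → ι → Prop) (v : V) (μ : ι) : Prop :=
  ∃ c : K, IsLeading K m lt v μ c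

/-- `lt` is a monomial ordering on the set of the monomials `a^α`. -/
structure IsMonomialOrdering (K : Type*) {A : Type*} [Field K] [Ring A] [Algebra K A] {n : ℕ}
    (a : Fin n → A) (lt : (Fin n →₀ ℕ) → (Fin n →₀ ℕ) → Prop) : Prop where
  total : IsStrictTotalOrder (Fin n →₀ ℕ) lt
  wf : WellFounded lt
  /-- Multiplication from both sides preserves the ordering; the monomial with exponent `0` is
  the one in `K`. -/
  mul_lt : ∀ α β γ η μ ν : Fin n →₀ ℕ, lt α β →
    IsLM K (mon a) lt (mon a γ * mon a α * mon a η) μ →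
    IsLM K (mon a) lt (mon a γ * mon a β * mon a η) ν → μ ≠ 0 → ν ≠ 0 → lt μ ν
  lt_of_ne : ∀ α β γ η : Fin n →₀ ℕ, β ≠ γ →
    IsLM K (mon a) lt (mon a α * mon a β * mon a η) γ → lt β γ

/-- `A = K[a₁, …, aₙ]` is a solvable polynomial algebra with the PBW basis of all `a^α` and the
monomial ordering `lt`. -/
structure IsSolvable (K : Type*) {A : Type*} [Field K] [Ring A] [Algebra K A] {n : ℕ}
    (a : Fin n → A) (lt : (Fin n →₀ ℕ) → (Fin n →₀ ℕ) → Prop) : Prop where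
  linearIndependent : LinearIndependent K (mon a)
  span_eq_top : Submodule.span K (Set.range (mon a)) = ⊤
  ordering : IsMonomialOrdering K a lt
  mul_eq : ∀ α β : Fin n →₀ ℕ, ∃ (c : K) (f : A), c ≠ 0 ∧
    mon a α * mon a β = c • mon a (α + β) + f ∧
    (f ≠ 0 → ∃ μ, IsLM K (mon a) lt f μ ∧ lt μ (α + β))

/-- The degree `d(a^α) = ∑ d(aᵢ) αᵢ`. -/
def wdeg {n : ℕ} (d : Fin n → ℕ) (α : Fin n →₀ ℕ) : ℕ := ∑ i, d i * α i

/-- `A` is a solvable polynomial algebra with respect to `lt`, the degree function `d` is positive,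
and `lt` is a graded monomial ordering with respect to `d`. -/
structure IsGradedSolvable (K : Type*) {A : Type*} [Field K] [Ring A] [Algebra K A] {n : ℕ}
    (a : Fin n → A) (lt : (Fin n →₀ ℕ) → (Fin n →₀ ℕ) → Prop) (d : Fin n → ℕ) : Prop where
  solvable : IsSolvable K a lt
  pos : ∀ i, 0 < d i
  graded : ∀ α β, lt α β → wdeg d α ≤ wdeg d β

/-! ### Filtrations and associated graded objects -/

/-- An exhaustive `ℕ`-filtration of a `K`-algebra. -/
structure RingFiltration (K A : Type*) [Field K] [Ring A] [Algebra K A] where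
  F : ℕ → Submodule K A
  mono : Monotone F
  exhaustive : ∀ x, ∃ p, x ∈ F p
  one_mem : (1 : A) ∈ F 0
  mul_mem : ∀ {p q x y}, x ∈ F p → y ∈ F q → x * y ∈ F (p + q)

/-- An exhaustive `ℕ`-filtration of a module over a filtered algebra. -/
structure ModuleFiltration {K A : Type*} [Field K] [Ring A] [Algebra K A]
    (FA : RingFiltration K A) (M : Type*) [AddCommGroup M] [Module K M] [Module A M] where
  F : ℕ → Submodule K M
  mono : Monotone F
  exhaustive : ∀ x, ∃ q, x ∈ F q
  smul_mem : ∀ {p q x y}, x ∈ FA.F p → y ∈ F q → x • y ∈ F (p + q)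

section Graded

variable {K : Type*} [Field K]

/-- `F_{p-1}`, where `F_{-1} = 0`. -/
def lower {V : Type*} [AddCommGroup V] [Module K V] (F : ℕ → Submodule K V) : ℕ → Submodule K V
  | 0 => ⊥
  | p + 1 => F p

/-- The graded piece `F_p / F_{p-1}`. -/
def Piece {V : Type*} [AddCommGroup V] [Module K V] (F : ℕ → Submodule K V) (p : ℕ) : Type _ :=
  F p ⧸ (lower F p).submoduleOf (F p)

instance Piece.addCommGroup {V : Type*} [AddCommGroup V] [Module K V] (F : ℕ → Submodule K V)
    (p : ℕ) : AddCommGroup (Piece F p) :=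
  inferInstanceAs (AddCommGroup (F p ⧸ (lower F p).submoduleOf (F p)))

instance Piece.module {V : Type*} [AddCommGroup V] [Module K V] (F : ℕ → Submodule K V)
    (p : ℕ) : Module K (Piece F p) :=
  inferInstanceAs (Module K (F p ⧸ (lower F p).submoduleOf (F p)))

/-- The class of `x ∈ F_p` in `F_p / F_{p-1}`. -/
def cls {V : Type*} [AddCommGroup V] [Module K V] (F : ℕ → Submodule K V) (p : ℕ) :
    F p →ₗ[K] Piece F p := Submodule.mkQ ((lower F p).submoduleOf (F p))

theorem cls_surjective {V : Type*} [AddCommGroup V] [Module K V] (F : ℕ → Submodule K V) (p : ℕ) :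
    Function.Surjective (cls F p) := Submodule.mkQ_surjective _

theorem cls_eq_iff {V : Type*} [AddCommGroup V] [Module K V] (F : ℕ → Submodule K V) (p : ℕ)
    (x y : F p) : cls F p x = cls F p y ↔ (x : V) - y ∈ lower F p := by
  exact Submodule.Quotient.eq _

theorem mk_cls_eq {V : Type*} [AddCommGroup V] [Module K V] (F : ℕ → Submodule K V) {p q : ℕ}
    (h : p = q) (x : F p) (y : F q) (hxy : (x : V) = y) :
    GradedMonoid.mk (A := Piece F) p (cls F p x) = GradedMonoid.mk q (cls F q y) := by
  subst h
  obtain rfl : x = y := Subtype.ext hxy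
  rfl

variable {A : Type*} [Ring A] [Algebra K A] (FA : RingFiltration K A)

theorem RingFiltration.mul_lower {p q : ℕ} {x y : A} (hx : x ∈ FA.F p)
    (hy : y ∈ lower FA.F q) : x * y ∈ lower FA.F (p + q) := by
  cases q with
  | zero => rw [lower, Submodule.mem_bot] at hy; subst hy; rw [mul_zero]; exact zero_mem _
  | succ q => exact FA.mul_mem hx hy

theorem RingFiltration.lower_mul {p q : ℕ} {x y : A} (hx : x ∈ lower FA.F p)
    (hy : y ∈ FA.F q) : x * y ∈ lower FA.F (p + q) := by
  cases p with
  | zero => rw [lower, Submodule.mem_bot] at hx; subst hx; rw [zero_mul]; exact zero_mem _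
  | succ p => rw [Nat.succ_add]; exact FA.mul_mem hx hy

/-- The product `F_p/F_{p-1} × F_q/F_{q-1} → F_{p+q}/F_{p+q-1}`. -/
def RingFiltration.pieceMul {p q : ℕ} : Piece FA.F p → Piece FA.F q → Piece FA.F (p + q) :=
  Quotient.map₂ (fun x y => ⟨x.1 * y.1, FA.mul_mem x.2 y.2⟩) (by
    intro x x' hx y y' hy
    have hx' : (x : A) - x' ∈ lower FA.F p := (cls_eq_iff FA.F p x x').1 (Quotient.sound hx)
    have hy' : (y : A) - y' ∈ lower FA.F q := (cls_eq_iff FA.F q y y').1 (Quotient.sound hy)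
    refine Quotient.exact ((cls_eq_iff FA.F (p + q) ⟨x.1 * y.1, _⟩ ⟨x'.1 * y'.1, _⟩).2 ?_)
    have := add_mem (FA.mul_lower x.2 hy') (FA.lower_mul hx' y'.2)
    simpa [mul_sub, sub_mul] using this)

instance RingFiltration.gOne : GradedMonoid.GOne (fun p => Piece FA.F p) where
  one := cls FA.F 0 ⟨1, FA.one_mem⟩

instance RingFiltration.gMul : GradedMonoid.GMul (fun p => Piece FA.F p) where
  mul := FA.pieceMul

instance RingFiltration.gMonoid : GradedMonoid.GMonoid (fun p => Piece FA.F p) where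
  __ := FA.gOne
  __ := FA.gMul
  one_mul := by
    rintro ⟨i, ⟨x⟩⟩; exact mk_cls_eq FA.F (zero_add i) _ _ (one_mul x.1)
  mul_one := by
    rintro ⟨i, ⟨x⟩⟩; exact mk_cls_eq FA.F (add_zero i) _ _ (mul_one x.1)
  mul_assoc := by
    rintro ⟨i, ⟨x⟩⟩ ⟨j, ⟨y⟩⟩ ⟨k, ⟨z⟩⟩
    exact mk_cls_eq FA.F (add_assoc i j k) _ _ (mul_assoc x.1 y.1 z.1)

instance RingFiltration.gRing : DirectSum.GRing (fun p => Piece FA.F p) where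
  __ := FA.gMonoid
  mul_zero := by
    rintro i j ⟨x⟩; exact congrArg (cls FA.F (i + j)) (Subtype.ext (mul_zero x.1))
  zero_mul := by
    rintro i j ⟨x⟩; exact congrArg (cls FA.F (i + j)) (Subtype.ext (zero_mul x.1))
  mul_add := by
    rintro i j ⟨x⟩ ⟨y⟩ ⟨z⟩
    exact congrArg (cls FA.F (i + j)) (Subtype.ext (mul_add x.1 y.1 z.1))
  add_mul := by
    rintro i j ⟨x⟩ ⟨y⟩ ⟨z⟩
    exact congrArg (cls FA.F (i + j)) (Subtype.ext (add_mul x.1 y.1 z.1))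
  natCast m := m • cls FA.F 0 ⟨1, FA.one_mem⟩
  natCast_zero := zero_smul _ _
  natCast_succ m := succ_nsmul _ _
  intCast m := m • cls FA.F 0 ⟨1, FA.one_mem⟩
  intCast_ofNat m := natCast_zsmul _ _
  intCast_negSucc_ofNat m := negSucc_zsmul _ _

/-- The associated graded ring `G(A) = ⨁ F_pA / F_{p-1}A`. -/
abbrev RingFiltration.Gr : Type _ := ⨁ p, Piece FA.F p

variable {M : Type*} [AddCommGroup M] [Module K M] [Module A M] {FA}
  (FM : ModuleFiltration FA M)

theorem ModuleFiltration.smul_lower {p q : ℕ} {x : A} {y : M} (hx : x ∈ FA.F p)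
    (hy : y ∈ lower FM.F q) : x • y ∈ lower FM.F (p + q) := by
  cases q with
  | zero => rw [lower, Submodule.mem_bot] at hy; subst hy; rw [smul_zero]; exact zero_mem _
  | succ q => exact FM.smul_mem hx hy

theorem ModuleFiltration.lower_smul {p q : ℕ} {x : A} {y : M} (hx : x ∈ lower FA.F p)
    (hy : y ∈ FM.F q) : x • y ∈ lower FM.F (p + q) := by
  cases p with
  | zero => rw [lower, Submodule.mem_bot] at hx; subst hx; rw [zero_smul]; exact zero_mem _
  | succ p => rw [Nat.succ_add]; exact FM.smul_mem hx hy

/-- The action `F_pA/F_{p-1}A × F_qM/F_{q-1}M → F_{p+q}M/F_{p+q-1}M`. -/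
def ModuleFiltration.pieceSMul {p q : ℕ} : Piece FA.F p → Piece FM.F q → Piece FM.F (p + q) :=
  Quotient.map₂ (fun x y => ⟨x.1 • y.1, FM.smul_mem x.2 y.2⟩) (by
    intro x x' hx y y' hy
    have hx' : (x : A) - x' ∈ lower FA.F p := (cls_eq_iff FA.F p x x').1 (Quotient.sound hx)
    have hy' : (y : M) - y' ∈ lower FM.F q := (cls_eq_iff FM.F q y y').1 (Quotient.sound hy)
    refine Quotient.exact ((cls_eq_iff FM.F (p + q) ⟨x.1 • y.1, _⟩ ⟨x'.1 • y'.1, _⟩).2 ?_)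
    have := add_mem (FM.smul_lower x.2 hy') (FM.lower_smul hx' y'.2)
    simpa [smul_sub, sub_smul] using this)

instance ModuleFiltration.gmodule :
    DirectSum.Gmodule (fun p => Piece FA.F p) (fun q => Piece FM.F q) where
  smul := FM.pieceSMul
  one_smul := by
    rintro ⟨i, ⟨x⟩⟩; exact mk_cls_eq FM.F (zero_add i) _ _ (one_smul A x.1)
  mul_smul := by
    rintro ⟨i, ⟨x⟩⟩ ⟨j, ⟨y⟩⟩ ⟨k, ⟨z⟩⟩
    exact mk_cls_eq FM.F (add_assoc i j k) _ _ (mul_smul x.1 y.1 z.1)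
  smul_add := by
    rintro i j ⟨x⟩ ⟨y⟩ ⟨z⟩
    exact congrArg (cls FM.F (i + j)) (Subtype.ext (smul_add x.1 y.1 z.1))
  smul_zero := by
    rintro i j ⟨x⟩; exact congrArg (cls FM.F (i + j)) (Subtype.ext (smul_zero x.1))
  add_smul := by
    rintro i j ⟨x⟩ ⟨y⟩ ⟨z⟩
    exact congrArg (cls FM.F (i + j)) (Subtype.ext (add_smul x.1 y.1 z.1))
  zero_smul := by
    rintro i j ⟨x⟩; exact congrArg (cls FM.F (i + j)) (Subtype.ext (zero_smul A x.1))

/-- The associated graded `G(A)`-module `G(M) = ⨁ F_qM / F_{q-1}M`. -/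
abbrev ModuleFiltration.Gr : Type _ := ⨁ q, Piece FM.F q

/-- The filtered degree of `x` (meaningful for `x ≠ 0`). -/
def RingFiltration.deg (FA : RingFiltration K A) (x : A) : ℕ := sInf {p | x ∈ FA.F p}

/-- The principal symbol `σ(x) ∈ G(A)`. -/
def RingFiltration.symbol (FA : RingFiltration K A) (x : A) : FA.Gr :=
  DirectSum.of (fun p => Piece FA.F p) (FA.deg x)
    (cls FA.F (FA.deg x) ⟨x, Nat.sInf_mem (FA.exhaustive x)⟩)

/-- The filtered degree of `x` (meaningful for `x ≠ 0`). -/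
def ModuleFiltration.deg (x : M) : ℕ := sInf {q | x ∈ FM.F q}

/-- The principal symbol `σ(x) ∈ G(M)`. -/
def ModuleFiltration.symbol (x : M) : FM.Gr :=
  DirectSum.of (fun q => Piece FM.F q) (FM.deg x)
    (cls FM.F (FM.deg x) ⟨x, Nat.sInf_mem (FM.exhaustive x)⟩)

/-- `h ∈ G(M)` is homogeneous of degree `q`. -/
def ModuleFiltration.HomDeg (h : FM.Gr) (q : ℕ) : Prop :=
  ∃ x : Piece FM.F q, h = DirectSum.of (fun q => Piece FM.F q) q x

/-- The filtration `F_qN = F_qM ∩ N` of a submodule. -/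
def ModuleFiltration.induced [IsScalarTower K A M] (N : Submodule A M) :
    ModuleFiltration FA N where
  F q := (FM.F q).comap (N.subtype.restrictScalars K)
  mono _ _ h _ hx := FM.mono h hx
  exhaustive x := FM.exhaustive x.1
  smul_mem hx hy := FM.smul_mem hx hy

/-- The graded submodule `G(N) = ⨁ F_qN / F_{q-1}N` of `G(M)` for the induced filtration of `N`:
the degree-`q` component consists of the classes of the elements of `F_qM ∩ N`. -/
def ModuleFiltration.grSubmodule (N : Submodule A M) : Submodule FA.Gr FM.Gr where
  carrier := {h | ∀ q, ∃ x : FM.F q, (x : M) ∈ N ∧ cls FM.F q x = h q}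
  zero_mem' q := ⟨0, N.zero_mem, rfl⟩
  add_mem' := by
    intro g h hg hh q
    obtain ⟨x, hx, ex⟩ := hg q
    obtain ⟨y, hy, ey⟩ := hh q
    refine ⟨x + y, N.add_mem hx hy, ?_⟩
    rw [DirectSum.add_apply, ← ex, ← ey]; rfl
  smul_mem' := by
    classical
    let S : AddSubmonoid FM.Gr :=
      { carrier := {h | ∀ q, ∃ x : FM.F q, (x : M) ∈ N ∧ cls FM.F q x = h q}
        zero_mem' := fun q => ⟨0, N.zero_mem, rfl⟩
        add_mem' := by
          intro g h hg hh q
          obtain ⟨x, hx, ex⟩ := hg q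
          obtain ⟨y, hy, ey⟩ := hh q
          refine ⟨x + y, N.add_mem hx hy, ?_⟩
          rw [DirectSum.add_apply, ← ex, ← ey]; rfl }
    have hof : ∀ (q : ℕ) (x : FM.F q), (x : M) ∈ N →
        DirectSum.of (fun q => Piece FM.F q) q (cls FM.F q x) ∈ S := by
      intro q x hx r
      by_cases hqr : q = r
      · subst hqr
        exact ⟨x, hx, (DirectSum.of_eq_same _ _).symm⟩
      · exact ⟨0, N.zero_mem,
          (map_zero (cls FM.F r)).trans (DirectSum.of_eq_of_ne _ _ _ (Ne.symm hqr)).symm⟩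
    intro r h hh
    change r • h ∈ S
    induction r using DirectSum.induction_on with
    | zero => rw [zero_smul]; exact S.zero_mem
    | add r r' h1 h2 => rw [add_smul]; exact S.add_mem h1 h2
    | of p a =>
      rw [← DirectSum.sum_support_of h, Finset.smul_sum]
      refine S.sum_mem fun q _ => ?_
      obtain ⟨x, hx, ex⟩ := hh q
      obtain ⟨a, rfl⟩ := cls_surjective FA.F p a
      rw [← ex, DirectSum.Gmodule.of_smul_of]
      exact hof (p + q) ⟨a.1 • x.1, FM.smul_mem a.2 x.2⟩ (N.smul_mem _ hx)

/-- `V` is an F-basis of `M`: a finite set of nonzero elements such that, for suitable `n(v) ∈ ℕ`,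
`F_qM = ∑_{v ∈ V} (∑_{p + n(v) ≤ q} F_pA) v` for all `q`. -/
def ModuleFiltration.IsFBasis (V : Set M) : Prop :=
  V.Finite ∧ 0 ∉ V ∧ ∃ n : M → ℕ, ∀ q, FM.F q =
    ⨆ v ∈ V, Submodule.span K {x | ∃ p, p + n v ≤ q ∧ ∃ r ∈ FA.F p, x = r • v}

/-- `X` is a minimal homogeneous generating set of the `G(A)`-submodule `P` of `G(M)`. -/
def ModuleFiltration.IsMinHomGen (P : Submodule FA.Gr FM.Gr) (X : Set FM.Gr) : Prop :=
  X.Finite ∧ (∀ h ∈ X, ∃ q, FM.HomDeg h q) ∧ Submodule.span FA.Gr X = P ∧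
    ∀ Y ⊂ X, Submodule.span FA.Gr Y ≠ P

variable [IsScalarTower K A M]

/-- `W` is a standard basis of the submodule `N`. -/
def ModuleFiltration.IsStandardBasis (N : Submodule A M) (W : Set M) : Prop :=
  W ⊆ N ∧ (FM.induced N).IsFBasis ((↑) ⁻¹' W : Set N)

/-- `W` is a minimal standard basis of `N`: no proper subset is a standard basis. -/
def ModuleFiltration.IsMinimalStandardBasis (N : Submodule A M) (W : Set M) : Prop :=
  FM.IsStandardBasis N W ∧ ∀ W' ⊂ W, ¬ FM.IsStandardBasis N W'

end Graded

/-! ### Weighted filtrations of solvable polynomial algebras and of their free modules -/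

section Weighted

variable {K A : Type*} [Field K] [Ring A] [Algebra K A] {n : ℕ} {a : Fin n → A}
  {lt : (Fin n →₀ ℕ) → (Fin n →₀ ℕ) → Prop} {d : Fin n → ℕ}

theorem mon_zero (a : Fin n → A) : mon a 0 = 1 := by
  simp [mon]

theorem wdeg_zero (d : Fin n → ℕ) : wdeg d 0 = 0 := by simp [wdeg]

theorem wdeg_add (d : Fin n → ℕ) (α β : Fin n →₀ ℕ) :
    wdeg d (α + β) = wdeg d α + wdeg d β := by
  simp [wdeg, mul_add, Finset.sum_add_distrib]

theorem IsGradedSolvable.mon_mul_mem (h : IsGradedSolvable K a lt d) {α β : Fin n →₀ ℕ} {r : ℕ}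
    (hr : wdeg d α + wdeg d β ≤ r) :
    mon a α * mon a β ∈ Submodule.span K (mon a '' {γ | wdeg d γ ≤ r}) := by
  obtain ⟨c, f, -, e, hf⟩ := h.solvable.mul_eq α β
  rw [← wdeg_add] at hr
  rw [e]
  refine add_mem (Submodule.smul_mem _ _ (Submodule.subset_span ⟨_, hr, rfl⟩)) ?_
  by_cases hf0 : f = 0
  · rw [hf0]; exact zero_mem _
  obtain ⟨μ, ⟨c', g, hg, -, -, hlt⟩, hμ⟩ := hf hf0
  rw [← hg, Finsupp.linearCombination_apply]
  refine Submodule.sum_mem _ fun ν hν => Submodule.smul_mem _ _ (Submodule.subset_span ?_)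
  refine ⟨ν, ?_, rfl⟩
  have h1 := h.graded _ _ hμ
  rcases hlt ν (Finsupp.mem_support_iff.1 hν) with rfl | h2
  · exact h1.trans hr
  · exact ((h.graded _ _ h2).trans h1).trans hr

/-- The weighted filtration `F_pA = K-span {a^α | d(a^α) ≤ p}`. -/
def IsGradedSolvable.filtration (h : IsGradedSolvable K a lt d) : RingFiltration K A where
  F p := Submodule.span K (mon a '' {α | wdeg d α ≤ p})
  mono p q hpq := Submodule.span_mono (Set.image_mono fun _ hα => le_trans hα hpq)
  exhaustive x := by
    have hx : x ∈ Submodule.span K (Set.range (mon a)) := by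
      rw [h.solvable.span_eq_top]; trivial
    induction hx using Submodule.span_induction with
    | mem x hx =>
      obtain ⟨α, rfl⟩ := hx
      exact ⟨wdeg d α, Submodule.subset_span ⟨α, le_refl (wdeg d α), rfl⟩⟩
    | zero => exact ⟨0, zero_mem _⟩
    | add x y _ _ hx hy =>
      obtain ⟨p, hp⟩ := hx
      obtain ⟨q, hq⟩ := hy
      exact ⟨max p q, add_mem
        (Submodule.span_mono (Set.image_mono fun _ hα => le_trans hα (le_max_left p q)) hp)
        (Submodule.span_mono (Set.image_mono fun _ hα => le_trans hα (le_max_right p q)) hq)⟩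
    | smul c x _ hx =>
      obtain ⟨p, hp⟩ := hx
      exact ⟨p, Submodule.smul_mem _ _ hp⟩
  one_mem := Submodule.subset_span ⟨0, (wdeg_zero d).le, mon_zero a⟩
  mul_mem := by
    intro p q x y hx hy
    have hxy := Submodule.mul_mem_mul hx hy
    rw [Submodule.span_mul_span] at hxy
    refine Submodule.span_le.2 ?_ hxy
    rintro _ ⟨_, ⟨α, hα, rfl⟩, _, ⟨β, hβ, rfl⟩, rfl⟩
    exact h.mon_mul_mem (add_le_add hα hβ)

/-- The set that indexes the monomials `a^α eᵢ` of a free module with basis `e₁, …, e_s`. -/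
abbrev Idx (n s : ℕ) : Type := (Fin n →₀ ℕ) × Fin s

/-- The monomial `a^α eᵢ`. -/
def lmon {R V : Type*} [Ring R] [AddCommGroup V] [Module R V] {n s : ℕ} (a : Fin n → R)
    (e : Fin s → V) (μ : Idx n s) : V := mon a μ.1 • e μ.2

variable {L : Type*} [AddCommGroup L] [Module K L] [Module A L] [IsScalarTower K A L] {s : ℕ}

/-- The filtration `F_qL = K-span {a^α eᵢ | d(a^α) + bᵢ ≤ q}` of the free module `L = ⨁ A eᵢ`. -/
def IsGradedSolvable.freeFiltration (h : IsGradedSolvable K a lt d) (e : Module.Basis (Fin s) A L)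
    (b : Fin s → ℕ) : ModuleFiltration h.filtration L :=
  have key : ∀ (p q : ℕ) (i : Fin s) (r : A), r ∈ h.filtration.F p → p + b i ≤ q →
      r • e i ∈ Submodule.span K (lmon a e '' {μ | wdeg d μ.1 + b μ.2 ≤ q}) := by
    intro p q i r hr hpq
    induction hr using Submodule.span_induction with
    | mem x hx =>
      obtain ⟨α, hα, rfl⟩ := hx
      exact Submodule.subset_span ⟨(α, i), le_trans (Nat.add_le_add_right hα _) hpq, rfl⟩
    | zero => rw [zero_smul]; exact zero_mem _
    | add x y _ _ hx hy => rw [add_smul]; exact add_mem hx hy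
    | smul c x _ hx => rw [smul_assoc]; exact Submodule.smul_mem _ _ hx
  have mono : Monotone fun q => Submodule.span K (lmon a e '' {μ | wdeg d μ.1 + b μ.2 ≤ q}) :=
    fun p q hpq => Submodule.span_mono (Set.image_mono fun _ hμ => le_trans hμ hpq)
  { F := fun q => Submodule.span K (lmon a e '' {μ | wdeg d μ.1 + b μ.2 ≤ q})
    mono := mono
    exhaustive := by
      intro x
      rw [← e.sum_repr x]
      choose p hp using fun i => h.filtration.exhaustive (e.repr x i)
      refine ⟨∑ i, (p i + b i), sum_mem fun i _ => key (p i) _ i _ (hp i) ?_⟩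
      exact Finset.single_le_sum (f := fun i => p i + b i) (fun _ _ => Nat.zero_le _)
        (Finset.mem_univ i)
    smul_mem := by
      intro p q x y hx hy
      induction hy using Submodule.span_induction with
      | mem y hy =>
        obtain ⟨μ, hμ, rfl⟩ := hy
        rw [lmon, ← mul_smul]
        refine key (p + wdeg d μ.1) _ μ.2 _ (h.filtration.mul_mem hx
          (Submodule.subset_span ⟨μ.1, le_refl (wdeg d μ.1), rfl⟩)) ?_
        have : wdeg d μ.1 + b μ.2 ≤ q := hμ
        omega
      | zero => rw [smul_zero]; exact zero_mem _
      | add y z _ _ hy hz => rw [smul_add]; exact add_mem hy hz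
      | smul c y _ hy =>
        rw [← algebraMap_smul A c y, ← mul_smul, ← Algebra.commutes, mul_smul, algebraMap_smul]
        exact Submodule.smul_mem _ _ hy }

/-- `ltL` is a left monomial ordering on the monomials of `L = ⨁ A eᵢ`, for the given monomial
ordering `lt` of `A`. -/
structure IsLeftMonomialOrdering (K : Type*) {A L : Type*} [Field K] [Ring A] [Algebra K A]
    [AddCommGroup L] [Module K L] [Module A L] {n s : ℕ} (a : Fin n → A)
    (lt : (Fin n →₀ ℕ) → (Fin n →₀ ℕ) → Prop) (e : Fin s → L)
    (ltL : Idx n s → Idx n s → Prop) : Prop where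
  total : IsStrictTotalOrder (Idx n s) ltL
  smul_lt : ∀ (μ ν : Idx n s) (γ : Fin n →₀ ℕ) (μ' ν' : Idx n s), ltL μ ν →
    IsLM K (lmon a e) ltL (mon a γ • lmon a e μ) μ' →
    IsLM K (lmon a e) ltL (mon a γ • lmon a e ν) ν' → ltL μ' ν'
  of_lt : ∀ (α β : Fin n →₀ ℕ) (i : Fin s), lt α β → ltL (α, i) (β, i)

/-- A graded left monomial ordering: a left monomial ordering such that `a^α eᵢ ≺ a^β eⱼ` implies
`d(a^α) + bᵢ ≤ d(a^β) + bⱼ`. -/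
structure IsGradedLeftMonomialOrdering (K : Type*) {A L : Type*} [Field K] [Ring A] [Algebra K A]
    [AddCommGroup L] [Module K L] [Module A L] {n s : ℕ} (a : Fin n → A)
    (lt : (Fin n →₀ ℕ) → (Fin n →₀ ℕ) → Prop) (d : Fin n → ℕ) (e : Fin s → L) (b : Fin s → ℕ)
    (ltL : Idx n s → Idx n s → Prop) : Prop
    extends IsLeftMonomialOrdering K a lt e ltL where
  graded : ∀ μ ν : Idx n s, ltL μ ν → wdeg d μ.1 + b μ.2 ≤ wdeg d ν.1 + b ν.2

end Weighted

/-! ### Left Gröbner bases and the algorithms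

`V` is a module over the ring `R` with the monomials `a^α eᵢ`, ordered by `lt`. This is used both
for `A` with `L` and for `G(A)` with `G(L)`. The algorithms are nondeterministic transition systems:
every choice that they leave open is a transition. -/

section Algorithms

variable (K : Type*) {R V : Type*} [Field K] [Ring R] [AddCommGroup V] [Module K V] [Module R V]
  {n s : ℕ} (a : Fin n → R) (e : Fin s → V) (lt : Idx n s → Idx n s → Prop)

/-- `a^α eᵢ` divides `a^β eⱼ`: `i = j` and `a^β eⱼ = LM(a^γ a^α eᵢ)` for some `a^γ`. -/
def Divides (μ ν : Idx n s) : Prop :=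
  μ.2 = ν.2 ∧ ∃ γ : Fin n →₀ ℕ, IsLM K (lmon a e) lt (mon a γ • lmon a e μ) ν

/-- `G` is a (finite) left Gröbner basis of the submodule `N`. -/
def IsLeftGroebner (N : Submodule R V) (G : Set V) : Prop :=
  G.Finite ∧ G ⊆ N ∧ 0 ∉ G ∧ ∀ v ∈ N, v ≠ 0 → ∃ g ∈ G, ∃ μ ν,
    IsLM K (lmon a e) lt g μ ∧ IsLM K (lmon a e) lt v ν ∧ Divides K a e lt μ ν

/-- One step of the division by the elements of the list `G`. In the state `(v, η)`, `v` is what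
is still to be divided and `η` is the part of the remainder found so far. -/
inductive DivStep (G : List V) : V × V → V × V → Prop
  | reduce (v η g : V) (γ : Fin n →₀ ℕ) (ν : Idx n s) (c c' : K) (hg : g ∈ G)
      (hv : IsLeading K (lmon a e) lt v ν c)
      (hγ : IsLeading K (lmon a e) lt (mon a γ • g) ν c') :
      DivStep G (v, η) (v - (c / c') • (mon a γ • g), η)
  | shift (v η : V) (ν : Idx n s) (c : K) (hv : IsLeading K (lmon a e) lt v ν c)
      (hG : ¬ ∃ g ∈ G, ∃ γ : Fin n →₀ ℕ, IsLM K (lmon a e) lt (mon a γ • g) ν) :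
      DivStep G (v, η) (v - c • lmon a e ν, η + c • lmon a e ν)

/-- `h` is the left S-polynomial of `f` and `g`, whose leading monomials involve the same `eₚ`:
with `LM(f) = a^α eₚ`, `LM(g) = a^β eₚ` and `γ = max(α, β)` it is
`LC(a^(γ-α) f)⁻¹ a^(γ-α) f - LC(a^(γ-β) g)⁻¹ a^(γ-β) g`. -/
def IsSPoly (f g h : V) : Prop :=
  ∃ (α β : Fin n →₀ ℕ) (p : Fin s) (c c' : K),
    IsLM K (lmon a e) lt f (α, p) ∧ IsLM K (lmon a e) lt g (β, p) ∧
    IsLeading K (lmon a e) lt (mon a (α ⊔ β - α) • f) (α ⊔ β, p) c ∧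
    IsLeading K (lmon a e) lt (mon a (α ⊔ β - β) • g) (α ⊔ β, p) c' ∧
    h = c⁻¹ • (mon a (α ⊔ β - α) • f) - c'⁻¹ • (mon a (α ⊔ β - β) • g)

/-- A state of the Buchberger algorithm: the current list `G`, the current set of S-polynomials,
and the state of the division that is being carried out, if any. -/
structure BuchbergerState (V : Type*) where
  gens : List V
  pending : Set V
  work : Option (V × V)

/-- The initial state for the input `Θ`. -/
def buchbergerInit (Θ : List V) : BuchbergerState V where
  gens := Θ
  pending := {h | ∃ i j : Fin Θ.length, i < j ∧ IsSPoly K a e lt (Θ.get i) (Θ.get j) h}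
  work := none

/-- The steps of the Buchberger algorithm: while there are S-polynomials left, remove one of them
and divide it by `G`; a nonzero remainder `η` is appended to `G`, and its S-polynomials with the
elements of `G` are added. -/
inductive BuchbergerStep : BuchbergerState V → BuchbergerState V → Prop
  | choose (G : List V) (S : Set V) (h : V) (hh : h ∈ S) :
      BuchbergerStep ⟨G, S, none⟩ ⟨G, S \ {h}, some (h, 0)⟩
  | divide (G : List V) (S : Set V) (x y : V × V) (hxy : DivStep K a e lt G x y) :
      BuchbergerStep ⟨G, S, some x⟩ ⟨G, S, some y⟩
  | discard (G : List V) (S : Set V) :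
      BuchbergerStep ⟨G, S, some (0, 0)⟩ ⟨G, S, none⟩
  | append (G : List V) (S : Set V) (η : V) (hη : η ≠ 0) :
      BuchbergerStep ⟨G, S, some (0, η)⟩
        ⟨G ++ [η], S ∪ {h | ∃ g ∈ G, IsSPoly K a e lt g η h}, none⟩

/-- A state of the algorithm that selects a minimal homogeneous generating set among homogeneous
elements `u₁, …, u_m`: the current list `G`, the current set of S-polynomials, the set `todo` of
the indices of the input elements not yet treated, the set `kept` of the indices selected so far,
and the division that is being carried out, if any, with the index of the input element that is
being divided (`none` for an S-polynomial). -/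
structure SelectState (V : Type*) (m : ℕ) where
  gens : List V
  pending : Set V
  todo : Finset (Fin m)
  kept : Finset (Fin m)
  work : Option (Option (Fin m) × V × V)

/-- The initial state. -/
def selectInit (V : Type*) (m : ℕ) : SelectState V m := ⟨[], ∅, Finset.univ, ∅, none⟩

/-- The steps of the selection algorithm, where `deg v q` says that `v` is homogeneous of degree
`q`. While there are untreated input elements, take an element of the least degree among the
S-polynomials and the untreated input elements, S-polynomials first, and divide it by `G`. A nonzero
remainder is appended to `G`, its nonzero S-polynomials with the elements of `G` are added, and, if
the divided element was an input element, this input element is selected. -/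
inductive SelectStep (deg : V → ℕ → Prop) {m : ℕ} (u : Fin m → V) :
    SelectState V m → SelectState V m → Prop
  | spoly (G : List V) (S : Set V) (T J : Finset (Fin m)) (h : V) (q : ℕ) (hT : T.Nonempty)
      (hh : h ∈ S) (hq : deg h q) (hS : ∀ h' ∈ S, ∀ q', deg h' q' → q ≤ q')
      (hu : ∀ j ∈ T, ∀ q', deg (u j) q' → q ≤ q') :
      SelectStep deg u ⟨G, S, T, J, none⟩ ⟨G, S \ {h}, T, J, some (none, h, 0)⟩
  | input (G : List V) (S : Set V) (T J : Finset (Fin m)) (j : Fin m) (q : ℕ)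
      (hj : j ∈ T) (hq : deg (u j) q) (hS : ∀ h' ∈ S, ∀ q', deg h' q' → q < q')
      (hu : ∀ j' ∈ T, ∀ q', deg (u j') q' → q ≤ q') :
      SelectStep deg u ⟨G, S, T, J, none⟩ ⟨G, S, T.erase j, J, some (some j, u j, 0)⟩
  | divide (G : List V) (S : Set V) (T J : Finset (Fin m)) (o : Option (Fin m)) (x y : V × V)
      (hxy : DivStep K a e lt G x y) :
      SelectStep deg u ⟨G, S, T, J, some (o, x)⟩ ⟨G, S, T, J, some (o, y)⟩
  | discard (G : List V) (S : Set V) (T J : Finset (Fin m)) (o : Option (Fin m)) :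
      SelectStep deg u ⟨G, S, T, J, some (o, 0, 0)⟩ ⟨G, S, T, J, none⟩
  | append (G : List V) (S : Set V) (T J : Finset (Fin m)) (o : Option (Fin m)) (η : V)
      (hη : η ≠ 0) :
      SelectStep deg u ⟨G, S, T, J, some (o, 0, η)⟩
        ⟨G ++ [η], S ∪ {h | h ≠ 0 ∧ ∃ g ∈ G, IsSPoly K a e lt g η h}, T, J ∪ o.toFinset, none⟩

end Algorithms

/-- Every run from the state `x` is finite. -/
def Terminates {σ : Type*} (Step : σ → σ → Prop) (x : σ) : Prop := Acc (fun t t' => Step t' t) x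

/-- There is a run from `x` that ends in `y`, where no further step is possible. -/
def HaltsAt {σ : Type*} (Step : σ → σ → Prop) (x y : σ) : Prop :=
  Relation.ReflTransGen Step x y ∧ ∀ z, ¬ Step y z

end SolvPoly

end

/-! Since the ordering of L is graded and only finitely many monomials lie below any given degree,
every monomial of L has finitely many predecessors. Their number is a rank in ℕ, and arguments on
leading monomials become inductions on this rank. L and G(L) have K-bases of monomials with the same
indices and the same ranks, and in both the leading monomial of a^γ · a^α eᵢ is the one with
exponent γ + α. `IsMonomialModule` isolates these properties, asking of the acting ring no K-algebra
structure, so that the Gröbner theory is developed once and used twice.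

Buchberger's algorithm: each S-polynomial of two generators is always pending, or congruent to the
current state of the division modulo multiples of generators with leading monomials below the least
common multiple, or itself a combination of such multiples. At the end only the last case is left,
and the criterion `exists_isLM_of_sPolyStd` applies. A nonzero remainder enlarges the set of
monomials divisible by a leading monomial of a generator, which by Dickson's lemma happens finitely
often.

Passage to G(N): the leading monomial of x has the top degree in x, so x and σ(x) have the same
leading monomial (`isLM_symbol`), and an element of G(N) lifts to an element of N with the same
leading monomial (`isLM_of_cls_eq`). Hence the symbols of a Gröbner basis of N form a Gröbner basis
of G(N), and in particular generate it.

Selection: when an input of degree q is divided, no S-polynomial of degree at most q is pending, so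
the criterion truncated at degree q holds, and a nonzero remainder means that the input is not
generated by its predecessors (`SelectInv.notMem_span`). As inputs come in nondecreasing degree,
such an input cannot make an earlier one redundant either (`irredundant_insert`).

Standard bases: a finite set of nonzero elements of N is a standard basis exactly when its symbols
generate G(N), by lifting classes degree by degree. So, if the symbols are distinct, minimality of
the symbols as generators gives minimality of the standard basis. -/

namespace SolvPoly

/-! ### Modules with a PBW basis of monomials and a translation invariant ordering -/

/-- The product of the monomial `μ` with the commutative monomial of exponent `γ`. -/
noncomputable def shift {n s : ℕ} (γ : Fin n →₀ ℕ) (μ : Idx n s) : Idx n s := (γ + μ.1, μ.2)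

theorem shift_shift {n s : ℕ} (γ δ : Fin n →₀ ℕ) (μ : Idx n s) :
    shift γ (shift δ μ) = shift (γ + δ) μ := by
  simp [shift, add_assoc]

/-- The common features of a free module over a solvable polynomial algebra and of its associated
graded module: the monomials form a `K`-basis, the ordering is given by the injective rank function
`rk`, it is translation invariant, and products of monomials have the expected leading monomial. -/
structure IsMonomialModule (K : Type*) {R V : Type*} [Field K] [Ring R] [AddCommGroup V]
    [Module K V] [Module R V] {n s : ℕ} (a : Fin n → R) (e : Fin s → V)
    (lt : Idx n s → Idx n s → Prop) (rk : Idx n s → ℕ) : Prop where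
  linearIndependent : LinearIndependent K (lmon a e)
  span_eq_top : ⊤ ≤ Submodule.span K (Set.range (lmon a e))
  lt_iff : ∀ μ ν, lt μ ν ↔ rk μ < rk ν
  rk_injective : Function.Injective rk
  rk_shift : ∀ γ μ ν, rk μ < rk ν → rk (shift γ μ) < rk (shift γ ν)
  rk_le_shift : ∀ γ μ, rk μ ≤ rk (shift γ μ)
  smul_comm : ∀ (γ : Fin n →₀ ℕ) (c : K) (v : V), mon a γ • c • v = c • mon a γ • v
  mon_smul_mon_smul : ∀ γ δ : Fin n →₀ ℕ, ∃ f : (Fin n →₀ ℕ) →₀ K, f (γ + δ) ≠ 0 ∧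
    (∀ η, f η ≠ 0 → η = γ + δ ∨ ∀ i : Fin s, rk (η, i) < rk (γ + δ, i)) ∧
    ∀ v : V, mon a γ • mon a δ • v = f.sum fun η c => c • mon a η • v
  smul_mem_span : ∀ (r : R) (v : V), r • v ∈ Submodule.span K (Set.range fun γ => mon a γ • v)
  exists_smul_eq : ∀ c : K, ∃ r : R, ∀ v : V, c • v = r • v

/-- The span of the monomials of rank less than `k`. -/
def lowSpan (K : Type*) {V ι : Type*} [Field K] [AddCommGroup V] [Module K V] (m : ι → V)
    (rk : ι → ℕ) (k : ℕ) : Submodule K V :=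
  Submodule.span K (m '' {ν | rk ν < k})

/-- The span of the multiples `a^γ g` of elements `g ∈ G` with a leading monomial in `D`. -/
def leadSpan (K : Type*) {R V : Type*} [Field K] [Ring R] [AddCommGroup V]
    [Module K V] [Module R V] {n s : ℕ} (a : Fin n → R) (e : Fin s → V)
    (lt : Idx n s → Idx n s → Prop) (G : Set V) (D : Set (Idx n s)) : Submodule K V :=
  Submodule.span K
    {x | ∃ g ∈ G, ∃ γ : Fin n →₀ ℕ, ∃ ν ∈ D, IsLM K (lmon a e) lt x ν ∧ x = mon a γ • g}

/-- `h` is the S-polynomial of `f` and `g`, and `τ` is the least common multiple of their leading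
monomials. -/
def IsSPolyAt (K : Type*) {R V : Type*} [Field K] [Ring R] [AddCommGroup V]
    [Module K V] [Module R V] {n s : ℕ} (a : Fin n → R) (e : Fin s → V)
    (lt : Idx n s → Idx n s → Prop) (f g h : V) (τ : Idx n s) : Prop :=
  ∃ (α β : Fin n →₀ ℕ) (p : Fin s) (c c' : K), τ = (α ⊔ β, p) ∧
    IsLM K (lmon a e) lt f (α, p) ∧ IsLM K (lmon a e) lt g (β, p) ∧
    IsLeading K (lmon a e) lt (mon a (α ⊔ β - α) • f) (α ⊔ β, p) c ∧
    IsLeading K (lmon a e) lt (mon a (α ⊔ β - β) • g) (α ⊔ β, p) c' ∧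
    h = c⁻¹ • (mon a (α ⊔ β - α) • f) - c'⁻¹ • (mon a (α ⊔ β - β) • g)

/-- The leading monomials of the multiples `a^γ g` of elements `g ∈ G`. -/
def leadSet (K : Type*) {R V : Type*} [Field K] [Ring R] [AddCommGroup V]
    [Module K V] [Module R V] {n s : ℕ} (a : Fin n → R) (e : Fin s → V)
    (lt : Idx n s → Idx n s → Prop) (G : Set V) : Set (Idx n s) :=
  {ν | ∃ g ∈ G, ∃ γ : Fin n →₀ ℕ, IsLM K (lmon a e) lt (mon a γ • g) ν}

/-! ### Leading monomials and multiplication by monomials. -/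

namespace IsMonomialModule

variable {K R V : Type*} [Field K] [Ring R] [AddCommGroup V] [Module K V] [Module R V] {n s : ℕ}
  {a : Fin n → R} {e : Fin s → V} {lt : Idx n s → Idx n s → Prop} {rk : Idx n s → ℕ}
  (H : IsMonomialModule K a e lt rk)

include H

/-- The monomials as a basis. -/
noncomputable def basis (H : IsMonomialModule K a e lt rk) : Module.Basis (Idx n s) K V :=
  Module.Basis.mk H.linearIndependent H.span_eq_top

theorem basis_apply (μ : Idx n s) : H.basis μ = lmon a e μ := Module.Basis.mk_apply _ _ μ

theorem coe_basis : ⇑H.basis = lmon a e := funext H.basis_apply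

theorem mem_span_iff (v : V) (D : Set (Idx n s)) :
    v ∈ Submodule.span K (lmon a e '' D) ↔ ∀ ν, H.basis.repr v ν ≠ 0 → ν ∈ D := by
  rw [← H.coe_basis, Module.Basis.mem_span_image]
  simp [Set.subset_def]

theorem mem_lowSpan_iff (v : V) (k : ℕ) :
    v ∈ lowSpan K (lmon a e) rk k ↔ ∀ ν, H.basis.repr v ν ≠ 0 → rk ν < k :=
  H.mem_span_iff v _

/-- Coordinates in the monomial basis replace the existential linear combination, and membership in
a span replaces the comparison of all monomials that occur. Later arguments use this form. -/
theorem isLeading_iff (v : V) (μ : Idx n s) (c : K) : IsLeading K (lmon a e) lt v μ c ↔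
    H.basis.repr v μ = c ∧ c ≠ 0 ∧ v ∈ lowSpan K (lmon a e) rk (rk μ + 1) := by
  rw [H.mem_lowSpan_iff]
  have key : ∀ ν, (ν = μ ∨ lt ν μ) ↔ rk ν < rk μ + 1 := fun ν => by
    rw [H.lt_iff, Nat.lt_succ_iff_lt_or_eq, or_comm, H.rk_injective.eq_iff]
  constructor
  · rintro ⟨f, rfl, hf, hc, h⟩
    have : H.basis.repr (Finsupp.linearCombination K (lmon a e) f) = f := by
      rw [← H.coe_basis, Module.Basis.repr_linearCombination]
    rw [this]
    exact ⟨hf, hc, fun ν hν => (key ν).1 (h ν hν)⟩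
  · rintro ⟨hf, hc, h⟩
    refine ⟨H.basis.repr v, ?_, hf, hc, fun ν hν => (key ν).2 (h ν hν)⟩
    rw [← H.coe_basis, Module.Basis.linearCombination_repr]

theorem isLM_iff (v : V) (μ : Idx n s) : IsLM K (lmon a e) lt v μ ↔
    H.basis.repr v μ ≠ 0 ∧ v ∈ lowSpan K (lmon a e) rk (rk μ + 1) := by
  constructor
  · rintro ⟨c, hc⟩
    obtain ⟨h1, h2, h3⟩ := (H.isLeading_iff v μ c).1 hc
    exact ⟨h1 ▸ h2, h3⟩
  · rintro ⟨h1, h2⟩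
    exact ⟨_, (H.isLeading_iff v μ _).2 ⟨rfl, h1, h2⟩⟩

omit H in
theorem lowSpan_mono {k l : ℕ} (h : k ≤ l) :
    lowSpan K (lmon a e) rk k ≤ lowSpan K (lmon a e) rk l :=
  Submodule.span_mono (Set.image_mono fun _ hν => lt_of_lt_of_le hν h)

omit H in
theorem lmon_mem_lowSpan {ν : Idx n s} {k : ℕ} (h : rk ν < k) :
    lmon a e ν ∈ lowSpan K (lmon a e) rk k :=
  Submodule.subset_span ⟨ν, h, rfl⟩

theorem repr_lmon (μ : Idx n s) : H.basis.repr (lmon a e μ) = Finsupp.single μ 1 := by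
  rw [← H.basis_apply, Module.Basis.repr_self]

theorem repr_smul_apply (c : K) (v : V) (μ : Idx n s) :
    H.basis.repr (c • v) μ = c * H.basis.repr v μ := by
  rw [map_smul H.basis.repr c, Finsupp.smul_apply, smul_eq_mul]

theorem repr_eq_zero_of_mem_lowSpan {v : V} {k : ℕ} {μ : Idx n s}
    (h : v ∈ lowSpan K (lmon a e) rk k) (hμ : k ≤ rk μ) : H.basis.repr v μ = 0 := by
  by_contra hne
  exact absurd ((H.mem_lowSpan_iff v k).1 h μ hne) (not_lt.2 hμ)

theorem mem_lowSpan_of_repr_eq_zero {v : V} {μ : Idx n s}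
    (h : v ∈ lowSpan K (lmon a e) rk (rk μ + 1)) (hμ : H.basis.repr v μ = 0) :
    v ∈ lowSpan K (lmon a e) rk (rk μ) := by
  rw [H.mem_lowSpan_iff] at h ⊢
  intro ν hν
  refine lt_of_le_of_ne (Nat.lt_succ_iff.1 (h ν hν)) fun e => ?_
  rw [H.rk_injective e] at hν
  exact hν hμ

theorem exists_isLM {v : V} (hv : v ≠ 0) : ∃ μ, IsLM K (lmon a e) lt v μ := by
  have hne : (H.basis.repr v).support.Nonempty := by
    rw [Finsupp.support_nonempty_iff]
    exact fun h => hv (by simpa using h)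
  obtain ⟨μ, hμ, hmax⟩ := Finset.exists_max_image _ rk hne
  refine ⟨μ, (H.isLM_iff v μ).2 ⟨Finsupp.mem_support_iff.1 hμ, (H.mem_lowSpan_iff _ _).2 ?_⟩⟩
  exact fun ν hν => Nat.lt_succ_iff.2 (hmax ν (Finsupp.mem_support_iff.2 hν))

theorem ne_zero_of_isLM {v : V} {μ : Idx n s} (h : IsLM K (lmon a e) lt v μ) : v ≠ 0 := by
  rintro rfl
  exact ((H.isLM_iff _ _).1 h).1 (by simp)

theorem isLM_rk_le {v : V} {μ : Idx n s} {k : ℕ} (h : IsLM K (lmon a e) lt v μ)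
    (hk : v ∈ lowSpan K (lmon a e) rk k) : rk μ < k :=
  (H.mem_lowSpan_iff v k).1 hk μ ((H.isLM_iff _ _).1 h).1

theorem isLM_unique {v : V} {μ ν : Idx n s} (h : IsLM K (lmon a e) lt v μ)
    (h' : IsLM K (lmon a e) lt v ν) : μ = ν := by
  have h1 := H.isLM_rk_le h ((H.isLM_iff _ _).1 h').2
  have h2 := H.isLM_rk_le h' ((H.isLM_iff _ _).1 h).2
  exact H.rk_injective (by omega)

/-- The expansion of a^γ a^α involves only exponents, so all terms of the product keep the same eᵢ,
and the expected exponent dominates for every eᵢ. -/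
theorem mon_smul_lmon (γ : Fin n →₀ ℕ) (μ : Idx n s) :
    IsLM K (lmon a e) lt (mon a γ • lmon a e μ) (shift γ μ) := by
  obtain ⟨f, hf, hlt, heq⟩ := H.mon_smul_mon_smul γ μ.1
  have h1 : mon a γ • lmon a e μ = f.sum fun η c => c • lmon a e (η, μ.2) := heq _
  have hrepr : ∀ ν : Idx n s, H.basis.repr (mon a γ • lmon a e μ) ν =
      if ν.2 = μ.2 then f ν.1 else 0 := by
    intro ν
    rw [h1, Finsupp.sum, map_sum, Finsupp.finsetSum_apply]
    simp only [map_smul, H.repr_lmon, Finsupp.smul_apply, Finsupp.single_apply, smul_eq_mul]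
    split_ifs with hν
    · rw [Finset.sum_eq_single ν.1]
      · simp [← hν]
      · intro b _ hb
        rw [if_neg (fun h : (b, μ.2) = ν => hb (congrArg Prod.fst h)), mul_zero]
      · intro h
        rw [Finsupp.notMem_support_iff.1 h, zero_mul]
    · refine Finset.sum_eq_zero fun b _ => ?_
      rw [if_neg (fun h : (b, μ.2) = ν => hν (congrArg Prod.snd h).symm), mul_zero]
  rw [H.isLM_iff, H.mem_lowSpan_iff]
  refine ⟨by rw [hrepr]; simpa [shift] using hf, fun ν hν => ?_⟩
  rw [hrepr] at hν
  obtain ⟨hν2, hν1⟩ : ν.2 = μ.2 ∧ f ν.1 ≠ 0 := by simpa using hν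
  obtain ⟨ν1, ν2⟩ := ν
  simp only at hν1 hν2
  subst hν2
  rcases hlt _ hν1 with h | h
  · subst h; exact Nat.lt_succ_self _
  · exact (h μ.2).trans (Nat.lt_succ_self _)

/-- Multiplication by a monomial is `K`-linear. -/
def monSMul (H : IsMonomialModule K a e lt rk) (γ : Fin n →₀ ℕ) : V →ₗ[K] V where
  toFun v := mon a γ • v
  map_add' := smul_add _
  map_smul' c v := H.smul_comm γ c v

theorem mon_smul_mem_of_span {γ : Fin n →₀ ℕ} {X : Set V} {N : Submodule K V} {v : V}
    (hv : v ∈ Submodule.span K X) (h : ∀ x ∈ X, mon a γ • x ∈ N) : mon a γ • v ∈ N := by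
  have : Submodule.span K X ≤ N.comap (H.monSMul γ) := Submodule.span_le.2 h
  exact this hv

theorem mon_smul_mem_lowSpan (γ : Fin n →₀ ℕ) {μ : Idx n s} {v : V}
    (hv : v ∈ lowSpan K (lmon a e) rk (rk μ)) :
    mon a γ • v ∈ lowSpan K (lmon a e) rk (rk (shift γ μ)) := by
  refine H.mon_smul_mem_of_span hv ?_
  rintro _ ⟨ν, hν, rfl⟩
  exact lowSpan_mono (H.rk_shift γ _ _ hν) ((H.isLM_iff _ _).1 (H.mon_smul_lmon γ ν)).2

theorem sub_smul_lmon_mem_lowSpan {v : V} {μ : Idx n s}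
    (hv : v ∈ lowSpan K (lmon a e) rk (rk μ + 1)) :
    v - H.basis.repr v μ • lmon a e μ ∈ lowSpan K (lmon a e) rk (rk μ) := by
  refine H.mem_lowSpan_of_repr_eq_zero (sub_mem hv (Submodule.smul_mem _ _
    (lmon_mem_lowSpan (Nat.lt_succ_self _)))) ?_
  simp [H.repr_lmon]

/-- Terms of v below μ are sent strictly below `shift γ μ`, so only the leading term contributes to
this coefficient. -/
theorem repr_mon_smul (γ : Fin n →₀ ℕ) {μ : Idx n s} {v : V}
    (hv : v ∈ lowSpan K (lmon a e) rk (rk μ + 1)) :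
    H.basis.repr (mon a γ • v) (shift γ μ) =
      H.basis.repr v μ * H.basis.repr (mon a γ • lmon a e μ) (shift γ μ) := by
  have h := H.repr_eq_zero_of_mem_lowSpan
    (H.mon_smul_mem_lowSpan γ (H.sub_smul_lmon_mem_lowSpan hv)) le_rfl
  rw [smul_sub, H.smul_comm, map_sub, Finsupp.sub_apply, H.repr_smul_apply, sub_eq_zero] at h
  exact h

theorem isLM_mon_smul (γ : Fin n →₀ ℕ) {μ : Idx n s} {v : V} (h : IsLM K (lmon a e) lt v μ) :
    IsLM K (lmon a e) lt (mon a γ • v) (shift γ μ) := by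
  obtain ⟨h1, h2⟩ := (H.isLM_iff _ _).1 h
  obtain ⟨h3, h4⟩ := (H.isLM_iff _ _).1 (H.mon_smul_lmon γ μ)
  refine (H.isLM_iff _ _).2 ⟨by rw [H.repr_mon_smul γ h2]; exact mul_ne_zero h1 h3, ?_⟩
  have h5 := add_mem (lowSpan_mono (Nat.le_succ _)
    (H.mon_smul_mem_lowSpan γ (H.sub_smul_lmon_mem_lowSpan h2)))
    (Submodule.smul_mem _ (H.basis.repr v μ) h4)
  rwa [smul_sub, H.smul_comm, sub_add_cancel] at h5

theorem isLM_mon_smul_iff (γ : Fin n →₀ ℕ) {μ ν : Idx n s} {v : V}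
    (h : IsLM K (lmon a e) lt v μ) :
    IsLM K (lmon a e) lt (mon a γ • v) ν ↔ ν = shift γ μ :=
  ⟨fun h' => H.isLM_unique h' (H.isLM_mon_smul γ h), fun h' => h' ▸ H.isLM_mon_smul γ h⟩

theorem exists_isLM_of_mon_smul {γ : Fin n →₀ ℕ} {ν : Idx n s} {v : V}
    (h : IsLM K (lmon a e) lt (mon a γ • v) ν) :
    ∃ μ, IsLM K (lmon a e) lt v μ ∧ ν = shift γ μ := by
  obtain ⟨μ, hμ⟩ := H.exists_isLM (v := v) (by
    rintro rfl; exact H.ne_zero_of_isLM h (smul_zero _))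
  exact ⟨μ, hμ, (H.isLM_mon_smul_iff γ hμ).1 h⟩

/-- Divisibility defined through noncommutative products is thereby divisibility of exponents, which
is what makes Dickson's lemma applicable. -/
theorem divides_iff (μ ν : Idx n s) : Divides K a e lt μ ν ↔ ∃ γ, ν = shift γ μ := by
  constructor
  · rintro ⟨_, γ, h⟩
    exact ⟨γ, H.isLM_unique h (H.mon_smul_lmon γ μ)⟩
  · rintro ⟨γ, rfl⟩
    exact ⟨rfl, γ, H.mon_smul_lmon γ μ⟩

theorem smul_mem_submodule (N : Submodule R V) (c : K) {v : V} (hv : v ∈ N) : c • v ∈ N := by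
  obtain ⟨r, hr⟩ := H.exists_smul_eq c
  rw [hr]
  exact N.smul_mem r hv

/-- An `R`-submodule as a `K`-submodule. -/
def toK (H : IsMonomialModule K a e lt rk) (N : Submodule R V) : Submodule K V where
  carrier := N
  add_mem' := N.add_mem
  zero_mem' := N.zero_mem
  smul_mem' c _ hx := H.smul_mem_submodule N c hx

/-- Every multiple r x is a K-combination of the multiples a^γ x, so a K-subspace containing the
latter contains the whole R-span. -/
theorem span_le_of_mon_smul_mem {X : Set V} {N : Submodule K V}
    (h : ∀ x ∈ X, ∀ γ, mon a γ • x ∈ N) {v : V} (hv : v ∈ Submodule.span R X) : v ∈ N := by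
  induction hv using Submodule.closure_induction with
  | zero => exact N.zero_mem
  | add x y _ _ hx hy => exact N.add_mem hx hy
  | smul_mem r x hx =>
    refine Submodule.span_le.2 ?_ (H.smul_mem_span r x)
    rintro _ ⟨γ, rfl⟩
    exact h x hx γ

/-! #### Spans of multiples with bounded leading monomials -/

omit H in
theorem leadSpan_mono {G G' : Set V} {D D' : Set (Idx n s)} (hG : G ⊆ G') (hD : D ⊆ D') :
    leadSpan K a e lt G D ≤ leadSpan K a e lt G' D' := by
  refine Submodule.span_mono ?_
  rintro x ⟨g, hg, γ, ν, hν, hx⟩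
  exact ⟨g, hG hg, γ, ν, hD hν, hx⟩

theorem mem_leadSpan {G : Set V} {D : Set (Idx n s)} {g : V} {γ : Fin n →₀ ℕ} {μ : Idx n s}
    (hg : g ∈ G) (hμ : IsLM K (lmon a e) lt g μ) (hD : shift γ μ ∈ D) :
    mon a γ • g ∈ leadSpan K a e lt G D :=
  Submodule.subset_span ⟨g, hg, γ, _, hD, H.isLM_mon_smul γ hμ, rfl⟩

theorem leadSpan_le_lowSpan {G : Set V} {k : ℕ} :
    leadSpan K a e lt G {ν | rk ν < k} ≤ lowSpan K (lmon a e) rk k := by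
  refine Submodule.span_le.2 ?_
  rintro x ⟨g, hg, γ, ν, hν, hx, -⟩
  exact lowSpan_mono hν ((H.isLM_iff _ _).1 hx).2

theorem leadSpan_le_span {G : Set V} {D : Set (Idx n s)} {x : V}
    (hx : x ∈ leadSpan K a e lt G D) : x ∈ Submodule.span R G := by
  have : leadSpan K a e lt G D ≤ H.toK (Submodule.span R G) := by
    refine Submodule.span_le.2 ?_
    rintro x ⟨g, hg, γ, ν, hν, hx, rfl⟩
    exact Submodule.smul_mem _ _ (Submodule.subset_span hg)
  exact this hx

theorem mem_leadSpan_univ {G : Set V} {x : V} (hx : x ∈ Submodule.span R G) :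
    x ∈ leadSpan K a e lt G Set.univ := by
  refine H.span_le_of_mon_smul_mem ?_ hx
  intro g hg γ
  by_cases h0 : g = 0
  · rw [h0, smul_zero]; exact zero_mem _
  · obtain ⟨μ, hμ⟩ := H.exists_isLM h0
    exact H.mem_leadSpan hg hμ trivial

/-- Because of noncommutativity a^δ a^γ g is not a scalar multiple of a^(δ+γ) g; the other terms of
a^δ a^γ contribute multiples of g with smaller leading monomials. -/
theorem mon_smul_mon_smul_sub_mem {G : Set V} {g : V} {μ : Idx n s} (hg : g ∈ G)
    (hμ : IsLM K (lmon a e) lt g μ) (δ γ : Fin n →₀ ℕ) :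
    ∃ c : K, mon a δ • mon a γ • g - c • mon a (δ + γ) • g ∈
      leadSpan K a e lt G {ν | rk ν < rk (shift (δ + γ) μ)} := by
  obtain ⟨f, hf, hlt, heq⟩ := H.mon_smul_mon_smul δ γ
  refine ⟨f (δ + γ), ?_⟩
  rw [heq, Finsupp.sum, ← Finset.add_sum_erase _ _ (Finsupp.mem_support_iff.2 hf),
    add_sub_cancel_left]
  refine Submodule.sum_mem _ fun η hη => Submodule.smul_mem _ _ (H.mem_leadSpan hg hμ ?_)
  obtain ⟨hne, hη⟩ := Finset.mem_erase.1 hη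
  have h1 := (hlt η (Finsupp.mem_support_iff.1 hη)).resolve_left hne μ.2
  -- Exponents η and δ + γ are compared on the basis element of μ; translating by the exponent of μ
  -- turns this into a comparison of leading monomials of multiples of g.
  have h2 := H.rk_shift μ.1 _ _ h1
  simpa [shift, add_comm, add_left_comm] using h2

theorem mon_smul_mem_leadSpan {G : Set V} {τ : Idx n s} {x : V} (δ : Fin n →₀ ℕ)
    (hx : x ∈ leadSpan K a e lt G {ν | rk ν < rk τ}) :
    mon a δ • x ∈ leadSpan K a e lt G {ν | rk ν < rk (shift δ τ)} := by
  refine H.mon_smul_mem_of_span hx ?_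
  rintro _ ⟨g, hg, γ, ν, hν, hx, rfl⟩
  obtain ⟨μ, hμ, rfl⟩ := H.exists_isLM_of_mon_smul hx
  have hlt : rk (shift (δ + γ) μ) < rk (shift δ τ) := by
    rw [← shift_shift]; exact H.rk_shift δ _ _ hν
  obtain ⟨c, hc⟩ := H.mon_smul_mon_smul_sub_mem hg hμ δ γ
  rw [← sub_add_cancel (mon a δ • mon a γ • g) (c • mon a (δ + γ) • g)]
  exact add_mem (leadSpan_mono subset_rfl (fun ν (hν : rk ν < _) => hν.trans hlt) hc)
    (Submodule.smul_mem _ _ (H.mem_leadSpan hg hμ hlt))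

/-! #### S-polynomials and the Buchberger criterion -/

omit H in
theorem isSPoly_iff (f g h : V) :
    IsSPoly K a e lt f g h ↔ ∃ τ, IsSPolyAt K a e lt f g h τ := by
  constructor
  · rintro ⟨α, β, p, c, c', h⟩
    exact ⟨_, α, β, p, c, c', rfl, h⟩
  · rintro ⟨_, α, β, p, c, c', -, h⟩
    exact ⟨α, β, p, c, c', h⟩

omit H in
theorem IsSPolyAt.symm {f g h : V} {τ : Idx n s} (hh : IsSPolyAt K a e lt f g h τ) :
    IsSPolyAt K a e lt g f (-h) τ := by
  obtain ⟨α, β, p, c, c', rfl, h1, h2, h3, h4, rfl⟩ := hh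
  refine ⟨β, α, p, c', c, by rw [sup_comm], h2, h1, ?_, ?_, ?_⟩
  · rwa [sup_comm]
  · rwa [sup_comm]
  · rw [sup_comm, neg_sub]

theorem isLeading_unique {v : V} {μ : Idx n s} {c c' : K}
    (h : IsLeading K (lmon a e) lt v μ c) (h' : IsLeading K (lmon a e) lt v μ c') : c = c' :=
  ((H.isLeading_iff _ _ _).1 h).1.symm.trans ((H.isLeading_iff _ _ _).1 h').1

theorem IsSPoly.unique {f g h h' : V} (hh : IsSPoly K a e lt f g h)
    (hh' : IsSPoly K a e lt f g h') : h = h' := by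
  obtain ⟨α, β, p, c, c', h1, h2, h3, h4, rfl⟩ := hh
  obtain ⟨α', β', p', d, d', h1', h2', h3', h4', rfl⟩ := hh'
  obtain ⟨rfl, rfl⟩ := Prod.mk.inj (H.isLM_unique h1 h1')
  obtain ⟨rfl, -⟩ := Prod.mk.inj (H.isLM_unique h2 h2')
  rw [H.isLeading_unique h3 h3', H.isLeading_unique h4 h4']

theorem IsSPolyAt.self_eq_zero {f h : V} {τ : Idx n s} (hh : IsSPolyAt K a e lt f f h τ) :
    h = 0 := by
  obtain ⟨α, β, p, c, c', -, h1, h2, h3, h4, rfl⟩ := hh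
  obtain ⟨rfl, -⟩ := Prod.mk.inj (H.isLM_unique h1 h2)
  rw [H.isLeading_unique h3 h4, sub_self]

/-- Both halves are normalised to leading coefficient 1 at τ, so their leading terms cancel. -/
theorem IsSPolyAt.mem_lowSpan {f g h : V} {τ : Idx n s} (hh : IsSPolyAt K a e lt f g h τ) :
    h ∈ lowSpan K (lmon a e) rk (rk τ) := by
  obtain ⟨α, β, p, c, c', rfl, h1, h2, h3, h4, rfl⟩ := hh
  obtain ⟨e3, n3, l3⟩ := (H.isLeading_iff _ _ _).1 h3
  obtain ⟨e4, n4, l4⟩ := (H.isLeading_iff _ _ _).1 h4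
  refine H.mem_lowSpan_of_repr_eq_zero
    (sub_mem (Submodule.smul_mem _ _ l3) (Submodule.smul_mem _ _ l4)) ?_
  rw [map_sub, Finsupp.sub_apply, H.repr_smul_apply, H.repr_smul_apply, e3, e4,
    inv_mul_cancel₀ n3, inv_mul_cancel₀ n4, sub_self]

theorem exists_isSPolyAt {f g : V} {α β : Fin n →₀ ℕ} {p : Fin s}
    (hf : IsLM K (lmon a e) lt f (α, p)) (hg : IsLM K (lmon a e) lt g (β, p)) :
    ∃ c c' : K, c ≠ 0 ∧ c' ≠ 0 ∧ IsSPolyAt K a e lt f g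
      (c • (mon a (α ⊔ β - α) • f) - c' • (mon a (α ⊔ β - β) • g)) (α ⊔ β, p) := by
  have h1 := H.isLM_mon_smul (α ⊔ β - α) hf
  have h2 := H.isLM_mon_smul (α ⊔ β - β) hg
  rw [shift, tsub_add_cancel_of_le le_sup_left] at h1
  rw [shift, tsub_add_cancel_of_le le_sup_right] at h2
  obtain ⟨c, hc⟩ := h1
  obtain ⟨c', hc'⟩ := h2
  refine ⟨c⁻¹, c'⁻¹, inv_ne_zero ((H.isLeading_iff _ _ _).1 hc).2.1,
    inv_ne_zero ((H.isLeading_iff _ _ _).1 hc').2.1, α, β, p, c, c', rfl, hf, hg, hc, hc', rfl⟩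

/-- All S-polynomials of `f` and `g` at least common multiples in `D` have standard
representations with respect to `G`. -/
def SPolyStd (_ : IsMonomialModule K a e lt rk) (G : Set V) (D : Set (Idx n s)) (f g : V) : Prop :=
  ∀ h τ, IsSPolyAt K a e lt f g h τ → τ ∈ D → h ∈ leadSpan K a e lt G {ν | rk ν < rk τ}

/-- The core of the Buchberger criterion: a cancellation of two leading terms at τ is, up to a
scalar and terms below τ, a monomial multiple of the S-polynomial. -/
theorem smul_sub_smul_mem_leadSpan {G : Set V} {f g : V} {μ ν : Idx n s} {γ γ' : Fin n →₀ ℕ}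
    {τ : Idx n s} (hf : f ∈ G) (hg : g ∈ G) (hμ : IsLM K (lmon a e) lt f μ)
    (hν : IsLM K (lmon a e) lt g ν) (hτ : τ = shift γ μ) (hτ' : τ = shift γ' ν)
    (hS : H.SPolyStd G {τ' | rk τ' ≤ rk τ} f g) {c c' : K}
    (hc : H.basis.repr (c • mon a γ • f) τ = H.basis.repr (c' • mon a γ' • g) τ) :
    c • mon a γ • f - c' • mon a γ' • g ∈ leadSpan K a e lt G {ν | rk ν < rk τ} := by
  obtain ⟨α, p⟩ := μ
  obtain ⟨β, q⟩ := ν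
  obtain ⟨ζ, r⟩ := τ
  obtain ⟨rfl, rfl⟩ := Prod.mk.inj hτ
  obtain ⟨hζ, h⟩ := Prod.mk.inj hτ'
  obtain rfl : r = q := h
  simp only at hζ
  obtain ⟨u, u', hu, hu', hsp⟩ := H.exists_isSPolyAt hμ hν
  -- The common leading monomial is a multiple of the least common multiple; δ is the cofactor by
  -- which the S-polynomial is multiplied.
  have hle : α ⊔ β ≤ γ + α := sup_le le_add_self (hζ ▸ le_add_self)
  obtain ⟨δ, hδ⟩ := exists_add_of_le hle
  have hδ1 : δ + (α ⊔ β - α) = γ := by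
    have : δ + (α ⊔ β - α) + α = γ + α := by
      rw [add_assoc, tsub_add_cancel_of_le le_sup_left, hδ, add_comm]
    exact add_right_cancel this
  have hδ2 : δ + (α ⊔ β - β) = γ' := by
    have : δ + (α ⊔ β - β) + β = γ' + β := by
      rw [add_assoc, tsub_add_cancel_of_le le_sup_right, ← hζ, hδ, add_comm]
    exact add_right_cancel this
  have hsh : shift δ (α ⊔ β, r) = (γ + α, r) := by rw [shift, hδ, add_comm]
  have h1 := H.mon_smul_mem_leadSpan δ (hS _ _ hsp (by
    change rk (α ⊔ β, r) ≤ rk (γ + α, r)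
    rw [← hsh]; exact H.rk_le_shift _ _))
  obtain ⟨k, hk⟩ := H.mon_smul_mon_smul_sub_mem hf hμ δ (α ⊔ β - α)
  obtain ⟨k', hk'⟩ := H.mon_smul_mon_smul_sub_mem hg hν δ (α ⊔ β - β)
  rw [hsh] at h1
  rw [hδ1] at hk
  rw [hδ2] at hk'
  have e1 : shift γ (α, r) = (γ + α, r) := rfl
  have e2 : shift γ' (β, r) = (γ + α, r) := by rw [shift, hζ]
  rw [e1] at hk
  rw [e2] at hk'
  set M := leadSpan K a e lt G {ν | rk ν < rk (γ + α, r)} with hM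
  -- the leading coefficients of the two multiples in the S-polynomial do not vanish
  have hx := H.isLM_mon_smul γ hμ
  have hy := H.isLM_mon_smul γ' hν
  have hxx := H.isLM_mon_smul δ (H.isLM_mon_smul (α ⊔ β - α) hμ)
  rw [shift_shift, hδ1] at hxx
  rw [e1] at hx hxx
  rw [e2] at hy
  have hx0 := ((H.isLM_iff _ _).1 hx).1
  have hy0 := ((H.isLM_iff _ _).1 hy).1
  have hxx0 := ((H.isLM_iff _ _).1 hxx).1
  have hz : ∀ m ∈ M, H.basis.repr m (γ + α, r) = 0 := fun m hm =>
    H.repr_eq_zero_of_mem_lowSpan (H.leadSpan_le_lowSpan hm) le_rfl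
  -- Up to multiples below τ, the product of a^δ with the S-polynomial is a combination of a^γ f and
  -- a^γ' g, with extra scalars k and k' from reordering the monomials.
  have h2 : (u * k) • mon a γ • f - (u' * k') • mon a γ' • g ∈ M := by
    have := sub_mem h1 (sub_mem (M.smul_mem u hk) (M.smul_mem u' hk'))
    rw [smul_sub, H.smul_comm, H.smul_comm, smul_sub, smul_sub] at this
    rw [mul_smul, mul_smul]
    convert this using 1
    abel
  -- If k vanished, a^δ a^(α ⊔ β - α) f would lie below τ, which is its leading monomial.
  have hk0 : k ≠ 0 := by
    rintro rfl
    rw [zero_smul, sub_zero] at hk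
    exact hxx0 (hz _ hk)
  have h3 := hz _ h2
  simp only [map_sub, Finsupp.sub_apply, H.repr_smul_apply] at h3 hc
  have h4 := M.smul_mem (c * (u * k)⁻¹) h2
  have huk : u * k ≠ 0 := mul_ne_zero hu hk0
  -- Both pairs of scalars make the coefficients at τ cancel, so they are proportional and the claim
  -- is a multiple of `h2`.
  have hcc : c * (u * k)⁻¹ * (u' * k') = c' := by
    refine mul_right_cancel₀ hy0 ?_
    rw [← hc]
    rw [sub_eq_zero] at h3
    rw [mul_assoc (c * (u * k)⁻¹), ← h3]
    field_simp
  rwa [smul_sub, smul_smul, smul_smul, inv_mul_cancel_right₀ huk, hcc] at h4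

/-- If the terms at τ cancel in a sum of multiples, comparing each multiple that reaches τ with a
fixed one rewrites the sum by multiples strictly below τ. -/
theorem mem_leadSpan_lt_of_repr_eq_zero {G : Set V} {τ : Idx n s}
    (hS : ∀ f ∈ G, ∀ g ∈ G, H.SPolyStd G {τ' | rk τ' ≤ rk τ} f g) {v : V}
    (hv : v ∈ leadSpan K a e lt G {ν | rk ν ≤ rk τ}) (h0 : H.basis.repr v τ = 0) :
    v ∈ leadSpan K a e lt G {ν | rk ν < rk τ} := by
  set M := leadSpan K a e lt G {ν | rk ν < rk τ} with hM
  by_cases hex : ∃ g ∈ G, ∃ γ, IsLM K (lmon a e) lt (mon a γ • g) τ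
  · obtain ⟨g, hg, γ, hγ⟩ := hex
    obtain ⟨ν, hν, hτ⟩ := H.exists_isLM_of_mon_smul hγ
    have hy0 := ((H.isLM_iff _ _).1 hγ).1
    -- The map subtracts the multiple of the fixed a^γ g that kills the coefficient at τ. It sends
    -- all generators into M and fixes v, whose coefficient at τ is already zero.
    have key : leadSpan K a e lt G {ν | rk ν ≤ rk τ} ≤
        M.comap (LinearMap.id - (LinearMap.toSpanSingleton K V (mon a γ • g)) ∘ₗ
          ((H.basis.repr (mon a γ • g) τ)⁻¹ • (H.basis.coord τ))) := by
      refine Submodule.span_le.2 ?_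
      rintro _ ⟨f, hf, γ', ν', hν', hx, rfl⟩
      change _ - (((H.basis.repr (mon a γ • g) τ)⁻¹ * H.basis.repr (mon a γ' • f) τ) •
        (mon a γ • g)) ∈ M
      obtain ⟨μ, hμ, rfl⟩ := H.exists_isLM_of_mon_smul hx
      by_cases hlt : rk (shift γ' μ) < rk τ
      · rw [H.repr_eq_zero_of_mem_lowSpan ((H.isLM_iff _ _).1 hx).2 hlt, mul_zero, zero_smul,
          sub_zero]
        exact H.mem_leadSpan hf hμ hlt
      · have heq : τ = shift γ' μ := H.rk_injective (le_antisymm (not_lt.1 hlt) hν')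
        have := H.smul_sub_smul_mem_leadSpan hf hg hμ hν heq hτ (hS f hf g hg) (c := 1)
          (c' := (H.basis.repr (mon a γ • g) τ)⁻¹ * H.basis.repr (mon a γ' • f) τ) (by
            rw [H.repr_smul_apply, H.repr_smul_apply]
            field_simp)
        rwa [one_smul] at this
    have := key hv
    change v - ((H.basis.repr (mon a γ • g) τ)⁻¹ * H.basis.repr v τ) • (mon a γ • g) ∈ M at this
    rwa [h0, mul_zero, zero_smul, sub_zero] at this
  · refine Submodule.span_mono ?_ hv
    rintro _ ⟨f, hf, γ', ν', hν', hx, rfl⟩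
    refine ⟨f, hf, γ', ν', lt_of_le_of_ne (b := rk τ) hν' fun h => hex ⟨f, hf, γ', ?_⟩, hx, rfl⟩
    rwa [← H.rk_injective h]

-- Only finitely many generators enter v, and the largest of their leading monomials serves as the
-- bound τ. The case v = 0 is separate because D may be empty.
omit H in
theorem leadSpan_induction {G : Set V} {D : Set (Idx n s)} {v : V}
    (hv : v ∈ leadSpan K a e lt G D) :
    v = 0 ∨ ∃ τ ∈ D, v ∈ leadSpan K a e lt G {ν | rk ν ≤ rk τ} := by
  induction hv using Submodule.span_induction with
  | mem x hx =>
    obtain ⟨g, hg, γ, ν, hν, hx, rfl⟩ := hx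
    exact Or.inr ⟨ν, hν, Submodule.subset_span ⟨g, hg, γ, ν, le_refl (rk ν), hx, rfl⟩⟩
  | zero => exact Or.inl rfl
  | smul c x _ hx =>
    rcases hx with rfl | ⟨τ, hτ, hx⟩
    · exact Or.inl (smul_zero c)
    · exact Or.inr ⟨τ, hτ, Submodule.smul_mem _ _ hx⟩
  | add x y _ _ hx hy =>
    rcases hx with rfl | ⟨τ, hτ, hx⟩
    · rwa [zero_add]
    rcases hy with rfl | ⟨τ', hτ', hy⟩
    · rw [add_zero]; exact Or.inr ⟨τ, hτ, hx⟩
    rcases le_total (rk τ) (rk τ') with h | h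
    · exact Or.inr ⟨τ', hτ', add_mem
        (leadSpan_mono subset_rfl (fun ν (hν : rk ν ≤ _) => hν.trans h) hx) hy⟩
    · exact Or.inr ⟨τ, hτ, add_mem hx
        (leadSpan_mono subset_rfl (fun ν (hν : rk ν ≤ _) => hν.trans h) hy)⟩

/-- The **Buchberger criterion**, restricted to a set `D` of monomials that is closed downwards. -/
theorem exists_isLM_of_sPolyStd {G : Set V} {D : Set (Idx n s)}
    (hD : ∀ μ ∈ D, ∀ ν, rk ν ≤ rk μ → ν ∈ D) (hS : ∀ f ∈ G, ∀ g ∈ G, H.SPolyStd G D f g) {v : V}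
    (hv : v ∈ leadSpan K a e lt G D) (hv0 : v ≠ 0) :
    ∃ ν, IsLM K (lmon a e) lt v ν ∧ ∃ g ∈ G, ∃ γ, IsLM K (lmon a e) lt (mon a γ • g) ν := by
  obtain ⟨τ, hτ, hv⟩ := (leadSpan_induction hv).resolve_left hv0
  induction hk : rk τ using Nat.strong_induction_on generalizing τ with
  | _ k ih =>
    subst hk
    -- If the coefficient at τ vanishes, the bound can be lowered. Otherwise τ is the leading
    -- monomial of v, and some generating multiple must reach it.
    by_cases h0 : H.basis.repr v τ = 0
    · have h1 := H.mem_leadSpan_lt_of_repr_eq_zero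
        (fun f hf g hg h τ' hh hτ' => hS f hf g hg h τ' hh (hD τ hτ τ' hτ')) hv h0
      obtain ⟨τ', hτ', h2⟩ := (leadSpan_induction h1).resolve_left hv0
      exact ih _ hτ' τ' (hD τ hτ τ' (le_of_lt hτ')) h2 rfl
    · have hle : leadSpan K a e lt G {ν | rk ν ≤ rk τ} ≤ lowSpan K (lmon a e) rk (rk τ + 1) :=
        (leadSpan_mono subset_rfl fun ν (hν : rk ν ≤ _) => Nat.lt_succ_of_le hν).trans
          H.leadSpan_le_lowSpan
      refine ⟨τ, (H.isLM_iff _ _).2 ⟨h0, hle hv⟩, ?_⟩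
      by_contra hex
      refine h0 (H.repr_eq_zero_of_mem_lowSpan (k := rk τ) ?_ le_rfl)
      refine H.leadSpan_le_lowSpan (G := G) ?_
      refine Submodule.span_mono ?_ hv
      rintro _ ⟨f, hf, γ', ν', hν', hx, rfl⟩
      refine ⟨f, hf, γ', ν', lt_of_le_of_ne (b := rk τ) hν' fun h => hex ⟨f, hf, γ', ?_⟩, hx, rfl⟩
      rwa [← H.rk_injective h]

/-- A left Gröbner basis generates. -/
theorem span_eq_of_isLeftGroebner {N : Submodule R V} {G : Set V}
    (hG : IsLeftGroebner K a e lt N G) : Submodule.span R G = N := by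
  obtain ⟨-, hGN, h0, hdiv⟩ := hG
  refine le_antisymm (Submodule.span_le.2 hGN) fun v hv => ?_
  -- Subtracting a multiple of a basis element with the same leading term lowers the rank bound, so
  -- the induction on the bound reduces v to 0.
  have key : ∀ k, ∀ v ∈ N, v ∈ lowSpan K (lmon a e) rk k → v ∈ Submodule.span R G := by
    intro k
    induction k using Nat.strong_induction_on with
    | _ k ih =>
      intro v hv hk
      by_cases hv0 : v = 0
      · rw [hv0]; exact zero_mem _
      obtain ⟨g, hg, μ, ν, hμ, hν, hd⟩ := hdiv v hv hv0
      obtain ⟨γ, rfl⟩ := (H.divides_iff _ _).1 hd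
      obtain ⟨h1, h2⟩ := (H.isLM_iff _ _).1 hν
      obtain ⟨h3, h4⟩ := (H.isLM_iff _ _).1 (H.isLM_mon_smul γ hμ)
      set c := H.basis.repr v (shift γ μ) * (H.basis.repr (mon a γ • g) (shift γ μ))⁻¹ with hc
      have h5 : v - c • mon a γ • g ∈ lowSpan K (lmon a e) rk (rk (shift γ μ)) := by
        refine H.mem_lowSpan_of_repr_eq_zero (sub_mem h2 (Submodule.smul_mem _ _ h4)) ?_
        rw [map_sub, Finsupp.sub_apply, H.repr_smul_apply, hc,
          inv_mul_cancel_right₀ h3, sub_self]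
      have h6 : c • mon a γ • g ∈ Submodule.span R G := H.smul_mem_submodule _ _
        (Submodule.smul_mem _ _ (Submodule.subset_span hg))
      have h7 := ih _ (H.isLM_rk_le hν hk) _
        (sub_mem hv (Submodule.span_le.2 hGN h6)) h5
      simpa using add_mem h7 h6
  obtain rfl | hv0 := eq_or_ne v 0
  · exact zero_mem _
  · obtain ⟨μ, hμ⟩ := H.exists_isLM hv0
    exact key _ v hv ((H.isLM_iff _ _).1 hμ).2

end IsMonomialModule

/-! ### Termination -/

theorem terminates_of_invariant {σ α : Type*} {Step : σ → σ → Prop} {r : α → α → Prop}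
    (hr : WellFounded r) (m : σ → α) (Inv : σ → Prop)
    (hInv : ∀ x y, Inv x → Step x y → Inv y) (hm : ∀ x y, Inv x → Step x y → r (m y) (m x))
    {x : σ} (hx : Inv x) : Terminates Step x := by
  induction h : m x using hr.induction generalizing x with
  | _ k ih =>
    subst h
    exact ⟨_, fun y hy => ih _ (hm x y hx hy) (hInv x y hx hy) rfl⟩

theorem invariant_of_reflTransGen {σ : Type*} {Step : σ → σ → Prop} (Inv : σ → Prop)
    (hInv : ∀ x y, Inv x → Step x y → Inv y) {x y : σ} (hx : Inv x)
    (h : Relation.ReflTransGen Step x y) : Inv y := by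
  induction h with
  | refl => exact hx
  | tail _ hs ih => exact hInv _ _ ih hs

/-- Sets of monomials that are closed under multiplication by monomials. -/
abbrev ShiftClosed (n s : ℕ) : Type :=
  {T : Set (Idx n s) // ∀ ν ∈ T, ∀ γ, shift γ ν ∈ T}

/-- **Dickson's lemma**, for monomials of a free module. -/
theorem ShiftClosed.wellFounded (n s : ℕ) :
    WellFounded fun T T' : ShiftClosed n s => T'.1 ⊂ T.1 := by
  rw [wellFounded_iff_isEmpty_descending_chain]
  refine ⟨fun ⟨f, hf⟩ => ?_⟩
  have hmono : Monotone fun k => (f k).1 := monotone_nat_of_le_succ fun k => (hf k).1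
  choose ν hν hν' using fun k => Set.exists_of_ssubset (hf k)
  -- Here ν k is new in the set with index k + 1. Of two such monomials with k < l and ν k dividing
  -- ν l, the latter already lies in the set with index l.
  obtain ⟨k, l, hkl, h1, h2⟩ := (wellQuasiOrdered_le (α := Fin n →₀ ℕ)).prod
    (Finite.wellQuasiOrdered (α := Fin s) (· = ·)) ν
  refine hν' l ?_
  obtain ⟨γ, hγ⟩ := exists_add_of_le h1
  have : ν l = shift γ (ν k) := Prod.ext (by rw [hγ, add_comm]; rfl) h2.symm
  rw [this]
  exact (f l).2 _ (hmono (Nat.succ_le_of_lt hkl) (hν k)) γ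

theorem setOf_mem_append {V : Type*} (G : List V) (η : V) :
    {g | g ∈ G ++ [η]} = insert η {g | g ∈ G} := by
  ext; simp [or_comm]

/-- In the division of the S-polynomials of the elements of `G`, those of `f` and `g` are in the
set `S` of the S-polynomials still to be treated, are just being divided, or have standard
representations. -/
def SPolyTodo (K : Type*) {R V : Type*} [Field K] [Ring R] [AddCommGroup V]
    [Module K V] [Module R V] {n s : ℕ} (a : Fin n → R) (e : Fin s → V)
    (lt : Idx n s → Idx n s → Prop) (rk : Idx n s → ℕ) (G S : Set V) (w : Option (V × V))
    (f g : V) : Prop :=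
  ∀ h τ, IsSPolyAt K a e lt f g h τ → h ∈ S ∨ ∃ x : V × V, (x = (0, 0) ∨ w = some x) ∧
    h - (x.1 + x.2) ∈ leadSpan K a e lt G {ν | rk ν < rk τ} ∧
    x.1 ∈ lowSpan K (lmon a e) rk (rk τ) ∧ x.2 ∈ lowSpan K (lmon a e) rk (rk τ)

/-- The least bound for the ranks of the monomials of `v`. -/
noncomputable def divRank (K : Type*) {V ι : Type*} [Field K] [AddCommGroup V] [Module K V]
    (m : ι → V) (rk : ι → ℕ) (v : V) : ℕ :=
  sInf {k | v ∈ lowSpan K m rk k}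

/-- The measure of a division in progress. -/
noncomputable def workRank (K : Type*) {V ι : Type*} [Field K] [AddCommGroup V] [Module K V]
    (m : ι → V) (rk : ι → ℕ) : Option (V × V) → ℕ
  | none => 0
  | some x => divRank K m rk x.1 + 1

namespace IsMonomialModule

variable {K R V : Type*} [Field K] [Ring R] [AddCommGroup V] [Module K V] [Module R V] {n s : ℕ}
  {a : Fin n → R} {e : Fin s → V} {lt : Idx n s → Idx n s → Prop} {rk : Idx n s → ℕ}
  (H : IsMonomialModule K a e lt rk)

include H

theorem exists_mem_lowSpan (v : V) : ∃ k, v ∈ lowSpan K (lmon a e) rk k := by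
  obtain rfl | hv := eq_or_ne v 0
  · exact ⟨0, zero_mem _⟩
  · obtain ⟨μ, hμ⟩ := H.exists_isLM hv
    exact ⟨_, ((H.isLM_iff _ _).1 hμ).2⟩

theorem divRank_lt {v v' : V} {ν : Idx n s} (h : IsLM K (lmon a e) lt v ν)
    (h' : v' ∈ lowSpan K (lmon a e) rk (rk ν)) :
    divRank K (lmon a e) rk v' < divRank K (lmon a e) rk v :=
  lt_of_le_of_lt (Nat.sInf_le h') (H.isLM_rk_le h (Nat.sInf_mem (H.exists_mem_lowSpan v)))

theorem shift_mem_leadSet {G : Set V} {ν : Idx n s} (hν : ν ∈ leadSet K a e lt G)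
    (γ : Fin n →₀ ℕ) : shift γ ν ∈ leadSet K a e lt G := by
  obtain ⟨g, hg, δ, h⟩ := hν
  obtain ⟨μ, hμ, rfl⟩ := H.exists_isLM_of_mon_smul h
  exact ⟨g, hg, γ + δ, by rw [shift_shift]; exact H.isLM_mon_smul _ hμ⟩

/-- `leadSet` as an element of `ShiftClosed`. -/
def leadSC (H : IsMonomialModule K a e lt rk) (G : Set V) : ShiftClosed n s :=
  ⟨leadSet K a e lt G, fun _ hν γ => H.shift_mem_leadSet hν γ⟩

omit H in
theorem leadSet_mono {G G' : Set V} (h : G ⊆ G') :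
    leadSet K a e lt G ⊆ leadSet K a e lt G' := by
  rintro ν ⟨g, hg, hν⟩
  exact ⟨g, h hg, hν⟩

/-- No monomial of a reduced η lies in the lead set of G, in particular not its leading monomial,
which is the new element. -/
theorem leadSet_ssubset {G G' : Set V} {η : V} (hG : G ⊆ G') (hη : η ∈ G') (h0 : η ≠ 0)
    (hred : η ∈ Submodule.span K (lmon a e '' (leadSet K a e lt G)ᶜ)) :
    leadSet K a e lt G ⊂ leadSet K a e lt G' := by
  obtain ⟨μ, hμ⟩ := H.exists_isLM h0
  refine (Set.ssubset_iff_of_subset (leadSet_mono hG)).2 ⟨shift 0 μ,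
    ⟨η, hη, 0, H.isLM_mon_smul 0 hμ⟩, ?_⟩
  have : shift 0 μ = μ := by simp [shift]
  rw [this]
  exact (H.mem_span_iff _ _).1 hred μ ((H.isLM_iff _ _).1 hμ).1

/-! #### Division -/

/-- Everything used about division, for both kinds of step: the part still to be divided falls below
its leading monomial ν, the sum of both parts changes by multiples of elements of G with leading
monomial at most ν, and the remainder stays irreducible. -/
theorem DivStep.spec {G : List V} {x y : V × V} (h : DivStep K a e lt G x y) :
    ∃ ν, IsLM K (lmon a e) lt x.1 ν ∧ y.1 ∈ lowSpan K (lmon a e) rk (rk ν) ∧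
      x.1 + x.2 - (y.1 + y.2) ∈ leadSpan K a e lt {g | g ∈ G} {τ | rk τ < rk ν + 1} ∧
      (x.2 ∈ lowSpan K (lmon a e) rk (rk ν + 1) → y.2 ∈ lowSpan K (lmon a e) rk (rk ν + 1)) ∧
      (y.2 - x.2 ∈ Submodule.span K {lmon a e ν}) ∧
      (x.2 ∈ Submodule.span K (lmon a e '' (leadSet K a e lt {g | g ∈ G})ᶜ) →
        y.2 ∈ Submodule.span K (lmon a e '' (leadSet K a e lt {g | g ∈ G})ᶜ)) := by
  cases h with
  | reduce v η g γ ν c c' hg hv hγ =>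
    obtain ⟨h1, h2, h3⟩ := (H.isLeading_iff _ _ _).1 hv
    obtain ⟨h4, h5, h6⟩ := (H.isLeading_iff _ _ _).1 hγ
    refine ⟨ν, ⟨c, hv⟩, ?_, ?_, id, by simp, id⟩
    · refine H.mem_lowSpan_of_repr_eq_zero (sub_mem h3 (Submodule.smul_mem _ _ h6)) ?_
      rw [map_sub, Finsupp.sub_apply, H.repr_smul_apply, h1, h4, div_mul_cancel₀ _ h5, sub_self]
    · have : v + η - (v - (c / c') • mon a γ • g + η) = (c / c') • mon a γ • g := by abel
      change v + η - (v - (c / c') • mon a γ • g + η) ∈ _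
      rw [this]
      exact Submodule.smul_mem _ _ (Submodule.subset_span
        ⟨g, hg, γ, ν, Nat.lt_succ_self _, ⟨c', hγ⟩, rfl⟩)
  | shift v η ν c hv hG =>
    obtain ⟨h1, h2, h3⟩ := (H.isLeading_iff _ _ _).1 hv
    refine ⟨ν, ⟨c, hv⟩, ?_, ?_, ?_, ?_, ?_⟩
    · rw [← h1]
      exact H.sub_smul_lmon_mem_lowSpan h3
    · have : v + η - (v - c • lmon a e ν + (η + c • lmon a e ν)) = 0 := by abel
      change v + η - (v - c • lmon a e ν + (η + c • lmon a e ν)) ∈ _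
      rw [this]
      exact zero_mem _
    · exact fun h => add_mem h (Submodule.smul_mem _ _ (lmon_mem_lowSpan (Nat.lt_succ_self _)))
    · change η + c • lmon a e ν - η ∈ _
      rw [add_sub_cancel_left]
      exact Submodule.smul_mem _ _ (Submodule.mem_span_singleton_self _)
    · exact fun h => add_mem h (Submodule.smul_mem _ _ (Submodule.subset_span ⟨ν, hG, rfl⟩))

theorem exists_divStep (G : List V) {v : V} (hv : v ≠ 0) (η : V) :
    ∃ y, DivStep K a e lt G (v, η) y := by
  obtain ⟨ν, c, hc⟩ := H.exists_isLM hv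
  by_cases h : ∃ g ∈ G, ∃ γ : Fin n →₀ ℕ, IsLM K (lmon a e) lt (mon a γ • g) ν
  · obtain ⟨g, hg, γ, c', hc'⟩ := h
    exact ⟨_, DivStep.reduce v η g γ ν c c' hg hc hc'⟩
  · exact ⟨_, DivStep.shift v η ν c hc h⟩

/-! ### Progress of an S-polynomial through the division. -/

omit H in
theorem SPolyTodo.choose {G S : Set V} {h₀ f g : V}
    (h : SPolyTodo K a e lt rk G S none f g) (H : IsMonomialModule K a e lt rk) :
    SPolyTodo K a e lt rk G (S \ {h₀}) (some (h₀, 0)) f g := by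
  intro h' τ hh
  rcases h h' τ hh with hS | ⟨x, hx, h1⟩
  · by_cases he : h' = h₀
    · subst he
      exact Or.inr ⟨(h', 0), Or.inr rfl, by simp, IsSPolyAt.mem_lowSpan H hh, zero_mem _⟩
    · exact Or.inl ⟨hS, he⟩
  · exact Or.inr ⟨x, Or.inl (hx.resolve_right (by simp)), h1⟩

omit H in
theorem SPolyTodo.start {G S : Set V} {w : Option (V × V)} {f g : V}
    (h : SPolyTodo K a e lt rk G S none f g) : SPolyTodo K a e lt rk G S w f g := by
  intro h' τ hh
  rcases h h' τ hh with hS | ⟨x, hx, h1⟩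
  · exact Or.inl hS
  · exact Or.inr ⟨x, Or.inl (hx.resolve_right (by simp)), h1⟩

/-- What is still to be divided lies below τ, hence so does its leading monomial; the subtracted
multiple is thus allowed in a standard representation at τ. -/
theorem SPolyTodo.divide {G : List V} {S : Set V} {x y : V × V} {f g : V}
    (h : SPolyTodo K a e lt rk {g | g ∈ G} S (some x) f g) (hxy : DivStep K a e lt G x y) :
    SPolyTodo K a e lt rk {g | g ∈ G} S (some y) f g := by
  intro h' τ hh
  rcases h h' τ hh with hS | ⟨z, rfl | hz, h1, h2, h3⟩
  · exact Or.inl hS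
  · exact Or.inr ⟨(0, 0), Or.inl rfl, h1, h2, h3⟩
  · obtain rfl := Option.some.inj hz
    obtain ⟨ν, hν, h4, h5, -, h6, -⟩ := DivStep.spec H hxy
    have hlt := H.isLM_rk_le hν h2
    refine Or.inr ⟨y, Or.inr rfl, ?_, lowSpan_mono hlt.le h4, ?_⟩
    · have := add_mem h1 (leadSpan_mono subset_rfl
        (fun τ' (hτ' : rk τ' < _) => lt_of_lt_of_le hτ' hlt) h5)
      rwa [sub_add_sub_cancel] at this
    · rw [← sub_add_cancel y.2 x.2]
      refine add_mem (Submodule.span_le.2 ?_ h6) h3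
      rw [Set.singleton_subset_iff]
      exact lmon_mem_lowSpan hlt

omit H in
theorem SPolyTodo.discard {G S : Set V} {f g : V}
    (h : SPolyTodo K a e lt rk G S (some (0, 0)) f g) : SPolyTodo K a e lt rk G S none f g := by
  intro h' τ hh
  rcases h h' τ hh with hS | ⟨x, hx, h1⟩
  · exact Or.inl hS
  · exact Or.inr ⟨x, Or.inl (hx.elim id fun hx => (Option.some.inj hx).symm), h1⟩

theorem mem_leadSpan_self {G : Set V} {g : V} {k : ℕ} (hg : g ∈ G)
    (hk : g ∈ lowSpan K (lmon a e) rk k) : g ∈ leadSpan K a e lt G {ν | rk ν < k} := by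
  obtain rfl | h0 := eq_or_ne g 0
  · exact zero_mem _
  · obtain ⟨μ, hμ⟩ := H.exists_isLM h0
    refine Submodule.subset_span ⟨g, hg, 0, μ, H.isLM_rk_le hμ hk, hμ, ?_⟩
    rw [mon_zero, one_smul]

/-- The remainder η becomes a generator. As it lies below τ, the product 1 · η completes the
standard representation of the S-polynomial. -/
theorem SPolyTodo.append {G G' S S' : Set V} {η f g : V} (hG : G ⊆ G') (hη : η ∈ G')
    (hS : S ⊆ S') (h : SPolyTodo K a e lt rk G S (some (0, η)) f g) :
    SPolyTodo K a e lt rk G' S' none f g := by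
  intro h' τ hh
  rcases h h' τ hh with h1 | ⟨x, rfl | hx, h1, h2, h3⟩
  · exact Or.inl (hS h1)
  · exact Or.inr ⟨(0, 0), Or.inl rfl, leadSpan_mono hG subset_rfl h1, h2, h3⟩
  · obtain rfl := Option.some.inj hx
    refine Or.inr ⟨(0, 0), Or.inl rfl, ?_, zero_mem _, zero_mem _⟩
    have := add_mem (leadSpan_mono hG subset_rfl h1) (H.mem_leadSpan_self hη h3)
    simpa using this

/-- With no division in progress, an S-polynomial that is not pending can only be in the finished
state (0, 0), where the congruence is a standard representation. -/
theorem sPolyStd_of_todo {G : Set V} {S : Set V} {D : Set (Idx n s)} {f g : V}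
    (h : SPolyTodo K a e lt rk G S none f g)
    (hD : ∀ h ∈ S, ∀ τ ∈ D, ¬ IsSPolyAt K a e lt f g h τ) : H.SPolyStd G D f g := by
  intro h' τ hh hτ
  rcases h h' τ hh with hS | ⟨x, hx, h1, -⟩
  · exact absurd hh (hD _ hS _ hτ)
  · obtain rfl := hx.resolve_right (by simp)
    simpa using h1

/-- The algorithms form only the S-polynomials of pairs in list order; swapping the pair changes the
sign, and equal elements give 0. -/
theorem sPolyStd_of_pairwise {G : List V} {D : Set (Idx n s)}
    (h : G.Pairwise (H.SPolyStd {g | g ∈ G} D)) :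
    ∀ f ∈ G, ∀ g ∈ G, H.SPolyStd {g | g ∈ G} D f g := by
  have : Std.Symm (H.SPolyStd {g | g ∈ G} D) := ⟨fun f g hfg h τ hh hτ => by
    have := hfg _ τ (IsSPolyAt.symm hh) hτ
    rwa [neg_mem_iff] at this⟩
  refine fun f hf g hg => List.Pairwise.forall_of_forall ?_ h hf hg
  intro f _ h τ hh _
  rw [IsSPolyAt.self_eq_zero H hh]
  exact zero_mem _

theorem finite_sPolys (G : List V) (η : V) :
    {h | ∃ g ∈ G, IsSPoly K a e lt g η h}.Finite := by
  have : {h | ∃ g ∈ G, IsSPoly K a e lt g η h} =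
      ⋃ g ∈ {g | g ∈ G}, {h | IsSPoly K a e lt g η h} := by
    ext h; simp
  rw [this]
  refine Set.Finite.biUnion (List.finite_toSet G) fun g _ => ?_
  exact Set.Subsingleton.finite fun h hh h' hh' => IsSPoly.unique H hh hh'

theorem sPoly_mem {N : Submodule R V} {f g h : V} (hf : f ∈ N) (hg : g ∈ N)
    (hh : IsSPoly K a e lt f g h) : h ∈ N := by
  obtain ⟨α, β, p, c, c', -, -, -, -, rfl⟩ := hh
  exact N.sub_mem (H.smul_mem_submodule N _ (N.smul_mem _ hf))
    (H.smul_mem_submodule N _ (N.smul_mem _ hg))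

/-! #### The Buchberger algorithm -/

/-- The invariants of the Buchberger algorithm. -/
structure BuchbergerInv (H : IsMonomialModule K a e lt rk) (N : Submodule R V)
    (t : BuchbergerState V) : Prop where
  ne_zero : ∀ g ∈ t.gens, g ≠ 0
  span_eq : Submodule.span R {g | g ∈ t.gens} = N
  finite : t.pending.Finite
  pending_mem : ∀ h ∈ t.pending, h ∈ N
  work_mem : ∀ x, t.work = some x → x.1 + x.2 ∈ N
  reduced : ∀ x, t.work = some x →
    x.2 ∈ Submodule.span K (lmon a e '' (leadSet K a e lt {g | g ∈ t.gens})ᶜ)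
  todo : t.gens.Pairwise (SPolyTodo K a e lt rk {g | g ∈ t.gens} t.pending t.work)

theorem buchbergerInv_init (Θ : List V) (hΘ : ∀ θ ∈ Θ, θ ≠ 0) :
    H.BuchbergerInv (Submodule.span R {θ | θ ∈ Θ}) (buchbergerInit K a e lt Θ) where
  ne_zero := hΘ
  span_eq := rfl
  finite := by
    have : (buchbergerInit K a e lt Θ).pending =
        ⋃ i : Fin Θ.length, ⋃ j : Fin Θ.length,
          {h | i < j ∧ IsSPoly K a e lt (Θ.get i) (Θ.get j) h} := by
      ext h; simp [buchbergerInit]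
    rw [this]
    refine Set.finite_iUnion fun i => Set.finite_iUnion fun j => ?_
    exact Set.Subsingleton.finite fun h hh h' hh' => IsSPoly.unique H hh.2 hh'.2
  pending_mem := by
    rintro h ⟨i, j, -, hh⟩
    exact H.sPoly_mem (Submodule.subset_span (List.get_mem _ _))
      (Submodule.subset_span (List.get_mem _ _)) hh
  work_mem x hx := by cases hx
  reduced x hx := by cases hx
  todo := by
    rw [List.pairwise_iff_get]
    exact fun i j hij h τ hh => Or.inl ⟨i, j, hij, (isSPoly_iff _ _ _).2 ⟨τ, hh⟩⟩

theorem BuchbergerInv.step {N : Submodule R V} {t t' : BuchbergerState V}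
    (h : H.BuchbergerInv N t) (hs : BuchbergerStep K a e lt t t') : H.BuchbergerInv N t' := by
  cases hs with
  | choose G S h₀ hh =>
    refine ⟨h.ne_zero, h.span_eq, h.finite.subset Set.sdiff_subset,
      fun g hg => h.pending_mem g hg.1, ?_, ?_, h.todo.imp fun hfg => SPolyTodo.choose hfg H⟩
    · intro x hx
      obtain rfl := Option.some.inj hx
      simpa using h.pending_mem _ hh
    · intro x hx
      obtain rfl := Option.some.inj hx
      exact zero_mem _
  | divide G S x y hxy =>
    obtain ⟨ν, -, -, h1, -, -, h2⟩ := DivStep.spec H hxy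
    refine ⟨h.ne_zero, h.span_eq, h.finite, h.pending_mem, ?_, ?_,
      h.todo.imp fun hfg => SPolyTodo.divide H hfg hxy⟩
    · intro y' hy
      obtain rfl := Option.some.inj hy
      have h3 := N.sub_mem (h.work_mem x rfl) (h.span_eq ▸ H.leadSpan_le_span h1)
      rwa [sub_sub_cancel] at h3
    · intro y' hy
      obtain rfl := Option.some.inj hy
      exact h2 (h.reduced x rfl)
  | discard G S =>
    exact ⟨h.ne_zero, h.span_eq, h.finite, h.pending_mem, by simp, by simp,
      h.todo.imp fun hfg => SPolyTodo.discard hfg⟩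
  | append G S η hη =>
    have hηN : η ∈ N := by simpa using h.work_mem _ rfl
    have hGN : ∀ g ∈ G, g ∈ N := fun g hg => h.span_eq ▸ Submodule.subset_span hg
    refine ⟨?_, ?_, h.finite.union (H.finite_sPolys G η), ?_, by simp, by simp, ?_⟩
    · intro g hg
      rcases List.mem_append.1 hg with hg | hg
      · exact h.ne_zero g hg
      · rwa [List.mem_singleton.1 hg]
    · rw [setOf_mem_append, Submodule.span_insert_eq_span, h.span_eq]
      rwa [h.span_eq]
    · rintro g (hg | ⟨f, hf, hg⟩)
      · exact h.pending_mem g hg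
      · exact H.sPoly_mem (hGN f hf) hηN hg
    · refine List.pairwise_append.2 ⟨h.todo.imp fun hfg => SPolyTodo.append H ?_ ?_ ?_ hfg,
        List.pairwise_singleton _ _, ?_⟩
      · exact fun g hg => List.mem_append_left _ hg
      · exact List.mem_append_right _ (List.mem_singleton_self _)
      · exact Set.subset_union_left
      · intro f hf g hg h' τ hh
        obtain rfl := List.mem_singleton.1 hg
        exact Or.inl (Or.inr ⟨f, hf, (isSPoly_iff _ _ _).2 ⟨τ, hh⟩⟩)

/-- Lexicographic descent: a nonzero remainder enlarges the lead set, starting a division removes a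
pending S-polynomial, and a division step lowers the rank. Appending may add S-polynomials, but then
the first entry has moved. -/
theorem buchberger_terminates (Θ : List V) (hΘ : ∀ θ ∈ Θ, θ ≠ 0) :
    Terminates (BuchbergerStep K a e lt) (buchbergerInit K a e lt Θ) := by
  refine terminates_of_invariant
    ((ShiftClosed.wellFounded n s).prod_lex (Nat.lt_wfRel.wf.prod_lex Nat.lt_wfRel.wf))
    (fun t => (H.leadSC {g | g ∈ t.gens}, (t.pending.ncard, workRank K (lmon a e) rk t.work)))
    (H.BuchbergerInv (Submodule.span R {θ | θ ∈ Θ})) (fun x y hx hs => BuchbergerInv.step H hx hs)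
    ?_ (H.buchbergerInv_init Θ hΘ)
  intro t t' h hs
  cases hs with
  | choose G S h₀ hh =>
    exact Prod.Lex.right _ (Prod.Lex.left _ _ (Set.ncard_sdiff_singleton_lt_of_mem hh h.finite))
  | divide G S x y hxy =>
    obtain ⟨ν, h1, h2, -⟩ := DivStep.spec H hxy
    exact Prod.Lex.right _ (Prod.Lex.right _ (Nat.succ_lt_succ (H.divRank_lt h1 h2)))
  -- The summand 1 in `workRank` makes even the end of a division of 0 a descent.
  | discard G S => exact Prod.Lex.right _ (Prod.Lex.right _ (Nat.succ_pos _))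
  | append G S η hη =>
    exact Prod.Lex.left _ _ (H.leadSet_ssubset (fun g hg => List.mem_append_left _ hg)
      (List.mem_append_right _ (List.mem_singleton_self _)) hη (h.reduced _ rfl))

theorem isLeftGroebner_of_exists {N : Submodule R V} {G : Set V} (hfin : G.Finite) (hN : G ⊆ N)
    (h0 : 0 ∉ G) (h : ∀ v ∈ N, v ≠ 0 → ∃ ν, IsLM K (lmon a e) lt v ν ∧ ν ∈ leadSet K a e lt G) :
    IsLeftGroebner K a e lt N G := by
  refine ⟨hfin, hN, h0, fun v hv hv0 => ?_⟩
  obtain ⟨ν, hν, g, hg, γ, hγ⟩ := h v hv hv0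
  obtain ⟨μ, hμ, rfl⟩ := H.exists_isLM_of_mon_smul hγ
  exact ⟨g, hg, μ, _, hμ, hν, (H.divides_iff _ _).2 ⟨γ, rfl⟩⟩

theorem buchberger_correct (Θ : List V) (hΘ : ∀ θ ∈ Θ, θ ≠ 0) {t : BuchbergerState V}
    (ht : HaltsAt (BuchbergerStep K a e lt) (buchbergerInit K a e lt Θ) t) :
    t.pending = ∅ ∧ t.work = none ∧
      IsLeftGroebner K a e lt (Submodule.span R {θ | θ ∈ Θ}) {g | g ∈ t.gens} := by
  have h := invariant_of_reflTransGen (H.BuchbergerInv (Submodule.span R {θ | θ ∈ Θ}))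
    (fun x y hx hs => BuchbergerInv.step H hx hs) (H.buchbergerInv_init Θ hΘ) ht.1
  obtain ⟨G, S, w⟩ := t
  have hw : w = none := by
    -- A division in progress always has a successor state, so it cannot be present when the run
    -- halts.
    rcases w with _ | ⟨v, η⟩
    · rfl
    · exfalso
      by_cases hv : v = 0
      · subst hv
        by_cases hη : η = 0
        · subst hη
          exact ht.2 _ (BuchbergerStep.discard G S)
        · exact ht.2 _ (BuchbergerStep.append G S η hη)
      · obtain ⟨y, hy⟩ := H.exists_divStep G hv η
        exact ht.2 _ (BuchbergerStep.divide G S _ y hy)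
  subst hw
  have hS : S = ∅ := by
    by_contra hne
    obtain ⟨h₀, hh⟩ := Set.nonempty_iff_ne_empty.2 hne
    exact ht.2 _ (BuchbergerStep.choose G S h₀ hh)
  subst hS
  refine ⟨rfl, rfl, H.isLeftGroebner_of_exists (List.finite_toSet G) ?_ ?_ ?_⟩
  · exact fun g hg => h.span_eq ▸ Submodule.subset_span hg
  · exact fun h0 => h.ne_zero 0 h0 rfl
  · intro v hv hv0
    refine H.exists_isLM_of_sPolyStd (D := Set.univ) (fun _ _ _ _ => trivial) ?_
      (H.mem_leadSpan_univ (by rw [h.span_eq]; exact hv)) hv0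
    exact H.sPolyStd_of_pairwise (h.todo.imp fun hfg => H.sPolyStd_of_todo hfg (by simp))

end IsMonomialModule

/-! ### Graded modules of monomials and the selection algorithm -/

/-- The span of the monomials of degree `q`. -/
def homSpan (K : Type*) {V ι : Type*} [Field K] [AddCommGroup V] [Module K V] (m : ι → V)
    (deg : ι → ℕ) (q : ℕ) : Submodule K V :=
  Submodule.span K (m '' {ν | deg ν = q})

/-- A module with monomials, graded by `deg`, such that the multiplication by the monomials of `R`
respects the degrees. -/
structure IsGradedMonomialModule (K : Type*) {R V : Type*} [Field K] [Ring R] [AddCommGroup V]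
    [Module K V] [Module R V] {n s : ℕ} (a : Fin n → R) (e : Fin s → V)
    (lt : Idx n s → Idx n s → Prop) (rk : Idx n s → ℕ) (d : Fin n → ℕ) (deg : Idx n s → ℕ) : Prop
    extends IsMonomialModule K a e lt rk where
  pos : ∀ i, 0 < d i
  deg_shift : ∀ γ μ, deg (shift γ μ) = wdeg d γ + deg μ
  deg_le : ∀ μ ν, rk μ ≤ rk ν → deg μ ≤ deg ν
  mon_smul_lmon_mem : ∀ γ μ, mon a γ • lmon a e μ ∈ homSpan K (lmon a e) deg (deg (shift γ μ))

theorem eq_zero_of_wdeg_eq_zero {n : ℕ} {d : Fin n → ℕ} (hd : ∀ i, 0 < d i) {γ : Fin n →₀ ℕ}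
    (h : wdeg d γ = 0) : γ = 0 := by
  ext i
  have := (Finset.sum_eq_zero_iff.1 h) i (Finset.mem_univ i)
  exact (Nat.mul_eq_zero.1 this).resolve_left (hd i).ne'

/-- No `u j` with `j ∈ J` is generated by the others. -/
def Irredundant (R : Type*) {V ι : Type*} [Ring R] [AddCommGroup V] [Module R V] (u : ι → V)
    (J : Set ι) : Prop :=
  ∀ j ∈ J, u j ∉ Submodule.span R (u '' (J \ {j}))

/-- The S-polynomial that is being divided, if any. -/
def sPolyWork {V : Type*} {m : ℕ} : Option (Option (Fin m) × V × V) → Option (V × V)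
  | some (none, x) => some x
  | _ => none

namespace IsGradedMonomialModule

variable {K R V : Type*} [Field K] [Ring R] [AddCommGroup V] [Module K V] [Module R V] {n s : ℕ}
  {a : Fin n → R} {e : Fin s → V} {lt : Idx n s → Idx n s → Prop} {rk : Idx n s → ℕ}
  {d : Fin n → ℕ} {deg : Idx n s → ℕ} (H : IsGradedMonomialModule K a e lt rk d deg)

include H

/-! ### Homogeneous components and irredundant families. -/

theorem mem_homSpan_iff (v : V) (q : ℕ) :
    v ∈ homSpan K (lmon a e) deg q ↔ ∀ ν, H.basis.repr v ν ≠ 0 → deg ν = q :=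
  H.mem_span_iff v _

theorem deg_of_isLM {v : V} {μ : Idx n s} {q : ℕ} (hμ : IsLM K (lmon a e) lt v μ)
    (hv : v ∈ homSpan K (lmon a e) deg q) : deg μ = q :=
  (H.mem_homSpan_iff v q).1 hv μ ((H.isLM_iff _ _).1 hμ).1

theorem deg_unique {v : V} {p q : ℕ} (h0 : v ≠ 0) (hp : v ∈ homSpan K (lmon a e) deg p)
    (hq : v ∈ homSpan K (lmon a e) deg q) : p = q := by
  obtain ⟨μ, hμ⟩ := H.exists_isLM h0
  exact (H.deg_of_isLM hμ hp).symm.trans (H.deg_of_isLM hμ hq)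

theorem mon_smul_mem_homSpan (γ : Fin n →₀ ℕ) {v : V} {q : ℕ}
    (hv : v ∈ homSpan K (lmon a e) deg q) :
    mon a γ • v ∈ homSpan K (lmon a e) deg (wdeg d γ + q) := by
  refine H.mon_smul_mem_of_span hv ?_
  rintro _ ⟨ν, rfl, rfl⟩
  rw [← H.deg_shift]
  exact H.mon_smul_lmon_mem γ ν

theorem mon_smul_mem_homSpan_deg {γ : Fin n →₀ ℕ} {v : V} {ν : Idx n s}
    (hv : ∃ q, v ∈ homSpan K (lmon a e) deg q) (hν : IsLM K (lmon a e) lt (mon a γ • v) ν) :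
    mon a γ • v ∈ homSpan K (lmon a e) deg (deg ν) := by
  obtain ⟨q, hq⟩ := hv
  have := H.mon_smul_mem_homSpan γ hq
  rwa [← H.deg_of_isLM hν this] at this

theorem sPoly_mem_homSpan {f g h : V} {τ : Idx n s}
    (hf : ∃ q, f ∈ homSpan K (lmon a e) deg q) (hg : ∃ q, g ∈ homSpan K (lmon a e) deg q)
    (hh : IsSPolyAt K a e lt f g h τ) : h ∈ homSpan K (lmon a e) deg (deg τ) := by
  obtain ⟨α, β, p, c, c', rfl, -, -, h3, h4, rfl⟩ := hh
  exact sub_mem (Submodule.smul_mem _ _ (H.mon_smul_mem_homSpan_deg hf ⟨c, h3⟩))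
    (Submodule.smul_mem _ _ (H.mon_smul_mem_homSpan_deg hg ⟨c', h4⟩))

/-- The homogeneous component of degree `q`. -/
noncomputable def proj (H : IsGradedMonomialModule K a e lt rk d deg) (q : ℕ) : V →ₗ[K] V :=
  H.basis.constr K fun μ => if deg μ = q then lmon a e μ else 0

theorem proj_lmon (q : ℕ) (μ : Idx n s) :
    H.proj q (lmon a e μ) = if deg μ = q then lmon a e μ else 0 := by
  rw [← H.basis_apply, proj, Module.Basis.constr_basis, H.basis_apply]

theorem proj_of_mem {q : ℕ} {v : V} (hv : v ∈ homSpan K (lmon a e) deg q) : H.proj q v = v := by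
  have : homSpan K (lmon a e) deg q ≤ LinearMap.eqLocus (H.proj q) LinearMap.id := by
    refine Submodule.span_le.2 ?_
    rintro _ ⟨μ, hμ, rfl⟩
    exact (H.proj_lmon q μ).trans (if_pos hμ)
  exact this hv

theorem proj_of_mem_of_ne {p q : ℕ} (hpq : p ≠ q) {v : V}
    (hv : v ∈ homSpan K (lmon a e) deg p) : H.proj q v = 0 := by
  have : homSpan K (lmon a e) deg p ≤ LinearMap.ker (H.proj q) := by
    refine Submodule.span_le.2 ?_
    rintro _ ⟨μ, rfl, rfl⟩
    exact (H.proj_lmon q μ).trans (if_neg hpq)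
  exact this hv

theorem proj_mem_leadSpan {G : Set V} (hG : ∀ g ∈ G, ∃ q, g ∈ homSpan K (lmon a e) deg q)
    {v : V} (hv : v ∈ Submodule.span R G) (q : ℕ) :
    H.proj q v ∈ leadSpan K a e lt G {ν | deg ν = q} := by
  have : leadSpan K a e lt G Set.univ ≤
      (leadSpan K a e lt G {ν | deg ν = q}).comap (H.proj q) := by
    refine Submodule.span_le.2 ?_
    rintro _ ⟨g, hg, γ, ν, -, hν, rfl⟩
    have h1 := H.mon_smul_mem_homSpan_deg (hG g hg) hν
    change H.proj q (mon a γ • g) ∈ leadSpan K a e lt G {ν | deg ν = q}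
    by_cases hq : deg ν = q
    · rw [H.proj_of_mem (hq ▸ h1)]
      exact Submodule.subset_span ⟨g, hg, γ, ν, hq, hν, rfl⟩
    · rw [H.proj_of_mem_of_ne hq h1]
      exact zero_mem _
  exact this (H.mem_leadSpan_univ hv)

theorem proj_mem_span {G : Set V} (hG : ∀ g ∈ G, ∃ q, g ∈ homSpan K (lmon a e) deg q)
    {v : V} (hv : v ∈ Submodule.span R G) (q : ℕ) : H.proj q v ∈ Submodule.span R G :=
  H.leadSpan_le_span (H.proj_mem_leadSpan hG hv q)

/-- For γ ≠ 0 the element a^γ w has degree larger than q, since all degrees of the variables are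
positive; only the constant term of r can contribute in degree p ≤ q. -/
theorem proj_smul {p q : ℕ} (hpq : p ≤ q) {w : V} (hw : w ∈ homSpan K (lmon a e) deg q) (r : R) :
    ∃ c : K, H.proj p (r • w) = c • w := by
  have : Submodule.span K (Set.range fun γ => mon a γ • w) ≤
      (Submodule.span K {w}).comap (H.proj p) := by
    refine Submodule.span_le.2 ?_
    rintro _ ⟨γ, rfl⟩
    change H.proj p (mon a γ • w) ∈ Submodule.span K {w}
    have h1 := H.mon_smul_mem_homSpan γ hw
    by_cases h : wdeg d γ + q = p
    · have hγ : γ = 0 := eq_zero_of_wdeg_eq_zero H.pos (by omega)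
      rw [H.proj_of_mem (h ▸ h1), hγ, mon_zero, one_smul]
      exact Submodule.mem_span_singleton_self w
    · rw [H.proj_of_mem_of_ne h h1]
      exact zero_mem _
  obtain ⟨c, hc⟩ := Submodule.mem_span_singleton.1 (this (H.smul_mem_span r w))
  exact ⟨c, hc.symm⟩

/-- Take the component in the degree of u j of a relation u j = r u i + y. It involves u i only
through a scalar c. If c = 0, then u j was redundant before; if c ≠ 0, the relation can be solved
for u i. Both are excluded. -/
theorem irredundant_insert {ι : Type*} {u : ι → V} {q : ι → ℕ}
    (hu : ∀ j, u j ∈ homSpan K (lmon a e) deg (q j)) {J : Set ι} (hJ : Irredundant R u J) {i : ι}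
    (hi : u i ∉ Submodule.span R (u '' J)) (hq : ∀ j ∈ J, q j ≤ q i) :
    Irredundant R u (insert i J) := by
  have hiJ : i ∉ J := fun h => hi (Submodule.subset_span ⟨i, h, rfl⟩)
  rintro j (rfl | hj) hmem
  · rw [Set.insert_sdiff_of_mem _ (Set.mem_singleton j)] at hmem
    exact hi (Submodule.span_mono (Set.image_mono Set.sdiff_subset) hmem)
  · have hij : i ∉ ({j} : Set ι) := fun h => hiJ (by rwa [Set.mem_singleton_iff.1 h])
    rw [Set.insert_sdiff_of_notMem _ hij, Set.image_insert_eq, Submodule.mem_span_insert] at hmem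
    obtain ⟨r, y, hy, hr⟩ := hmem
    obtain ⟨c, hc⟩ := H.proj_smul (hq j hj) (hu i) r
    have hy' := H.proj_mem_span (G := u '' (J \ {j})) (by
      rintro _ ⟨k, -, rfl⟩; exact ⟨_, hu k⟩) hy (q j)
    have h1 : u j = c • u i + H.proj (q j) y := by
      rw [← hc, ← map_add, ← hr, H.proj_of_mem (hu j)]
    by_cases h0 : c = 0
    · rw [h0, zero_smul, zero_add] at h1
      exact hJ j hj (h1 ▸ hy')
    · refine hi ?_
      have h2 : u i = c⁻¹ • (u j - H.proj (q j) y) := by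
        rw [h1, add_sub_cancel_right, smul_smul, inv_mul_cancel₀ h0, one_smul]
      rw [h2]
      exact H.smul_mem_submodule _ _ (sub_mem (Submodule.subset_span ⟨j, hj, rfl⟩)
        (Submodule.span_mono (Set.image_mono Set.sdiff_subset) hy'))

theorem DivStep.homogeneous {G : List V}
    (hG : ∀ g ∈ G, ∃ q, g ∈ homSpan K (lmon a e) deg q) {x y : V × V}
    (hxy : DivStep K a e lt G x y) {q : ℕ} (h1 : x.1 ∈ homSpan K (lmon a e) deg q)
    (h2 : x.2 ∈ homSpan K (lmon a e) deg q) :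
    y.1 ∈ homSpan K (lmon a e) deg q ∧ y.2 ∈ homSpan K (lmon a e) deg q := by
  cases hxy with
  | reduce v η g γ ν c c' hg hv hγ =>
    have h3 := H.mon_smul_mem_homSpan_deg (hG g hg) ⟨c', hγ⟩
    rw [H.deg_of_isLM ⟨c, hv⟩ h1] at h3
    exact ⟨sub_mem h1 (Submodule.smul_mem _ _ h3), h2⟩
  | shift v η ν c hv _ =>
    have h3 : lmon a e ν ∈ homSpan K (lmon a e) deg q :=
      Submodule.subset_span ⟨ν, H.deg_of_isLM ⟨c, hv⟩ h1, rfl⟩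
    exact ⟨sub_mem h1 (Submodule.smul_mem _ _ h3), add_mem h2 (Submodule.smul_mem _ _ h3)⟩

/-- The invariants of the selection algorithm. -/
structure SelectInv (H : IsGradedMonomialModule K a e lt rk d deg) {m : ℕ} (u : Fin m → V)
    (q : Fin m → ℕ) (t : SelectState V m) : Prop where
  ne_zero : ∀ g ∈ t.gens, g ≠ 0
  homogeneous : ∀ g ∈ t.gens, ∃ p, g ∈ homSpan K (lmon a e) deg p
  span_eq : Submodule.span R {g | g ∈ t.gens} = Submodule.span R (u '' t.kept)
  finite : t.pending.Finite
  pending_mem : ∀ h ∈ t.pending, h ∈ Submodule.span R {g | g ∈ t.gens}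
  treated : ∀ j ∉ t.todo, u j ∈ Submodule.span R {g | g ∈ t.gens} ∨
    ∃ x, t.work = some (some j, x)
  order : ∀ i ∉ t.todo, ∀ j ∈ t.todo, q i ≤ q j
  kept_notMem : ∀ j ∈ t.kept, j ∉ t.todo
  irredundant : Irredundant R u (t.kept : Set (Fin m))
  reduced : ∀ o x, t.work = some (o, x) →
    x.2 ∈ Submodule.span K (lmon a e '' (leadSet K a e lt {g | g ∈ t.gens})ᶜ)
  work_none : ∀ x, t.work = some (none, x) →
    x.1 + x.2 ∈ Submodule.span R {g | g ∈ t.gens} ∧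
      ∃ p, x.1 ∈ homSpan K (lmon a e) deg p ∧ x.2 ∈ homSpan K (lmon a e) deg p
  work_some : ∀ j x, t.work = some (some j, x) →
    u j - (x.1 + x.2) ∈ Submodule.span R {g | g ∈ t.gens} ∧
      (x.1 ∈ homSpan K (lmon a e) deg (q j) ∧ x.2 ∈ homSpan K (lmon a e) deg (q j)) ∧
      (∀ h ∈ t.pending, ∀ p, h ∈ homSpan K (lmon a e) deg p → q j < p) ∧
      j ∉ t.todo ∧ ∀ i ∉ t.todo, q i ≤ q j
  sPolys : t.gens.Pairwise
    (SPolyTodo K a e lt rk {g | g ∈ t.gens} t.pending (sPolyWork t.work))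

/-! ### Correctness and termination of the selection algorithm. -/

variable {m : ℕ} {u : Fin m → V} {q : Fin m → ℕ} {degP : V → ℕ → Prop}

theorem selectInv_init : H.SelectInv u q (selectInit V m) where
  ne_zero g hg := by cases hg
  homogeneous g hg := by cases hg
  span_eq := by simp [selectInit]
  finite := Set.finite_empty
  pending_mem h hh := by cases hh
  treated j hj := absurd (Finset.mem_univ j) hj
  order j hj := absurd (Finset.mem_univ j) hj
  kept_notMem j hj := by cases hj
  irredundant j hj := by cases hj
  reduced o x hx := by cases hx
  work_none x hx := by cases hx
  work_some j x hx := by cases hx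
  sPolys := List.Pairwise.nil

/-- If u j were generated by G, so would be its remainder η, which is homogeneous of the same
degree. All S-polynomials up to this degree have standard representations, so the truncated
criterion makes the leading monomial of η reducible by G, contrary to η being a remainder. -/
theorem SelectInv.notMem_span {G : List V} {S : Set V} {T J : Finset (Fin m)} {j : Fin m} {η : V}
    (h : H.SelectInv u q ⟨G, S, T, J, some (some j, 0, η)⟩) (hη : η ≠ 0) :
    u j ∉ Submodule.span R {g | g ∈ G} := by
  intro hmem
  obtain ⟨h1, ⟨-, h2⟩, h3, -, -⟩ := h.work_some j _ rfl
  have h4 : η ∈ Submodule.span R {g | g ∈ G} := by simpa using sub_mem hmem h1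
  have h5 := H.proj_mem_leadSpan h.homogeneous h4 (q j)
  rw [H.proj_of_mem h2] at h5
  have h6 := IsMonomialModule.leadSpan_mono (K := K) (a := a) (e := e) (lt := lt) (Set.Subset.refl {g | g ∈ G})
    (fun ν (hν : deg ν = q j) => (show ν ∈ {ν | deg ν ≤ q j} from hν.le)) h5
  -- An S-polynomial is homogeneous of the degree of its least common multiple, while the pending
  -- ones have degree greater than q j.
  have hstd : ∀ f ∈ G, ∀ g ∈ G, H.SPolyStd {g | g ∈ G} {ν | deg ν ≤ q j} f g := by
    refine H.sPolyStd_of_pairwise (List.Pairwise.imp_of_mem ?_ h.sPolys)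
    intro f g hf hg hfg
    refine H.sPolyStd_of_todo hfg fun k hk τ hτ hsp => ?_
    exact absurd (h3 k hk _ (H.sPoly_mem_homSpan (h.homogeneous f hf) (h.homogeneous g hg) hsp))
      (not_lt.2 hτ)
  obtain ⟨ν, hν, hlead⟩ := H.exists_isLM_of_sPolyStd
    (fun μ (hμ : deg μ ≤ q j) ν hν => (H.deg_le ν μ hν).trans hμ) hstd h6 hη
  exact (H.mem_span_iff _ _).1 (h.reduced _ _ rfl) ν ((H.isLM_iff _ _).1 hν).1 hlead

-- The case w = none occurs when an input element was divided, so that η is not the remainder of an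
-- S-polynomial. New S-polynomials equal to 0 are not put into S' but count as finished.
omit H in
theorem sPolys_append (H : IsMonomialModule K a e lt rk) {G : List V} {S S' : Set V} {η : V}
    {w : Option (V × V)} (hw : w = none ∨ w = some (0, η)) (hS : S ⊆ S')
    (hS' : ∀ h, h ≠ 0 → (∃ g ∈ G, IsSPoly K a e lt g η h) → h ∈ S')
    (h : G.Pairwise (SPolyTodo K a e lt rk {g | g ∈ G} S w)) :
    (G ++ [η]).Pairwise (SPolyTodo K a e lt rk {g | g ∈ G ++ [η]} S' none) := by
  refine List.pairwise_append.2 ⟨h.imp fun {f g} hfg => ?_, List.pairwise_singleton _ _, ?_⟩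
  · refine IsMonomialModule.SPolyTodo.append H (S := S) (G := {g | g ∈ G}) (η := η) ?_ ?_ hS ?_
    · exact fun g hg => List.mem_append_left _ hg
    · exact List.mem_append_right _ (List.mem_singleton_self _)
    · rcases hw with rfl | rfl
      · exact IsMonomialModule.SPolyTodo.start hfg
      · exact hfg
  · intro f hf g hg h' τ hh
    obtain rfl := List.mem_singleton.1 hg
    by_cases h0 : h' = 0
    · subst h0
      exact Or.inr ⟨(0, 0), Or.inl rfl, by simp, zero_mem _, zero_mem _⟩
    · exact Or.inl (hS' _ h0 ⟨f, hf, (IsMonomialModule.isSPoly_iff _ _ _).2 ⟨τ, hh⟩⟩)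

theorem SelectInv.append {G : List V} {S : Set V} {T J : Finset (Fin m)} {o : Option (Fin m)}
    {η : V} (hu : ∀ j, u j ∈ homSpan K (lmon a e) deg (q j))
    (h : H.SelectInv u q ⟨G, S, T, J, some (o, 0, η)⟩) (hη : η ≠ 0) :
    H.SelectInv u q ⟨G ++ [η], S ∪ {h | h ≠ 0 ∧ ∃ g ∈ G, IsSPoly K a e lt g η h}, T,
      J ∪ o.toFinset, none⟩ := by
  have hle : Submodule.span R {g | g ∈ G} ≤ Submodule.span R {g | g ∈ G ++ [η]} :=
    Submodule.span_mono fun g hg => List.mem_append_left _ hg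
  have hηm : η ∈ Submodule.span R {g | g ∈ G ++ [η]} :=
    Submodule.subset_span (List.mem_append_right _ (List.mem_singleton_self _))
  have hhom : ∃ p, η ∈ homSpan K (lmon a e) deg p := by
    cases o with
    | none => obtain ⟨-, p, -, hp⟩ := h.work_none _ rfl; exact ⟨p, hp⟩
    | some j => exact ⟨_, (h.work_some j _ rfl).2.1.2⟩
  have hkept : ∀ j ∈ J ∪ o.toFinset, j ∈ J ∨ o = some j := by
    intro j hj
    simpa using hj
  refine ⟨?_, ?_, ?_, ?_, ?_, ?_, h.order, ?_, ?_, by simp, by simp, by simp, ?_⟩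
  · intro g hg
    rcases List.mem_append.1 hg with hg | hg
    · exact h.ne_zero g hg
    · rwa [List.mem_singleton.1 hg]
  · intro g hg
    rcases List.mem_append.1 hg with hg | hg
    · exact h.homogeneous g hg
    · rwa [List.mem_singleton.1 hg]
  · change Submodule.span R {g | g ∈ G ++ [η]} = Submodule.span R (u '' ↑(J ∪ o.toFinset))
    have hspan : Submodule.span R {g | g ∈ G} = Submodule.span R (u '' J) := h.span_eq
    cases o with
    | none =>
      have hηG : η ∈ Submodule.span R {g | g ∈ G} := by simpa using (h.work_none _ rfl).1
      rw [setOf_mem_append, Submodule.span_insert_eq_span hηG, hspan]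
      simp
    | some j =>
      have h1 : u j - (0 + η) ∈ Submodule.span R {g | g ∈ G} := (h.work_some j _ rfl).1
      rw [zero_add] at h1
      have h2 : ((J ∪ (some j).toFinset : Finset (Fin m)) : Set (Fin m)) = insert j ↑J := by
        ext i; simp
      rw [h2, setOf_mem_append, Set.image_insert_eq, Submodule.span_insert, Submodule.span_insert,
        ← hspan]
      -- Modulo the span of G, the input u j and its remainder η coincide, so either may be
      -- adjoined.
      refine le_antisymm (sup_le ?_ le_sup_right) (sup_le ?_ le_sup_right)
      · rw [Submodule.span_singleton_le_iff_mem, ← sub_sub_cancel (u j) η]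
        exact sub_mem (Submodule.mem_sup_left (Submodule.mem_span_singleton_self _))
          (Submodule.mem_sup_right h1)
      · rw [Submodule.span_singleton_le_iff_mem, ← sub_add_cancel (u j) η]
        exact add_mem (Submodule.mem_sup_right h1)
          (Submodule.mem_sup_left (Submodule.mem_span_singleton_self _))
  · exact h.finite.union ((H.finite_sPolys G η).subset fun _ hh => hh.2)
  · rintro g (hg | ⟨-, f, hf, hg⟩)
    · exact hle (h.pending_mem g hg)
    · exact H.sPoly_mem (hle (Submodule.subset_span hf)) hηm hg
  · intro j hj
    refine Or.inl ?_
    rcases h.treated j hj with h1 | ⟨x, hx⟩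
    · exact hle h1
    · obtain ⟨rfl, rfl⟩ := Prod.mk.inj (Option.some.inj hx)
      have h1 := hle (h.work_some j _ rfl).1
      simpa using add_mem h1 hηm
  · intro j hj
    rcases hkept j hj with hj | rfl
    · exact h.kept_notMem j hj
    · exact (h.work_some j _ rfl).2.2.2.1
  · cases o with
    | none =>
      have : ((J ∪ (none : Option (Fin m)).toFinset : Finset (Fin m)) : Set (Fin m)) = J := by simp
      change Irredundant R u _
      rw [this]
      exact h.irredundant
    | some j =>
      have h2 : ((J ∪ (some j).toFinset : Finset (Fin m)) : Set (Fin m)) = insert j ↑J := by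
        ext i; simp
      change Irredundant R u _
      rw [h2]
      refine H.irredundant_insert hu h.irredundant ?_ fun i hi =>
        (h.work_some j _ rfl).2.2.2.2 i (h.kept_notMem i hi)
      rw [← h.span_eq]
      exact SelectInv.notMem_span H h hη
  · cases o with
    | none =>
      exact sPolys_append H.toIsMonomialModule (Or.inr rfl) Set.subset_union_left
        (fun h' h0 hh => Or.inr ⟨h0, hh⟩) h.sPolys
    | some j =>
      exact sPolys_append H.toIsMonomialModule (Or.inl rfl) Set.subset_union_left
        (fun h' h0 hh => Or.inr ⟨h0, hh⟩) h.sPolys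

theorem SelectInv.step (hdeg : ∀ v p, degP v p ↔ v ∈ homSpan K (lmon a e) deg p)
    (hu : ∀ j, u j ∈ homSpan K (lmon a e) deg (q j)) (hu0 : ∀ j, u j ≠ 0)
    {t t' : SelectState V m} (h : H.SelectInv u q t)
    (hs : SelectStep K a e lt degP u t t') : H.SelectInv u q t' := by
  cases hs with
  | spoly G S T J h₀ p hT hh hq _ _ =>
    refine ⟨h.ne_zero, h.homogeneous, h.span_eq, h.finite.subset Set.sdiff_subset,
      fun g hg => h.pending_mem g hg.1, ?_, h.order, h.kept_notMem, h.irredundant, ?_, ?_, ?_,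
      h.sPolys.imp fun hfg => IsMonomialModule.SPolyTodo.choose hfg H.toIsMonomialModule⟩
    · intro j hj
      exact Or.inl ((h.treated j hj).resolve_right (by simp))
    · intro o x hx
      obtain ⟨-, rfl⟩ := Prod.mk.inj (Option.some.inj hx)
      exact zero_mem _
    · intro x hx
      obtain ⟨-, rfl⟩ := Prod.mk.inj (Option.some.inj hx)
      exact ⟨by simpa using h.pending_mem _ hh, p, (hdeg _ _).1 hq, zero_mem _⟩
    · intro j x hx
      simp at hx
  | input G S T J j p hj hq hS hu' =>
    have hp : p = q j := H.deg_unique (hu0 j) ((hdeg _ _).1 hq) (hu j)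
    subst hp
    refine ⟨h.ne_zero, h.homogeneous, h.span_eq, h.finite, h.pending_mem, ?_, ?_, ?_,
      h.irredundant, ?_, ?_, ?_, h.sPolys⟩
    · intro i hi
      by_cases hij : i = j
      · subst hij
        exact Or.inr ⟨_, rfl⟩
      · exact Or.inl ((h.treated i fun hiT =>
          hi (Finset.mem_erase.2 ⟨hij, hiT⟩)).resolve_right (by simp))
    · intro i hi k hk
      have hkT := (Finset.mem_erase.1 hk).2
      by_cases hij : i = j
      · subst hij
        -- The choice of an input of least degree is what keeps the treated inputs in nondecreasing
        -- degree.
        exact hu' k hkT _ ((hdeg _ _).2 (hu k))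
      · exact h.order i (fun hiT => hi (Finset.mem_erase.2 ⟨hij, hiT⟩)) k hkT
    · exact fun i hi hiT => h.kept_notMem i hi (Finset.mem_erase.1 hiT).2
    · intro o x hx
      obtain ⟨-, rfl⟩ := Prod.mk.inj (Option.some.inj hx)
      exact zero_mem _
    · intro x hx
      simp at hx
    · intro k x hx
      obtain ⟨hk, rfl⟩ := Prod.mk.inj (Option.some.inj hx)
      obtain rfl := Option.some.inj hk
      -- The strict inequality q j < p for pending S-polynomials is the rule that S-polynomials come
      -- first in a tie.
      refine ⟨by simp, ⟨hu j, zero_mem _⟩, fun h' hh p hp => hS h' hh p ((hdeg _ _).2 hp),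
        Finset.notMem_erase _ _, fun i hi => ?_⟩
      by_cases hij : i = j
      · rw [hij]
      · exact h.order i (fun hiT => hi (Finset.mem_erase.2 ⟨hij, hiT⟩)) j hj
  | divide G S T J o x y hxy =>
    obtain ⟨ν, -, -, h1, -, -, h2⟩ := IsMonomialModule.DivStep.spec H.toIsMonomialModule hxy
    have h1 := H.leadSpan_le_span h1
    refine ⟨h.ne_zero, h.homogeneous, h.span_eq, h.finite, h.pending_mem, ?_, h.order,
      h.kept_notMem, h.irredundant, ?_, ?_, ?_, ?_⟩
    · intro i hi
      rcases h.treated i hi with h3 | ⟨z, hz⟩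
      · exact Or.inl h3
      · obtain ⟨rfl, -⟩ := Prod.mk.inj (Option.some.inj hz)
        exact Or.inr ⟨y, rfl⟩
    · intro o' z hz
      obtain ⟨-, rfl⟩ := Prod.mk.inj (Option.some.inj hz)
      exact h2 (h.reduced o x rfl)
    · intro z hz
      obtain ⟨rfl, rfl⟩ := Prod.mk.inj (Option.some.inj hz)
      obtain ⟨h3, p, h4, h5⟩ := h.work_none x rfl
      exact ⟨by simpa using sub_mem h3 h1, p, DivStep.homogeneous H h.homogeneous hxy h4 h5⟩
    · intro j z hz
      obtain ⟨rfl, rfl⟩ := Prod.mk.inj (Option.some.inj hz)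
      obtain ⟨h3, ⟨h4, h5⟩, h6⟩ := h.work_some j x rfl
      exact ⟨by simpa using add_mem h3 h1, DivStep.homogeneous H h.homogeneous hxy h4 h5, h6⟩
    · cases o with
      | none =>
        exact h.sPolys.imp fun hfg =>
          IsMonomialModule.SPolyTodo.divide H.toIsMonomialModule hfg hxy
      | some j => exact h.sPolys
  | discard G S T J o =>
    refine ⟨h.ne_zero, h.homogeneous, h.span_eq, h.finite, h.pending_mem, ?_, h.order,
      h.kept_notMem, h.irredundant, by simp, by simp, by simp, ?_⟩
    · intro j hj
      rcases h.treated j hj with h3 | ⟨z, hz⟩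
      · exact Or.inl h3
      · obtain ⟨rfl, rfl⟩ := Prod.mk.inj (Option.some.inj hz)
        exact Or.inl (by simpa using (h.work_some j _ rfl).1)
    · cases o with
      | none => exact h.sPolys.imp fun hfg => IsMonomialModule.SPolyTodo.discard hfg
      | some j => exact h.sPolys
  | append G S T J o η hη => exact SelectInv.append H hu h hη

/-- The descent of Buchberger's algorithm, with the untreated inputs counted together with the
pending S-polynomials. -/
theorem select_terminates (hdeg : ∀ v p, degP v p ↔ v ∈ homSpan K (lmon a e) deg p)
    (hu : ∀ j, u j ∈ homSpan K (lmon a e) deg (q j)) (hu0 : ∀ j, u j ≠ 0) :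
    Terminates (SelectStep K a e lt degP u) (selectInit V m) := by
  refine terminates_of_invariant
    ((ShiftClosed.wellFounded n s).prod_lex (Nat.lt_wfRel.wf.prod_lex Nat.lt_wfRel.wf))
    (fun t => (H.leadSC {g | g ∈ t.gens}, (t.pending.ncard + t.todo.card,
      workRank K (lmon a e) rk (t.work.map Prod.snd))))
    (H.SelectInv u q) (fun x y hx hs => SelectInv.step H hdeg hu hu0 hx hs) ?_ H.selectInv_init
  intro t t' h hs
  cases hs with
  | spoly G S T J h₀ p hT hh hq _ _ =>
    exact Prod.Lex.right _ (Prod.Lex.left _ _ (Nat.add_lt_add_right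
      (Set.ncard_sdiff_singleton_lt_of_mem hh h.finite) _))
  | input G S T J j p hj hq hS hu' =>
    exact Prod.Lex.right _ (Prod.Lex.left _ _ (Nat.add_lt_add_left
      (Finset.card_erase_lt_of_mem hj) _))
  | divide G S T J o x y hxy =>
    obtain ⟨ν, h1, h2, -⟩ := IsMonomialModule.DivStep.spec H.toIsMonomialModule hxy
    exact Prod.Lex.right _ (Prod.Lex.right _ (Nat.succ_lt_succ (H.divRank_lt h1 h2)))
  | discard G S T J o => exact Prod.Lex.right _ (Prod.Lex.right _ (Nat.succ_pos _))
  | append G S T J o η hη =>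
    exact Prod.Lex.left _ _ (H.leadSet_ssubset (fun g hg => List.mem_append_left _ hg)
      (List.mem_append_right _ (List.mem_singleton_self _)) hη (h.reduced _ _ rfl))

theorem select_correct (hdeg : ∀ v p, degP v p ↔ v ∈ homSpan K (lmon a e) deg p)
    (hu : ∀ j, u j ∈ homSpan K (lmon a e) deg (q j)) (hu0 : ∀ j, u j ≠ 0) {t : SelectState V m}
    (ht : HaltsAt (SelectStep K a e lt degP u) (selectInit V m) t) :
    t.todo = ∅ ∧ t.work = none ∧ Irredundant R u (t.kept : Set (Fin m)) ∧
      Submodule.span R (u '' t.kept) = Submodule.span R (Set.range u) := by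
  have h := invariant_of_reflTransGen (H.SelectInv u q)
    (fun x y hx hs => SelectInv.step H hdeg hu hu0 hx hs) H.selectInv_init ht.1
  obtain ⟨G, S, T, J, w⟩ := t
  have hw : w = none := by
    rcases w with _ | ⟨o, v, η⟩
    · rfl
    · exfalso
      by_cases hv : v = 0
      · subst hv
        by_cases hη : η = 0
        · subst hη
          exact ht.2 _ (SelectStep.discard G S T J o)
        · exact ht.2 _ (SelectStep.append G S T J o η hη)
      · obtain ⟨y, hy⟩ := H.exists_divStep G hv η
        exact ht.2 _ (SelectStep.divide G S T J o _ y hy)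
  subst hw
  have hT : T = ∅ := by
    by_contra hne
    have hT := Finset.nonempty_iff_ne_empty.2 hne
    obtain ⟨j₀, hj₀⟩ := id hT
    have hex : ∃ p, (∃ h ∈ S, degP h p) ∨ ∃ j ∈ T, degP (u j) p :=
      ⟨q j₀, Or.inr ⟨j₀, hj₀, (hdeg _ _).2 (hu j₀)⟩⟩
    classical
    have hmin := fun p hp => Nat.find_min' hex (m := p) hp
    have hspec := Nat.find_spec hex
    -- An input may be taken only if no S-polynomial attains the least degree; one of the two moves
    -- is therefore always possible.
    by_cases hS : ∃ h ∈ S, degP h (Nat.find hex)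
    · obtain ⟨h₀, hh, hd⟩ := hS
      exact ht.2 _ (SelectStep.spoly G S T J h₀ _ hT hh hd
        (fun h' hh' p hp => hmin p (Or.inl ⟨h', hh', hp⟩))
        (fun j hj p hp => hmin p (Or.inr ⟨j, hj, hp⟩)))
    · obtain ⟨j, hj, hd⟩ := hspec.resolve_left hS
      refine ht.2 _ (SelectStep.input G S T J j _ hj hd (fun h' hh' p hp => ?_)
        (fun j hj p hp => hmin p (Or.inr ⟨j, hj, hp⟩)))
      refine lt_of_le_of_ne (hmin p (Or.inl ⟨h', hh', hp⟩)) ?_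
      rintro rfl
      exact hS ⟨h', hh', hp⟩
  subst hT
  refine ⟨rfl, rfl, h.irredundant, le_antisymm (Submodule.span_mono (Set.image_subset_range _ _))
    (Submodule.span_le.2 ?_)⟩
  rintro _ ⟨j, rfl⟩
  -- S-polynomials may remain pending at this point; for generation it is enough that every input
  -- has been treated.
  have := (h.treated j (by simp)).resolve_right (by simp)
  rw [h.span_eq] at this
  exact this

end IsGradedMonomialModule

/-! ### The free module over a solvable polynomial algebra -/

section FreeModule

variable {K A : Type*} [Field K] [Ring A] [Algebra K A] {n : ℕ} {a : Fin n → A}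
  {lt : (Fin n →₀ ℕ) → (Fin n →₀ ℕ) → Prop} {d : Fin n → ℕ}
  {L : Type*} [AddCommGroup L] [Module K L] [Module A L] [IsScalarTower K A L] {s : ℕ}
  {e : Module.Basis (Fin s) A L} {b : Fin s → ℕ} {ltL : Idx n s → Idx n s → Prop}

theorem IsSolvable.exists_mul_eq_sum (h : IsSolvable K a lt) (γ δ : Fin n →₀ ℕ) :
    ∃ f : (Fin n →₀ ℕ) →₀ K, f (γ + δ) ≠ 0 ∧ (∀ η, f η ≠ 0 → η = γ + δ ∨ lt η (γ + δ)) ∧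
      mon a γ * mon a δ = f.sum fun η c => c • mon a η := by
  have := h.ordering.total
  obtain ⟨c, x, hc, heq, hx⟩ := h.mul_eq γ δ
  by_cases h0 : x = 0
  · refine ⟨Finsupp.single (γ + δ) c, by simpa using hc, fun η hη => ?_, ?_⟩
    · by_contra hne
      rw [Finsupp.single_apply, if_neg fun h => hne (Or.inl h.symm)] at hη
      exact hη rfl
    · rw [← Finsupp.linearCombination_apply, Finsupp.linearCombination_single, heq, h0, add_zero]
  · obtain ⟨μ, ⟨c', g, rfl, -, -, hlt⟩, hμ⟩ := hx h0
    have hg : ∀ ν, g ν ≠ 0 → lt ν (γ + δ) := by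
      intro ν hν
      rcases hlt ν hν with rfl | h1
      · exact hμ
      · exact _root_.trans h1 hμ
    have hg0 : g (γ + δ) = 0 := by
      by_contra hne
      exact irrefl _ (hg _ hne)
    refine ⟨Finsupp.single (γ + δ) c + g, by simpa [hg0] using hc, fun η hη => ?_, ?_⟩
    · by_cases hη' : η = γ + δ
      · exact Or.inl hη'
      · rw [Finsupp.add_apply, Finsupp.single_apply, if_neg (Ne.symm hη'), zero_add] at hη
        exact Or.inr (hg η hη)
    · rw [heq, ← Finsupp.linearCombination_apply, map_add, Finsupp.linearCombination_single]

/-- Condition (b) for the product a^γ · 1 · 1, whose leading monomial a^γ differs from the middle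
factor 1. -/
theorem IsSolvable.zero_lt (h : IsSolvable K a lt) {γ : Fin n →₀ ℕ} (hγ : γ ≠ 0) : lt 0 γ := by
  refine h.ordering.lt_of_ne γ 0 γ 0 hγ.symm ?_
  refine ⟨1, Finsupp.single γ 1, ?_, by simp, one_ne_zero, fun ν hν => ?_⟩
  · rw [Finsupp.linearCombination_single, mon_zero, mul_one, mul_one, one_smul]
  · by_contra hne
    rw [Finsupp.single_apply, if_neg fun h => hne (Or.inl h.symm)] at hν
    exact hν rfl

theorem IsLeftMonomialOrdering.isLM_mon_smul_lmon (h : IsSolvable K a lt)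
    (hL : IsLeftMonomialOrdering K a lt e ltL) (γ : Fin n →₀ ℕ) (μ : Idx n s) :
    IsLM K (lmon a e) ltL (mon a γ • lmon a e μ) (shift γ μ) := by
  obtain ⟨f, hf, hlt, heq⟩ := h.exists_mul_eq_sum γ μ.1
  have hinj : Function.Injective fun η : Fin n →₀ ℕ => (η, μ.2) := fun _ _ h => (Prod.mk.inj h).1
  refine ⟨f (γ + μ.1), f.mapDomain fun η => (η, μ.2), ?_, ?_, hf, fun ν hν => ?_⟩
  · rw [Finsupp.linearCombination_mapDomain, Finsupp.linearCombination_apply, lmon, ← mul_smul,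
      heq, Finsupp.sum, Finsupp.sum, Finset.sum_smul]
    exact Finset.sum_congr rfl fun η _ => (smul_assoc _ _ _).symm
  · exact Finsupp.mapDomain_apply hinj f (γ + μ.1)
  · by_cases hν2 : ν ∈ Set.range fun η : Fin n →₀ ℕ => (η, μ.2)
    · obtain ⟨η, rfl⟩ := hν2
      have h1 : f η ≠ 0 := by rwa [Finsupp.mapDomain_apply hinj f η] at hν
      rcases hlt η h1 with rfl | h2
      · exact Or.inl rfl
      · exact Or.inr (hL.of_lt _ _ _ h2)
    · exact absurd (Finsupp.mapDomain_of_notMem_range _ _ hν2) hν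

theorem IsLeftMonomialOrdering.shift_lt (h : IsSolvable K a lt)
    (hL : IsLeftMonomialOrdering K a lt e ltL) (γ : Fin n →₀ ℕ) {μ ν : Idx n s} (hμν : ltL μ ν) :
    ltL (shift γ μ) (shift γ ν) :=
  hL.smul_lt μ ν γ _ _ hμν (hL.isLM_mon_smul_lmon h γ μ) (hL.isLM_mon_smul_lmon h γ ν)

/-- The degree of the monomial `a^α eᵢ`. -/
def ldeg {n s : ℕ} (d : Fin n → ℕ) (b : Fin s → ℕ) (μ : Idx n s) : ℕ := wdeg d μ.1 + b μ.2

/-- As every dᵢ is at least 1, each exponent is bounded by the degree. This makes the rank of a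
monomial finite, so well-foundedness of the ordering on L need not be assumed. -/
theorem finite_setOf_ldeg_le (hd : ∀ i, 0 < d i) (b : Fin s → ℕ) (q : ℕ) :
    {μ : Idx n s | ldeg d b μ ≤ q}.Finite := by
  have h1 : {α : Fin n →₀ ℕ | ∀ i, α i ≤ q}.Finite := by
    refine (Set.finite_Iic (Finsupp.equivFunOnFinite.symm fun _ : Fin n => q)).subset ?_
    exact fun α hα i => hα i
  refine (h1.prod (Set.finite_univ (α := Fin s))).subset ?_
  rintro ⟨α, i⟩ hμ
  refine ⟨fun j => ?_, trivial⟩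
  have h2 : d j * α j ≤ wdeg d α :=
    Finset.single_le_sum (f := fun i => d i * α i) (fun _ _ => Nat.zero_le _) (Finset.mem_univ j)
  have h3 : wdeg d α + b i ≤ q := hμ
  have h4 : α j ≤ d j * α j := Nat.le_mul_of_pos_left _ (hd j)
  change α j ≤ q
  omega

/-- The number of smaller monomials. -/
noncomputable def orderRank {ι : Type*} (r : ι → ι → Prop) (ν : ι) : ℕ := {μ | r μ ν}.ncard

theorem orderRank_lt_iff {ι : Type*} {r : ι → ι → Prop} (hr : IsStrictTotalOrder ι r)
    (hfin : ∀ ν, {μ | r μ ν}.Finite) (μ ν : ι) :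
    r μ ν ↔ orderRank r μ < orderRank r ν := by
  have key : ∀ μ ν, r μ ν → orderRank r μ < orderRank r ν := by
    intro μ ν h
    refine Set.ncard_lt_ncard ((Set.ssubset_iff_of_subset fun ζ hζ => ?_).2 ⟨μ, h, irrefl μ⟩)
      (hfin ν)
    exact _root_.trans hζ h
  refine ⟨key μ ν, fun h => ?_⟩
  rcases trichotomous_of r μ ν with h1 | rfl | h1
  · exact h1
  · exact absurd h (lt_irrefl _)
  · exact absurd (key _ _ h1) (lt_asymm h)

variable (hA : IsGradedSolvable K a lt d) (hL : IsGradedLeftMonomialOrdering K a lt d e b ltL)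
include hA hL

omit [IsScalarTower K A L] in
theorem ltL_iff (μ ν : Idx n s) : ltL μ ν ↔ orderRank ltL μ < orderRank ltL ν :=
  orderRank_lt_iff hL.total (fun ν => (finite_setOf_ldeg_le hA.pos b (ldeg d b ν)).subset
    fun μ hμ => hL.graded μ ν hμ) μ ν

omit [IsScalarTower K A L] in
theorem orderRank_injective : Function.Injective (orderRank ltL) := by
  have := hL.total
  intro μ ν h
  rcases trichotomous_of ltL μ ν with h1 | h1 | h1
  · exact absurd h ((ltL_iff hA hL _ _).1 h1).ne
  · exact h1
  · exact absurd h ((ltL_iff hA hL _ _).1 h1).ne'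

theorem orderRank_shift (γ : Fin n →₀ ℕ) (μ ν : Idx n s)
    (h : orderRank ltL μ < orderRank ltL ν) :
    orderRank ltL (shift γ μ) < orderRank ltL (shift γ ν) :=
  (ltL_iff hA hL _ _).1 (hL.toIsLeftMonomialOrdering.shift_lt hA.solvable γ
    ((ltL_iff hA hL _ _).2 h))

/-- Multiplying eᵢ ≺ a^γ eᵢ by the exponent of μ gives the comparison, exponents being added
commutatively. -/
theorem orderRank_le_shift (γ : Fin n →₀ ℕ) (μ : Idx n s) :
    orderRank ltL μ ≤ orderRank ltL (shift γ μ) := by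
  by_cases hγ : γ = 0
  · simp [hγ, shift]
  · have h1 := hL.of_lt 0 γ μ.2 (hA.solvable.zero_lt hγ)
    have h2 := orderRank_shift hA hL μ.1 _ _ ((ltL_iff hA hL _ _).1 h1)
    simpa [shift, add_comm] using h2.le

omit [IsScalarTower K A L] in
theorem ldeg_le (μ ν : Idx n s) (h : orderRank ltL μ ≤ orderRank ltL ν) :
    ldeg d b μ ≤ ldeg d b ν := by
  rcases h.lt_or_eq with h | h
  · exact hL.graded _ _ ((ltL_iff hA hL _ _).2 h)
  · rw [orderRank_injective hA hL h]

theorem isMonomialModule_free : IsMonomialModule K a e ltL (orderRank ltL) := by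
  have hspan : ⊤ ≤ Submodule.span K (Set.range (mon a)) := hA.solvable.span_eq_top.ge
  have hB : ⇑((Module.Basis.mk hA.solvable.linearIndependent hspan).smulTower e) = lmon a e := by
    ext μ
    rw [Module.Basis.smulTower_apply, Module.Basis.mk_apply, lmon]
  refine ⟨?_, ?_, ltL_iff hA hL, orderRank_injective hA hL, orderRank_shift hA hL,
    orderRank_le_shift hA hL, fun γ c v => smul_comm _ _ _, fun γ δ => ?_, fun r v => ?_,
    fun c => ⟨algebraMap K A c, fun v => (algebraMap_smul A c v).symm⟩⟩
  · rw [← hB]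
    exact Module.Basis.linearIndependent _
  · rw [← hB, Module.Basis.span_eq]
  · obtain ⟨f, hf, hlt, heq⟩ := hA.solvable.exists_mul_eq_sum γ δ
    refine ⟨f, hf, fun η hη => (hlt η hη).imp id fun h i => (ltL_iff hA hL _ _).1
      (hL.of_lt _ _ _ h), fun v => ?_⟩
    rw [← mul_smul, heq, Finsupp.sum, Finsupp.sum, Finset.sum_smul]
    exact Finset.sum_congr rfl fun η _ => smul_assoc _ _ _
  · have hr : r ∈ Submodule.span K (Set.range (mon a)) := hspan trivial
    induction hr using Submodule.span_induction with
    | mem x hx =>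
      obtain ⟨γ, rfl⟩ := hx
      exact Submodule.subset_span ⟨γ, rfl⟩
    | zero => rw [zero_smul]; exact zero_mem _
    | add x y _ _ hx hy => rw [add_smul]; exact add_mem hx hy
    | smul c x _ hx => rw [smul_assoc]; exact Submodule.smul_mem _ _ hx

end FreeModule

/-! ### Associated graded objects -/

section Graded

variable {K : Type*} [Field K]

/-- The class in degree `p` of an element of `F_p`, as an element of the direct sum. -/
noncomputable def toGr {V : Type*} [AddCommGroup V] [Module K V] (F : ℕ → Submodule K V) (p : ℕ) :
    F p →ₗ[K] ⨁ q, Piece F q :=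
  DirectSum.lof K ℕ (fun q => Piece F q) p ∘ₗ cls F p

section Module

variable {V : Type*} [AddCommGroup V] [Module K V] (F : ℕ → Submodule K V)

theorem toGr_apply_same (p : ℕ) (x : F p) : toGr F p x p = cls F p x :=
  DirectSum.of_eq_same _ _

theorem toGr_apply_of_ne {p q : ℕ} (h : p ≠ q) (x : F p) : toGr F p x q = 0 :=
  DirectSum.of_eq_of_ne _ _ _ h.symm

theorem cls_eq_zero_iff (p : ℕ) (x : F p) : cls F p x = 0 ↔ (x : V) ∈ lower F p := by
  rw [← map_zero (cls F p), cls_eq_iff, Submodule.coe_zero, sub_zero]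

/-- A linear map on `F_p` that vanishes on `F_{p-1}`, as a linear map on the graded piece. -/
noncomputable def Piece.lift {W : Type*} [AddCommGroup W] [Module K W] {p : ℕ} (f : F p →ₗ[K] W)
    (hf : ∀ x : F p, (x : V) ∈ lower F p → f x = 0) : Piece F p →ₗ[K] W :=
  Submodule.liftQ ((lower F p).submoduleOf (F p)) f hf

theorem Piece.lift_cls {W : Type*} [AddCommGroup W] [Module K W] {p : ℕ} (f : F p →ₗ[K] W)
    (hf : ∀ x : F p, (x : V) ∈ lower F p → f x = 0) (x : F p) :
    Piece.lift F f hf (cls F p x) = f x := rfl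

theorem mem_lower_of_lt {F : ℕ → Submodule K V} (hF : Monotone F) {p q : ℕ} (h : p < q) {x : V}
    (hx : x ∈ F p) : x ∈ lower F q := by
  cases q with
  | zero => exact absurd h (Nat.not_lt_zero p)
  | succ q => exact hF (Nat.le_of_lt_succ h) hx

theorem toGr_eq_zero_of_mem_lower {p : ℕ} (x : F p) (hx : (x : V) ∈ lower F p) :
    toGr F p x = 0 := by
  change DirectSum.lof K ℕ (fun q => Piece F q) p (cls F p x) = 0
  rw [(cls_eq_zero_iff F p x).2 hx, map_zero]

theorem toGr_congr {p q : ℕ} (h : p = q) (x : F p) (y : F q) (hxy : (x : V) = y) :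
    toGr F p x = toGr F q y := by
  subst h
  rw [Subtype.ext hxy]

theorem gr_induction {P : (⨁ q, Piece F q) → Prop} (zero : P 0)
    (add : ∀ g h, P g → P h → P (g + h)) (of : ∀ p x, P (toGr F p x)) (h : ⨁ q, Piece F q) :
    P h := by
  induction h using DirectSum.induction_on with
  | zero => exact zero
  | add g h hg hh => exact add g h hg hh
  | of p x =>
    obtain ⟨x, rfl⟩ := cls_surjective F p x
    exact of p x

end Module

variable {A : Type*} [Ring A] [Algebra K A] {FA : RingFiltration K A}
  {M : Type*} [AddCommGroup M] [Module K M] [Module A M] (FM : ModuleFiltration FA M)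

theorem toGr_mul_toGr {p q : ℕ} (x : FA.F p) (y : FA.F q) :
    toGr FA.F p x * toGr FA.F q y = toGr FA.F (p + q) ⟨x * y, FA.mul_mem x.2 y.2⟩ :=
  DirectSum.of_mul_of _ _

theorem toGr_smul_toGr {p q : ℕ} (x : FA.F p) (y : FM.F q) :
    toGr FA.F p x • toGr FM.F q y =
      toGr FM.F (p + q) ⟨(x : A) • (y : M), FM.smul_mem x.2 y.2⟩ :=
  DirectSum.Gmodule.of_smul_of _ _ _ _

theorem gr_smul_comm [IsScalarTower K A M] (r : FA.Gr) (c : K) (v : FM.Gr) :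
    r • c • v = c • r • v := by
  induction r using gr_induction with
  | zero => simp
  | add r r' h h' => rw [add_smul, h, h', add_smul, smul_add]
  | of p x =>
    induction v using gr_induction with
    | zero => simp
    | add v v' h h' => rw [smul_add, smul_add, h, h', smul_add, smul_add]
    | of q y =>
      rw [← map_smul, toGr_smul_toGr, toGr_smul_toGr, ← map_smul]
      exact toGr_congr _ rfl _ _ (smul_comm _ _ _)

theorem gr_smul_assoc [IsScalarTower K A M] (c : K) (r : FA.Gr) (v : FM.Gr) :
    (c • r) • v = c • r • v := by
  induction r using gr_induction with
  | zero => simp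
  | add r r' h h' => rw [smul_add, add_smul, h, h', add_smul, smul_add]
  | of p x =>
    induction v using gr_induction with
    | zero => simp
    | add v v' h h' => rw [smul_add, h, h', smul_add, smul_add]
    | of q y =>
      rw [← map_smul (toGr FA.F p) c, toGr_smul_toGr, toGr_smul_toGr,
        ← map_smul (toGr FM.F (p + q)) c]
      exact toGr_congr _ rfl _ _ (smul_assoc _ _ _)

/-- The element c • 1 of G(A) plays the role of the scalar c, so G(A)-submodules are closed under K.
-/
theorem gr_algebraMap_smul [IsScalarTower K A M] (c : K) (v : FM.Gr) :
    (c • (1 : FA.Gr)) • v = c • v := by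
  rw [gr_smul_assoc, one_smul]

theorem ModuleFiltration.symbol_eq (x : M) {q : ℕ} (hx : x ∈ FM.F q)
    (hq : ∀ p, x ∈ FM.F p → q ≤ p) : FM.symbol x = toGr FM.F q ⟨x, hx⟩ :=
  toGr_congr FM.F (le_antisymm (Nat.sInf_le hx)
    (hq _ (Nat.sInf_mem (FM.exhaustive x)))) _ _ rfl

theorem RingFiltration.symbol_eq (x : A) {q : ℕ} (hx : x ∈ FA.F q)
    (hq : ∀ p, x ∈ FA.F p → q ≤ p) : FA.symbol x = toGr FA.F q ⟨x, hx⟩ :=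
  toGr_congr FA.F (le_antisymm (Nat.sInf_le hx)
    (hq _ (Nat.sInf_mem (FA.exhaustive x)))) _ _ rfl

theorem toGr_prod {ι : Type*} (l : List ι) (w : ι → ℕ) (x : ι → A) (y : ι → FA.Gr)
    (h : ∀ i, ∃ hx, y i = toGr FA.F (w i) ⟨x i, hx⟩) :
    ∃ hx, (l.map y).prod = toGr FA.F (l.map w).sum ⟨(l.map x).prod, hx⟩ := by
  induction l with
  | nil => exact ⟨FA.one_mem, rfl⟩
  | cons i l ih =>
    obtain ⟨h1, e1⟩ := h i
    obtain ⟨h2, e2⟩ := ih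
    simp only [List.map_cons, List.prod_cons, List.sum_cons]
    rw [e1, e2, toGr_mul_toGr]
    exact ⟨FA.mul_mem h1 h2, rfl⟩

theorem toGr_pow {p : ℕ} {x : A} {y : FA.Gr} (h : ∃ hx, y = toGr FA.F p ⟨x, hx⟩) (k : ℕ) :
    ∃ hx, y ^ k = toGr FA.F (p * k) ⟨x ^ k, hx⟩ := by
  induction k with
  | zero => simp only [pow_zero]; exact ⟨FA.one_mem, rfl⟩
  | succ k ih =>
    obtain ⟨h1, e1⟩ := h
    obtain ⟨h2, e2⟩ := ih
    simp only [pow_succ]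
    rw [e2, e1, toGr_mul_toGr]
    exact ⟨FA.mul_mem h2 h1, rfl⟩

end Graded

/-! ### Principal symbols of the monomials of A. -/

section FreeModule

variable {K A : Type*} [Field K] [Ring A] [Algebra K A] {n : ℕ} {a : Fin n → A}
  {lt : (Fin n →₀ ℕ) → (Fin n →₀ ℕ) → Prop} {d : Fin n → ℕ}
  {L : Type*} [AddCommGroup L] [Module K L] [Module A L] [IsScalarTower K A L] {s : ℕ}
  {e : Module.Basis (Fin s) A L} {b : Fin s → ℕ} {ltL : Idx n s → Idx n s → Prop}

theorem mon_single (a : Fin n → A) (i : Fin n) : mon a (Finsupp.single i 1) = a i := by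
  change (List.ofFn fun j => a j ^ (Finsupp.single i 1 : Fin n →₀ ℕ) j).prod = a i
  rw [List.ofFn_eq_map, List.prod_map_eq_pow_single i]
  · rw [List.count_eq_one_of_mem (List.nodup_finRange n) (List.mem_finRange i)]
    simp
  · intro j hj _
    simp [Ne.symm hj]

theorem IsGradedSolvable.mon_mem_F (hA : IsGradedSolvable K a lt d) (α : Fin n →₀ ℕ) :
    mon a α ∈ hA.filtration.F (wdeg d α) :=
  Submodule.subset_span ⟨α, le_refl (wdeg d α), rfl⟩

theorem IsGradedSolvable.wdeg_le_of_mem (hA : IsGradedSolvable K a lt d) {α : Fin n →₀ ℕ} {p : ℕ}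
    (h : mon a α ∈ hA.filtration.F p) : wdeg d α ≤ p := by
  by_contra hlt
  exact hA.solvable.linearIndependent.notMem_span_image (s := {α | wdeg d α ≤ p}) hlt h

theorem wdeg_single (d : Fin n → ℕ) (i : Fin n) : wdeg d (Finsupp.single i 1) = d i := by
  rw [wdeg, Finset.sum_eq_single i]
  · simp
  · intro j _ hj
    simp [Ne.symm hj]
  · simp

/-- `σ(a)^α` is the class of `a^α`. -/
theorem IsGradedSolvable.mon_symbol (hA : IsGradedSolvable K a lt d) (α : Fin n →₀ ℕ) :
    mon (fun i => hA.filtration.symbol (a i)) α =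
      toGr hA.filtration.F (wdeg d α) ⟨mon a α, hA.mon_mem_F α⟩ := by
  have h1 : ∀ i, ∃ hx, hA.filtration.symbol (a i) ^ α i =
      toGr hA.filtration.F (d i * α i) ⟨a i ^ α i, hx⟩ := by
    intro i
    -- The generator a_i has filtered degree exactly d i: linear independence of the monomials keeps
    -- it out of the smaller filtration steps.
    have hi := hA.mon_mem_F (Finsupp.single i 1)
    rw [mon_single, wdeg_single] at hi
    refine toGr_pow ⟨hi, hA.filtration.symbol_eq _ hi fun p hp => ?_⟩ (α i)
    rw [← mon_single a] at hp
    exact (wdeg_single d i).ge.trans (hA.wdeg_le_of_mem hp)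
  obtain ⟨h2, h3⟩ := toGr_prod (List.finRange n) (fun i => d i * α i) (fun i => a i ^ α i) _ h1
  change (List.ofFn fun i => hA.filtration.symbol (a i) ^ α i).prod = _
  rw [List.ofFn_eq_map, h3]
  refine toGr_congr _ ?_ _ _ ?_
  · rw [← List.ofFn_eq_map, List.sum_ofFn, wdeg]
  · change _ = (List.ofFn fun i => a i ^ α i).prod
    rw [List.ofFn_eq_map]

theorem IsGradedSolvable.toGr_mon (hA : IsGradedSolvable K a lt d) {α : Fin n →₀ ℕ} {p : ℕ}
    (h : mon a α ∈ hA.filtration.F p) : toGr hA.filtration.F p ⟨mon a α, h⟩ =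
      if wdeg d α = p then mon (fun i => hA.filtration.symbol (a i)) α else 0 := by
  split_ifs with hp
  · rw [hA.mon_symbol]
    exact toGr_congr _ hp.symm _ _ rfl
  · exact toGr_eq_zero_of_mem_lower _ _ (mem_lower_of_lt hA.filtration.mono
      (lt_of_le_of_ne (hA.wdeg_le_of_mem h) hp) (hA.mon_mem_F α))

theorem IsGradedSolvable.toGr_sum (hA : IsGradedSolvable K a lt d) {p : ℕ}
    (c : (Fin n →₀ ℕ) → K) (S : Finset (Fin n →₀ ℕ)) (hS : ∀ α ∈ S, wdeg d α ≤ p) :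
    ∃ hx, toGr hA.filtration.F p ⟨∑ α ∈ S, c α • mon a α, hx⟩ =
      ∑ α ∈ S, if wdeg d α = p then c α • mon (fun i => hA.filtration.symbol (a i)) α else 0 := by
  classical
  induction S using Finset.induction_on with
  | empty => exact ⟨zero_mem _, map_zero _⟩
  | insert α S hα ih =>
    obtain ⟨h1, e1⟩ := ih fun α hα => hS α (Finset.mem_insert_of_mem hα)
    have h2 := hA.filtration.mono (hS α (Finset.mem_insert_self _ _)) (hA.mon_mem_F α)
    simp only [Finset.sum_insert hα]
    refine ⟨add_mem (Submodule.smul_mem _ _ h2) h1, ?_⟩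
    rw [← e1]
    refine (map_add (toGr hA.filtration.F p) ⟨c α • mon a α, Submodule.smul_mem _ _ h2⟩
      ⟨_, h1⟩).trans (congrArg₂ _ ?_ rfl)
    refine (map_smul (toGr hA.filtration.F p) (c α) ⟨mon a α, h2⟩).trans ?_
    rw [hA.toGr_mon, smul_ite, smul_zero]

theorem IsGradedSolvable.toGr_mem_of_mon_mem (hA : IsGradedSolvable K a lt d)
    {S : Submodule K hA.filtration.Gr}
    (h : ∀ α, mon (fun i => hA.filtration.symbol (a i)) α ∈ S) {p : ℕ}
    (x : hA.filtration.F p) : toGr hA.filtration.F p x ∈ S := by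
  have key : hA.filtration.F p ≤
      (S.comap (toGr hA.filtration.F p)).map (Submodule.subtype _) := by
    refine Submodule.span_le.2 ?_
    rintro _ ⟨α, hα, rfl⟩
    have hm : mon a α ∈ hA.filtration.F p := Submodule.subset_span ⟨α, hα, rfl⟩
    refine ⟨⟨mon a α, hm⟩, ?_, rfl⟩
    change toGr hA.filtration.F p ⟨mon a α, hm⟩ ∈ S
    rw [hA.toGr_mon]
    split_ifs
    · exact h α
    · exact zero_mem _
  obtain ⟨y, hy, hyx⟩ := key x.2
  obtain rfl : y = x := Subtype.ext hyx
  exact hy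

end FreeModule

/-! ### G(L) as a graded module of monomials. -/

section FreeModule

variable {K A : Type*} [Field K] [Ring A] [Algebra K A] {n : ℕ} {a : Fin n → A}
  {lt : (Fin n →₀ ℕ) → (Fin n →₀ ℕ) → Prop} {d : Fin n → ℕ}
  {L : Type*} [AddCommGroup L] [Module K L] [Module A L] [IsScalarTower K A L] {s : ℕ}
  {e : Module.Basis (Fin s) A L} {b : Fin s → ℕ} {ltL : Idx n s → Idx n s → Prop}

theorem lmon_mem_F (hA : IsGradedSolvable K a lt d) (e : Module.Basis (Fin s) A L) (b : Fin s → ℕ)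
    (μ : Idx n s) : lmon a e μ ∈ (hA.freeFiltration e b).F (ldeg d b μ) :=
  Submodule.subset_span ⟨μ, le_refl (ldeg d b μ), rfl⟩

variable (hA : IsGradedSolvable K a lt d) (hL : IsGradedLeftMonomialOrdering K a lt d e b ltL)
include hA hL

theorem mem_freeFiltration_iff (x : L) (q : ℕ) : x ∈ (hA.freeFiltration e b).F q ↔
    ∀ μ, (isMonomialModule_free hA hL).basis.repr x μ ≠ 0 → ldeg d b μ ≤ q :=
  (isMonomialModule_free hA hL).mem_span_iff x _

theorem mem_lower_freeFiltration_iff (x : L) (q : ℕ) : x ∈ lower (hA.freeFiltration e b).F q ↔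
    ∀ μ, (isMonomialModule_free hA hL).basis.repr x μ ≠ 0 → ldeg d b μ < q := by
  cases q with
  | zero =>
    rw [lower, Submodule.mem_bot, ← (isMonomialModule_free hA hL).basis.repr.map_eq_zero_iff]
    constructor
    · intro h; simp [h]
    · intro h
      ext μ
      by_contra hne
      exact Nat.not_lt_zero _ (h μ hne)
  | succ q =>
    rw [lower, mem_freeFiltration_iff hA hL]
    simp only [Nat.lt_succ_iff]

/-- `σ(a)^α σ(eᵢ)` is the class of `a^α eᵢ`. -/
theorem lmon_symbol (μ : Idx n s) :
    lmon (fun i => hA.filtration.symbol (a i))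
      (fun i => (hA.freeFiltration e b).symbol (e i)) μ =
      toGr (hA.freeFiltration e b).F (ldeg d b μ) ⟨lmon a e μ, lmon_mem_F hA e b μ⟩ := by
  have he : e μ.2 = lmon a e (0, μ.2) := by rw [lmon, mon_zero, one_smul]
  have hb : ldeg d b (0, μ.2) = b μ.2 := by rw [ldeg, wdeg_zero, zero_add]
  have h1 := lmon_mem_F hA e b (0, μ.2)
  rw [hb, ← he] at h1
  have h2 : (hA.freeFiltration e b).symbol (e μ.2) =
      toGr (hA.freeFiltration e b).F (b μ.2) ⟨e μ.2, h1⟩ := by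
    refine (hA.freeFiltration e b).symbol_eq _ h1 fun p hp => ?_
    rw [← hb]
    refine (mem_freeFiltration_iff hA hL _ _).1 hp _ ?_
    rw [he, (isMonomialModule_free hA hL).repr_lmon]
    simp
  rw [lmon, hA.mon_symbol, h2, toGr_smul_toGr]
  rfl

/-- The coefficient of the monomial `μ` in an element of the associated graded module. -/
noncomputable def grCoeff (μ : Idx n s) : (hA.freeFiltration e b).Gr →ₗ[K] K :=
  Piece.lift (hA.freeFiltration e b).F
    ((isMonomialModule_free hA hL).basis.coord μ ∘ₗ Submodule.subtype _) (by
      -- The coordinate descends to classes because elements of the preceding filtration step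
      -- involve only monomials of smaller degree.
      intro x hx
      by_contra hne
      exact lt_irrefl _ ((mem_lower_freeFiltration_iff hA hL _ _).1 hx μ hne)) ∘ₗ
    DirectSum.component K ℕ (fun q => Piece (hA.freeFiltration e b).F q) (ldeg d b μ)

theorem grCoeff_of_cls_eq {μ : Idx n s} {h : (hA.freeFiltration e b).Gr} {q : ℕ}
    (hμ : ldeg d b μ = q) {x : (hA.freeFiltration e b).F q}
    (hx : cls (hA.freeFiltration e b).F q x = h q) :
    grCoeff hA hL μ h = (isMonomialModule_free hA hL).basis.repr x μ := by
  subst hμ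
  rw [grCoeff, LinearMap.comp_apply, ← DirectSum.apply_eq_component, ← hx, Piece.lift_cls]
  rfl

theorem grCoeff_toGr {μ : Idx n s} {q : ℕ} (hμ : ldeg d b μ = q)
    (x : (hA.freeFiltration e b).F q) :
    grCoeff hA hL μ (toGr (hA.freeFiltration e b).F q x) =
      (isMonomialModule_free hA hL).basis.repr x μ :=
  grCoeff_of_cls_eq hA hL hμ (toGr_apply_same _ _ _).symm

theorem grCoeff_toGr_of_ne {μ : Idx n s} {q : ℕ} (hμ : ldeg d b μ ≠ q)
    (x : (hA.freeFiltration e b).F q) :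
    grCoeff hA hL μ (toGr (hA.freeFiltration e b).F q x) = 0 := by
  rw [grCoeff, LinearMap.comp_apply, ← DirectSum.apply_eq_component,
    toGr_apply_of_ne _ (Ne.symm hμ), map_zero]

theorem grCoeff_lmon (μ ν : Idx n s) :
    grCoeff hA hL μ (lmon (fun i => hA.filtration.symbol (a i))
      (fun i => (hA.freeFiltration e b).symbol (e i)) ν) = Finsupp.single ν 1 μ := by
  rw [lmon_symbol hA hL]
  by_cases h : ldeg d b μ = ldeg d b ν
  · rw [grCoeff_toGr hA hL h, (isMonomialModule_free hA hL).repr_lmon]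
  · rw [grCoeff_toGr_of_ne hA hL h, Finsupp.single_apply, if_neg]
    rintro rfl
    exact h rfl

theorem toGr_mem_of_lmon_mem {S : Submodule K (hA.freeFiltration e b).Gr} {q : ℕ}
    (h : ∀ μ, ldeg d b μ = q → lmon (fun i => hA.filtration.symbol (a i))
      (fun i => (hA.freeFiltration e b).symbol (e i)) μ ∈ S)
    (x : (hA.freeFiltration e b).F q) : toGr (hA.freeFiltration e b).F q x ∈ S := by
  have key : (hA.freeFiltration e b).F q ≤
      (S.comap (toGr (hA.freeFiltration e b).F q)).map (Submodule.subtype _) := by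
    refine Submodule.span_le.2 ?_
    rintro _ ⟨μ, hμ, rfl⟩
    have hm : lmon a e μ ∈ (hA.freeFiltration e b).F q := Submodule.subset_span ⟨μ, hμ, rfl⟩
    refine ⟨⟨lmon a e μ, hm⟩, ?_, rfl⟩
    change toGr (hA.freeFiltration e b).F q ⟨lmon a e μ, hm⟩ ∈ S
    rcases (show ldeg d b μ ≤ q from hμ).lt_or_eq with hlt | heq
    · rw [toGr_eq_zero_of_mem_lower]
      · exact zero_mem _
      · exact mem_lower_of_lt (hA.freeFiltration e b).mono hlt (lmon_mem_F hA e b μ)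
    · have := h μ heq
      rw [lmon_symbol hA hL] at this
      rwa [toGr_congr (hA.freeFiltration e b).F heq _ ⟨lmon a e μ, hm⟩ rfl] at this
  obtain ⟨y, hy, hyx⟩ := key x.2
  obtain rfl : y = x := Subtype.ext hyx
  exact hy

/-- The monomials of G(L) are the classes of those of L in their own degrees. The coefficient
functionals `grCoeff` give their independence, and products are those of A cut down to the top
degree. -/
theorem isMonomialModule_gr :
    IsMonomialModule K (fun i => hA.filtration.symbol (a i))
      (fun i => (hA.freeFiltration e b).symbol (e i)) ltL (orderRank ltL) := by
  refine ⟨?_, ?_, ltL_iff hA hL, orderRank_injective hA hL, orderRank_shift hA hL,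
    orderRank_le_shift hA hL, fun γ c v => gr_smul_comm _ _ _ _, fun γ δ => ?_, fun r v => ?_,
    fun c => ⟨c • 1, fun v => (gr_algebraMap_smul _ c v).symm⟩⟩
  · rw [linearIndependent_iff]
    intro l hl
    ext μ
    have h1 := congrArg (grCoeff hA hL μ) hl
    rw [map_zero, Finsupp.linearCombination_apply, Finsupp.sum, map_sum] at h1
    simp only [map_smul, grCoeff_lmon, smul_eq_mul] at h1
    rw [Finset.sum_eq_single μ] at h1
    · simpa using h1
    · intro ν _ hν
      rw [Finsupp.single_apply, if_neg hν, mul_zero]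
    · intro hμ
      rw [Finsupp.notMem_support_iff.1 hμ, zero_mul]
  · intro h _
    induction h using gr_induction with
    | zero => exact zero_mem _
    | add g h hg hh => exact add_mem (hg trivial) (hh trivial)
    | of q x =>
      exact toGr_mem_of_lmon_mem hA hL (fun μ _ => Submodule.subset_span (Set.mem_range_self μ)) x
  · obtain ⟨f, hf, hlt, heq⟩ := hA.solvable.exists_mul_eq_sum γ δ
    have hf' : ∀ η ∈ f.support, wdeg d η ≤ wdeg d γ + wdeg d δ := by
      intro η hη
      rw [← wdeg_add]
      rcases hlt η (Finsupp.mem_support_iff.1 hη) with rfl | h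
      · exact le_rfl
      · exact hA.graded _ _ h
    classical
    -- Terms of smaller degree in a^γ a^δ vanish in G(A); the leading term survives because degrees
    -- are additive.
    refine ⟨f.filter fun η => wdeg d η = wdeg d γ + wdeg d δ, ?_, fun η hη => ?_, fun v => ?_⟩
    · rwa [Finsupp.filter_apply_pos (fun η => wdeg d η = _) _ (wdeg_add d γ δ)]
    · have hη' : f η ≠ 0 := fun h0 => hη (by rw [Finsupp.filter_apply, h0, ite_self])
      exact (hlt η hη').imp id fun h i => (ltL_iff hA hL _ _).1 (hL.of_lt _ _ _ h)
    · obtain ⟨h1, h2⟩ := hA.toGr_sum f f.support hf'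
      rw [← mul_smul, hA.mon_symbol γ, hA.mon_symbol δ, toGr_mul_toGr,
        toGr_congr hA.filtration.F rfl _ ⟨_, h1⟩ heq, h2, Finsupp.sum_filter_index,
        ← Finset.sum_filter, Finset.sum_smul, Finsupp.support_filter]
      exact Finset.sum_congr rfl fun η _ => gr_smul_assoc _ _ _ _
  · let φ : hA.filtration.Gr →ₗ[K] (hA.freeFiltration e b).Gr :=
      { toFun := fun r => r • v
        map_add' := fun r r' => add_smul r r' v
        map_smul' := fun c r => gr_smul_assoc _ c r v }
    change φ r ∈ _
    rw [← Submodule.mem_comap]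
    induction r using gr_induction with
    | zero => exact zero_mem _
    | add g h hg hh => exact add_mem hg hh
    | of p x =>
      refine hA.toGr_mem_of_mon_mem (fun α => ?_) x
      exact Submodule.subset_span (Set.mem_range_self (f := fun γ =>
        mon (fun i => hA.filtration.symbol (a i)) γ • v) α)

theorem toGr_mem_homSpan {q : ℕ} (x : (hA.freeFiltration e b).F q) :
    toGr (hA.freeFiltration e b).F q x ∈ homSpan K (lmon (fun i => hA.filtration.symbol (a i))
      (fun i => (hA.freeFiltration e b).symbol (e i))) (ldeg d b) q :=
  toGr_mem_of_lmon_mem hA hL (fun _ hμ => Submodule.subset_span (Set.mem_image_of_mem _ hμ)) x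

theorem isGradedMonomialModule_gr :
    IsGradedMonomialModule K (fun i => hA.filtration.symbol (a i))
      (fun i => (hA.freeFiltration e b).symbol (e i)) ltL (orderRank ltL) d (ldeg d b) where
  toIsMonomialModule := isMonomialModule_gr hA hL
  pos := hA.pos
  deg_shift γ μ := by rw [ldeg, ldeg, shift, wdeg_add, add_assoc]
  deg_le := ldeg_le hA hL
  mon_smul_lmon_mem γ μ := by
    rw [lmon_symbol hA hL, hA.mon_symbol, toGr_smul_toGr]
    have : ldeg d b (shift γ μ) = wdeg d γ + ldeg d b μ := by
      rw [ldeg, ldeg, shift, wdeg_add, add_assoc]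
    rw [this]
    exact toGr_mem_homSpan hA hL _

theorem homDeg_iff (h : (hA.freeFiltration e b).Gr) (q : ℕ) :
    (hA.freeFiltration e b).HomDeg h q ↔
      h ∈ homSpan K (lmon (fun i => hA.filtration.symbol (a i))
        (fun i => (hA.freeFiltration e b).symbol (e i))) (ldeg d b) q := by
  constructor
  · rintro ⟨x, rfl⟩
    obtain ⟨x, rfl⟩ := cls_surjective _ _ x
    exact toGr_mem_homSpan hA hL x
  · intro hh
    have : homSpan K (lmon (fun i => hA.filtration.symbol (a i))
        (fun i => (hA.freeFiltration e b).symbol (e i))) (ldeg d b) q ≤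
        LinearMap.range (toGr (hA.freeFiltration e b).F q) := by
      refine Submodule.span_le.2 ?_
      rintro _ ⟨μ, rfl, rfl⟩
      exact ⟨_, (lmon_symbol hA hL μ).symm⟩
    obtain ⟨x, rfl⟩ := this hh
    exact ⟨_, rfl⟩

theorem repr_gr_eq (h : (hA.freeFiltration e b).Gr) (μ : Idx n s) :
    (isMonomialModule_gr hA hL).basis.repr h μ = grCoeff hA hL μ h := by
  have : (isMonomialModule_gr hA hL).basis.coord μ = grCoeff hA hL μ := by
    refine (isMonomialModule_gr hA hL).basis.ext fun ν => ?_
    rw [Module.Basis.coord_apply, Module.Basis.repr_self, IsMonomialModule.basis_apply,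
      grCoeff_lmon]
  exact congrArg (fun f => f h) this

/-- In the degree of μ the representative x has the same coefficients as h, and its remaining
monomials have smaller degree, hence are smaller because the ordering is graded. -/
theorem isLM_of_cls_eq {h : (hA.freeFiltration e b).Gr} {μ : Idx n s}
    {x : (hA.freeFiltration e b).F (ldeg d b μ)}
    (hx : cls (hA.freeFiltration e b).F (ldeg d b μ) x = h (ldeg d b μ))
    (hμ : IsLM K (lmon (fun i => hA.filtration.symbol (a i))
      (fun i => (hA.freeFiltration e b).symbol (e i))) ltL h μ) :
    IsLM K (lmon a e) ltL (x : L) μ := by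
  obtain ⟨h1, h2⟩ := ((isMonomialModule_gr hA hL).isLM_iff _ _).1 hμ
  rw [(isMonomialModule_gr hA hL).mem_lowSpan_iff] at h2
  rw [(isMonomialModule_free hA hL).isLM_iff, (isMonomialModule_free hA hL).mem_lowSpan_iff]
  rw [repr_gr_eq hA hL, grCoeff_of_cls_eq hA hL rfl hx] at h1
  refine ⟨h1, fun ν hν => ?_⟩
  rcases ((mem_freeFiltration_iff hA hL _ _).1 x.2 ν hν).lt_or_eq with hlt | heq
  · by_contra hne
    exact absurd (ldeg_le hA hL μ ν (by omega)) (not_le.2 hlt)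
  · refine h2 ν ?_
    rwa [repr_gr_eq hA hL, grCoeff_of_cls_eq hA hL heq hx]

/-- For a graded ordering no monomial of x has larger degree than the leading one, so the filtered
degree of x is that of its leading monomial. -/
theorem symbol_eq_toGr {x : L} {μ : Idx n s} (hμ : IsLM K (lmon a e) ltL x μ) :
    ∃ hx, (hA.freeFiltration e b).symbol x =
      toGr (hA.freeFiltration e b).F (ldeg d b μ) ⟨x, hx⟩ := by
  obtain ⟨h1, h2⟩ := ((isMonomialModule_free hA hL).isLM_iff _ _).1 hμ
  rw [(isMonomialModule_free hA hL).mem_lowSpan_iff] at h2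
  have hx : x ∈ (hA.freeFiltration e b).F (ldeg d b μ) :=
    (mem_freeFiltration_iff hA hL _ _).2 fun ν hν =>
      ldeg_le hA hL ν μ (Nat.le_of_lt_succ (h2 ν hν))
  exact ⟨hx, (hA.freeFiltration e b).symbol_eq x hx fun p hp =>
    (mem_freeFiltration_iff hA hL _ _).1 hp μ h1⟩

theorem isLM_symbol {x : L} {μ : Idx n s} (hμ : IsLM K (lmon a e) ltL x μ) :
    IsLM K (lmon (fun i => hA.filtration.symbol (a i))
      (fun i => (hA.freeFiltration e b).symbol (e i))) ltL
      ((hA.freeFiltration e b).symbol x) μ := by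
  obtain ⟨hx, heq⟩ := symbol_eq_toGr hA hL hμ
  obtain ⟨h1, h2⟩ := ((isMonomialModule_free hA hL).isLM_iff _ _).1 hμ
  rw [(isMonomialModule_free hA hL).mem_lowSpan_iff] at h2
  rw [(isMonomialModule_gr hA hL).isLM_iff, (isMonomialModule_gr hA hL).mem_lowSpan_iff, heq]
  refine ⟨?_, fun ν hν => ?_⟩
  · rwa [repr_gr_eq hA hL, grCoeff_toGr hA hL rfl]
  · rw [repr_gr_eq hA hL] at hν
    by_cases hd : ldeg d b ν = ldeg d b μ
    · rw [grCoeff_toGr hA hL hd] at hν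
      exact h2 ν hν
    · exact absurd (grCoeff_toGr_of_ne hA hL hd _) hν

omit hA hL in
theorem symbol_mem_grSubmodule {A M : Type*} [Ring A] [Algebra K A] {FA : RingFiltration K A}
    [AddCommGroup M] [Module K M] [Module A M] (FM : ModuleFiltration FA M) {N : Submodule A M}
    {p : ℕ} (x : FM.F p) (hx : (x : M) ∈ N) : toGr FM.F p x ∈ FM.grSubmodule N := by
  intro q
  by_cases h : p = q
  · subst h
    exact ⟨x, hx, (toGr_apply_same _ _ _).symm⟩
  · exact ⟨0, N.zero_mem, by rw [toGr_apply_of_ne _ h, map_zero]⟩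

/-- The symbols of a left Gröbner basis form a left Gröbner basis. -/
theorem isLeftGroebner_symbol {N : Submodule A L} {U : List L}
    (hU : IsLeftGroebner K a e ltL N {g | g ∈ U}) :
    IsLeftGroebner K (fun i => hA.filtration.symbol (a i))
      (fun i => (hA.freeFiltration e b).symbol (e i)) ltL
      ((hA.freeFiltration e b).grSubmodule N)
      (Set.range fun j : Fin U.length => (hA.freeFiltration e b).symbol (U.get j)) := by
  have HG := isMonomialModule_gr hA hL
  have HL := isMonomialModule_free hA hL
  obtain ⟨-, hUN, h0, hdiv⟩ := hU
  have hlm : ∀ g ∈ U, ∃ μ, IsLM K (lmon a e) ltL g μ := fun g hg =>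
    HL.exists_isLM fun h => h0 (by rw [h] at hg; exact hg)
  refine HG.isLeftGroebner_of_exists (Set.finite_range _) ?_ ?_ ?_
  · rintro _ ⟨j, rfl⟩
    exact symbol_mem_grSubmodule _ _ (hUN (List.get_mem U j))
  · rintro ⟨j, hj⟩
    obtain ⟨μ, hμ⟩ := hlm _ (List.get_mem U j)
    exact HG.ne_zero_of_isLM (isLM_symbol hA hL hμ) hj
  · intro h hh hh0
    obtain ⟨ν, hν⟩ := HG.exists_isLM hh0
    -- Only the component of h in the degree of its leading monomial is lifted to N; the lift has
    -- leading monomial ν, to which the Gröbner property in L applies.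
    obtain ⟨x, hxN, hx⟩ := hh (ldeg d b ν)
    have hxν := isLM_of_cls_eq hA hL hx hν
    obtain ⟨g, hg, μ, ν', hμ, hν', hd⟩ := hdiv x hxN (HL.ne_zero_of_isLM hxν)
    obtain rfl := HL.isLM_unique hxν hν'
    obtain ⟨γ, rfl⟩ := (HL.divides_iff _ _).1 hd
    obtain ⟨j, hj⟩ := List.get_of_mem hg
    refine ⟨_, hν, _, ⟨j, rfl⟩, γ, ?_⟩
    simp only [hj]
    exact HG.isLM_mon_smul γ (isLM_symbol hA hL hμ)

end FreeModule

/-! ### Standard bases and generators of the associated graded module -/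

section StandardBasis

variable {K A M : Type*} [Field K] [Ring A] [Algebra K A] {FA : RingFiltration K A}
  [AddCommGroup M] [Module K M] [Module A M] [IsScalarTower K A M] {FM : ModuleFiltration FA M}
  {N : Submodule A M} {W : Set M}

/-- With n(v) the filtered degree of v, every class of degree q in G(N) lifts to a combination of W
allowed in degree q. The error lies one filtration step lower, and induction on q absorbs it. -/
theorem ModuleFiltration.isStandardBasis_of_span_symbol (hW : W.Finite) (hWN : W ⊆ N)
    (h0 : 0 ∉ W) (hspan : Submodule.span FA.Gr (FM.symbol '' W) = FM.grSubmodule N) :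
    FM.IsStandardBasis N W := by
  refine ⟨hWN, hW.preimage Subtype.val_injective.injOn, fun h => h0 h, fun v => FM.deg v, ?_⟩
  set T : ℕ → Submodule K N := fun q => ⨆ v ∈ ((↑) ⁻¹' W : Set N),
    Submodule.span K {x : N | ∃ p, p + FM.deg v ≤ q ∧ ∃ r ∈ FA.F p, x = r • v} with hT
  have hTF : ∀ q, T q ≤ (FM.induced N).F q := by
    intro q
    refine iSup₂_le fun v _ => Submodule.span_le.2 ?_
    rintro _ ⟨p, hp, r, hr, rfl⟩
    exact FM.mono hp (FM.smul_mem hr (Nat.sInf_mem (FM.exhaustive (v : M))))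
  have hTmono : Monotone T := by
    intro q q' hq
    refine iSup₂_mono fun v _ => Submodule.span_mono ?_
    rintro _ ⟨p, hp, r, hr, rfl⟩
    exact ⟨p, hp.trans hq, r, hr, rfl⟩
  have hlift : ∀ h ∈ Submodule.span FA.Gr (FM.symbol '' W), ∀ q, ∃ y ∈ T q,
      ∃ hy : (y : M) ∈ FM.F q, cls FM.F q ⟨y, hy⟩ = h q := by
    intro h hh
    induction hh using Submodule.closure_induction with
    | zero => exact fun q => ⟨0, zero_mem _, zero_mem _, map_zero _⟩
    | add g h _ _ hg hh =>
      intro q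
      obtain ⟨y, hy, hy', e1⟩ := hg q
      obtain ⟨z, hz, hz', e2⟩ := hh q
      refine ⟨y + z, add_mem hy hz, add_mem hy' hz', ?_⟩
      rw [DirectSum.add_apply, ← e1, ← e2]
      rfl
    | smul_mem r w hw =>
      obtain ⟨v, hv, rfl⟩ := hw
      induction r using gr_induction with
      | zero =>
        intro q
        refine ⟨0, zero_mem _, zero_mem _, ?_⟩
        rw [zero_smul]
        exact map_zero _
      | add r r' hr hr' =>
        intro q
        obtain ⟨y, hy, hy', e1⟩ := hr q
        obtain ⟨z, hz, hz', e2⟩ := hr' q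
        refine ⟨y + z, add_mem hy hz, add_mem hy' hz', ?_⟩
        rw [add_smul, DirectSum.add_apply, ← e1, ← e2]
        rfl
      | of p x =>
        intro q
        have hvd : v ∈ FM.F (FM.deg v) := Nat.sInf_mem (FM.exhaustive v)
        have e1 : toGr FA.F p x • FM.symbol v = toGr FM.F (p + FM.deg v)
            ⟨(x : A) • v, FM.smul_mem x.2 hvd⟩ := toGr_smul_toGr FM x ⟨v, hvd⟩
        rw [e1]
        by_cases hq : p + FM.deg v = q
        · subst hq
          refine ⟨(x : A) • ⟨v, hWN hv⟩, ?_, FM.smul_mem x.2 hvd, ?_⟩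
          · refine Submodule.mem_iSup_of_mem ⟨v, hWN hv⟩ (Submodule.mem_iSup_of_mem hv ?_)
            exact Submodule.subset_span ⟨p, le_rfl, x, x.2, rfl⟩
          · rw [toGr_apply_same]
            rfl
        · refine ⟨0, zero_mem _, zero_mem _, ?_⟩
          rw [toGr_apply_of_ne _ hq]
          exact map_zero _
  intro q
  refine le_antisymm ?_ (hTF q)
  suffices h : ∀ q, (FM.induced N).F q ≤ T q from h q
  intro q
  -- In degree 0 the error lies in F₋₁ = 0, so the lift is x itself.
  induction q with
  | zero =>
    intro x hx
    obtain ⟨y, hy, hy', e1⟩ := hlift (toGr FM.F 0 ⟨x, hx⟩)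
      (hspan ▸ symbol_mem_grSubmodule FM _ x.2) 0
    rw [toGr_apply_same, cls_eq_iff, lower, Submodule.mem_bot, sub_eq_zero] at e1
    rwa [← show y = x from Subtype.ext e1]
  | succ q ih =>
    intro x hx
    obtain ⟨y, hy, hy', e1⟩ := hlift (toGr FM.F (q + 1) ⟨x, hx⟩)
      (hspan ▸ symbol_mem_grSubmodule FM _ x.2) (q + 1)
    rw [toGr_apply_same, cls_eq_iff, lower] at e1
    have h1 : y - x ∈ T q := ih e1
    have h2 := sub_mem hy (hTmono (Nat.le_succ q) h1)
    rwa [sub_sub_cancel] at h2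

/-- Since v = 1 · v lies in F_{n(v)}N, each n(v) is at least the filtered degree of v. So a term r v
allowed in degree q has as its class in degree q a multiple of σ(v). -/
theorem ModuleFiltration.span_symbol_of_isStandardBasis (hW : FM.IsStandardBasis N W) :
    Submodule.span FA.Gr (FM.symbol '' W) = FM.grSubmodule N := by
  obtain ⟨hWN, -, -, m, hm⟩ := hW
  have hdeg : ∀ v (hv : v ∈ W), FM.deg v ≤ m ⟨v, hWN hv⟩ := by
    intro v hv
    refine Nat.sInf_le ?_
    have h1 : (⟨v, hWN hv⟩ : N) ∈ (FM.induced N).F (m ⟨v, hWN hv⟩) := by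
      rw [hm]
      refine Submodule.mem_iSup_of_mem ⟨v, hWN hv⟩ (Submodule.mem_iSup_of_mem hv ?_)
      exact Submodule.subset_span ⟨0, (zero_add _).le, 1, FA.one_mem, (one_smul _ _).symm⟩
    exact h1
  refine le_antisymm (Submodule.span_le.2 ?_) fun h hh => ?_
  · rintro _ ⟨v, hv, rfl⟩
    exact symbol_mem_grSubmodule FM _ (hWN hv)
  · let S : Submodule K FM.Gr :=
      { carrier := Submodule.span FA.Gr (FM.symbol '' W)
        add_mem' := add_mem
        zero_mem' := zero_mem _
        smul_mem' := fun c x hx => by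
          rw [← gr_algebraMap_smul FM c x]
          exact Submodule.smul_mem _ _ hx }
    have key : ∀ q, (FM.induced N).F q ≤
        ((S.comap (toGr FM.F q)).map (FM.F q).subtype).comap (N.subtype.restrictScalars K) := by
      intro q
      rw [hm]
      refine iSup₂_le fun v hv => Submodule.span_le.2 ?_
      rintro _ ⟨p, hp, r, hr, rfl⟩
      have hd := hdeg v hv
      -- The degree q - deg v, rather than p, makes the product with σ(v) land exactly in degree q;
      -- the class of r there may be zero.
      have hr' : r ∈ FA.F (q - FM.deg v) := FA.mono (by change FM.deg v ≤ m v at hd; omega) hr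
      have hvd : (v : M) ∈ FM.F (FM.deg v) := Nat.sInf_mem (FM.exhaustive (v : M))
      have hq : q - FM.deg (v : M) + FM.deg (v : M) = q :=
        Nat.sub_add_cancel (by change FM.deg v ≤ m v at hd; omega)
      have hrv := FM.smul_mem hr' hvd
      refine ⟨⟨r • (v : M), hq ▸ hrv⟩, ?_, rfl⟩
      change toGr FM.F q ⟨r • (v : M), _⟩ ∈ Submodule.span FA.Gr (FM.symbol '' W)
      have e1 : toGr FA.F (q - FM.deg v) ⟨r, hr'⟩ • FM.symbol v =
          toGr FM.F (q - FM.deg v + FM.deg v) ⟨r • (v : M), hrv⟩ :=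
        toGr_smul_toGr FM ⟨r, hr'⟩ ⟨(v : M), hvd⟩
      rw [← toGr_congr FM.F hq ⟨r • (v : M), hrv⟩ _ rfl, ← e1]
      exact Submodule.smul_mem _ _ (Submodule.subset_span ⟨v, hv, rfl⟩)
    classical
    rw [← DirectSum.sum_support_of h]
    refine sum_mem fun q _ => ?_
    obtain ⟨x, hx, e1⟩ := hh q
    obtain ⟨y, hy, hyx⟩ := key q (show (⟨x, hx⟩ : N) ∈ (FM.induced N).F q from x.2)
    obtain rfl : y = x := Subtype.ext hyx
    rw [← e1]
    exact hy

/-- A set whose symbols, pairwise distinct, minimally generate `G(N)` is a minimal standard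
basis. -/
theorem ModuleFiltration.isMinimalStandardBasis_of_isMinHomGen (hW : W.Finite) (hWN : W ⊆ N)
    (h0 : 0 ∉ W) (hinj : Set.InjOn FM.symbol W)
    (hgen : FM.IsMinHomGen (FM.grSubmodule N) (FM.symbol '' W)) :
    FM.IsMinimalStandardBasis N W := by
  refine ⟨FM.isStandardBasis_of_span_symbol hW hWN h0 hgen.2.2.1, fun W' hW' hstd => ?_⟩
  -- By injectivity of σ on W, a proper subset of W has a proper subset of the symbols, which would
  -- still generate G(N).
  refine hgen.2.2.2 _ ?_ (FM.span_symbol_of_isStandardBasis hstd)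
  exact (hinj.image_ssubset_image_iff hW'.subset subset_rfl).2 hW'

end StandardBasis

/-! ### Irredundant families as minimal generating sets, and the theorem. -/

theorem Irredundant.injOn {R V ι : Type*} [Ring R] [AddCommGroup V] [Module R V] {u : ι → V}
    {J : Set ι} (h : Irredundant R u J) : Set.InjOn u J := by
  intro i hi j hj hij
  by_contra hne
  exact h j hj (Submodule.subset_span ⟨i, ⟨hi, hne⟩, hij⟩)

/-- A proper subset misses some u j and, consisting of values u i, can only use indices i ≠ j; so u
j would be generated by the others. -/
theorem Irredundant.span_ne {R V ι : Type*} [Ring R] [AddCommGroup V] [Module R V] {u : ι → V}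
    {J : Set ι} (h : Irredundant R u J) {Y : Set V} (hY : Y ⊂ u '' J) :
    Submodule.span R Y ≠ Submodule.span R (u '' J) := by
  intro heq
  obtain ⟨_, ⟨j, hj, rfl⟩, hjY⟩ := Set.exists_of_ssubset hY
  have hmem : u j ∈ Submodule.span R Y := by
    rw [heq]
    exact Submodule.subset_span (Set.mem_image_of_mem u hj)
  refine h j hj (Submodule.span_mono (fun y hy => ?_) hmem)
  obtain ⟨i, hi, rfl⟩ := hY.subset hy
  exact ⟨i, ⟨hi, fun hij => hjY (by rwa [← Set.mem_singleton_iff.1 hij])⟩, rfl⟩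

end SolvPoly

open SolvPoly in
theorem theorem5p4 {K A L : Type*} [Field K] [Ring A] [Algebra K A] [AddCommGroup L]
    [Module K L] [Module A L] [IsScalarTower K A L] {n s : ℕ}
    -- `A = K[a₁, …, aₙ]` with the graded monomial ordering `lt` and the positive degrees `d`
    (a : Fin n → A) (lt : (Fin n →₀ ℕ) → (Fin n →₀ ℕ) → Prop) (d : Fin n → ℕ)
    (hA : IsGradedSolvable K a lt d)
    -- `L = ⨁ A eᵢ` with the graded left monomial ordering `ltL` and the degrees `b` of the `eᵢ`
    (e : Module.Basis (Fin s) A L) (b : Fin s → ℕ) (ltL : Idx n s → Idx n s → Prop)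
    (hL : IsGradedLeftMonomialOrdering K a lt d e b ltL)
    -- the generators of the submodule `N`
    (Θ : List L) (hΘ : ∀ θ ∈ Θ, θ ≠ 0) (N : Submodule A L)
    (hN : N = Submodule.span A {θ | θ ∈ Θ}) :
    let FL : ModuleFiltration hA.filtration L := hA.freeFiltration e b
    let σa : Fin n → hA.filtration.Gr := fun i => hA.filtration.symbol (a i)
    let σe : Fin s → FL.Gr := fun i => FL.symbol (e i)
    -- the Buchberger algorithm with input `Θ` terminates with a left Gröbner basis of `N`
    (Terminates (BuchbergerStep K a e ltL) (buchbergerInit K a e ltL Θ) ∧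
      ∀ t, HaltsAt (BuchbergerStep K a e ltL) (buchbergerInit K a e ltL Θ) t →
        t.pending = ∅ ∧ t.work = none ∧ IsLeftGroebner K a e ltL N {g | g ∈ t.gens}) ∧
    ∀ U : List L, IsLeftGroebner K a e ltL N {g | g ∈ U} →
      let σU : Fin U.length → FL.Gr := fun j => FL.symbol (U.get j)
      -- `σ(U)` is a homogeneous left Gröbner basis of `G(N)`
      (∀ j, FL.HomDeg (σU j) (FL.deg (U.get j))) ∧
      IsLeftGroebner K σa σe ltL (FL.grSubmodule N) (Set.range σU) ∧
      -- the selection algorithm with input `σ(U)` terminates with a minimal homogeneous generating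
      -- set of `G(N)`, and the corresponding elements of `U` form a minimal standard basis of `N`
      (Terminates (SelectStep K σa σe ltL FL.HomDeg σU) (selectInit FL.Gr U.length) ∧
        ∀ t, HaltsAt (SelectStep K σa σe ltL FL.HomDeg σU) (selectInit FL.Gr U.length) t →
          t.todo = ∅ ∧ t.work = none ∧ Set.InjOn σU t.kept ∧
          FL.IsMinHomGen (FL.grSubmodule N) (σU '' t.kept) ∧
          FL.IsMinimalStandardBasis N (U.get '' t.kept)) ∧
      -- the same holds for every selection of elements of `U` whose symbols, pairwise distinct,
      -- form a minimal homogeneous generating set of `G(N)`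
      ∀ J : Finset (Fin U.length), Set.InjOn σU J →
        FL.IsMinHomGen (FL.grSubmodule N) (σU '' J) →
        FL.IsMinimalStandardBasis N (U.get '' J) := by
  intro FL σa σe
  have HL := isMonomialModule_free hA hL
  have HG := isGradedMonomialModule_gr hA hL
  subst hN
  refine ⟨⟨HL.buchberger_terminates Θ hΘ, fun t ht => HL.buchberger_correct Θ hΘ ht⟩, ?_⟩
  intro U hU σU
  have hσ : ∀ j, FL.HomDeg (σU j) (FL.deg (U.get j)) := fun j => ⟨_, rfl⟩
  have hGB := isLeftGroebner_symbol hA hL hU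
  have hmem : ∀ j, U.get j ∈ {g | g ∈ U} := fun j => List.get_mem U j
  have hmin : ∀ J : Finset (Fin U.length), Set.InjOn σU J →
      FL.IsMinHomGen (FL.grSubmodule (Submodule.span A {θ | θ ∈ Θ})) (σU '' J) →
      FL.IsMinimalStandardBasis (Submodule.span A {θ | θ ∈ Θ}) (U.get '' J) := by
    intro J hinj hgen
    have himg : FL.symbol '' (U.get '' J) = σU '' J := Set.image_image _ _ _
    refine FL.isMinimalStandardBasis_of_isMinHomGen (J.finite_toSet.image _) ?_ ?_ ?_ ?_
    · rintro _ ⟨j, -, rfl⟩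
      exact hU.2.1 (hmem j)
    · rintro ⟨j, -, hj⟩
      exact hU.2.2.1 (hj ▸ hmem j)
    · rintro _ ⟨i, hi, rfl⟩ _ ⟨j, hj, rfl⟩ hij
      rw [hinj hi hj hij]
    · rwa [himg]
  have hu : ∀ j, σU j ∈ homSpan K (lmon σa σe) (ldeg d b) (FL.deg (U.get j)) :=
    fun j => (homDeg_iff hA hL _ _).1 (hσ j)
  have hu0 : ∀ j, σU j ≠ 0 := fun j h => hGB.2.2.1 ⟨j, h⟩
  refine ⟨hσ, hGB, ⟨HG.select_terminates (homDeg_iff hA hL) hu hu0, fun t ht => ?_⟩, hmin⟩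
  obtain ⟨h1, h2, h3, h4⟩ := HG.select_correct (homDeg_iff hA hL) hu hu0 ht
  -- The selected symbols span the same submodule as σ(U), which is G(N) because a Gröbner basis
  -- generates.
  have h5 : Submodule.span hA.filtration.Gr (σU '' t.kept) =
      FL.grSubmodule (Submodule.span A {θ | θ ∈ Θ}) :=
    h4.trans (HG.span_eq_of_isLeftGroebner hGB)
  have h6 : FL.IsMinHomGen (FL.grSubmodule (Submodule.span A {θ | θ ∈ Θ})) (σU '' t.kept) := by
    refine ⟨t.kept.finite_toSet.image _, ?_, h5, fun Y hY => ?_⟩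
    · rintro _ ⟨j, -, rfl⟩
      exact ⟨_, hσ j⟩
    · rw [← h5]
      exact h3.span_ne hY
  exact ⟨h1, h2, h3.injOn, h6, hmin _ h3.injOn h6⟩
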